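/- Let $M^3$ be a smooth Riemannian manifold of dimension $3$, without boundary, with Levi-Civita connection $\nabla$. Let $I\subset\mathbb R$ be a non-empty open interval, $\beta:I\to M^3$ a smooth regular curve and $V$ a smooth unit vector field parallel along $\beta$. The intrinsic cylinder with basis $\beta$ and rulings parallel to $V$ is the surface $$\mathcal C_{\beta,V}(u,v)=\exp_{\beta(u)}\big(vV(u)\big),\qquad (u,v)\in W,$$ where $W\subset I\times\mathbb R$ is an open set containing $I\times\{0\}$, such that for each $u\in I$ the set $\{v:(u,v)\in W\}$ is an interval, on which $\mathcal C_{\beta,V}$ is defined and is a regular surface (a smooth immersion). The axis of the cylinder is the extension $V(u,v)$ of $V$ obtained by parallel transport of $V(u)$ along the ruling $v\mapsto\mathcal C_{\beta,V}(u,v)$. The cylinder is called intrinsically flat if the Gaussian curvature $K_{int}$ of its induced metric vanishes, and extrinsically flat if $K_{ext}=\det(\mathrm{II})/\det(\mathrm{I})$ vanishes, where $\mathrm I$ and $\mathrm{II}$ are its first and second fundamental forms. A regular curve $\gamma$ in $M^3$ is a generalized helix with axis $X$ if $X$ is a unit vector field parallel along $\gamma$ that makes a constant angle with $\gamma'$.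 **Theorem.** 1. For every intrinsic cylinder $\mathcal C_{\beta,V}$ in $M^3$ the following are equivalent: (a) the axis $V$ is parallel along every smooth curve of $\mathcal C_{\beta,V}$; (b) $\mathcal C_{\beta,V}$ is both intrinsically and extrinsically flat; (c) every (non-constant) geodesic of $\mathcal C_{\beta,V}$ is a generalized helix whose axis is the axis $V$ of the cylinder. 2. The following are equivalent: (a) $M^3$ is flat, i.e. its Riemann curvature tensor vanishes; (b) for every intrinsic cylinder $\mathcal C_{\beta,V}$ in $M^3$, the axis $V$ is parallel along every smooth curve of $\mathcal C_{\beta,V}$; (c) for every intrinsic cylinder $\mathcal C_{\beta,V}$ in $M^3$, every (non-constant) geodesic of $\mathcal C_{\beta,V}$ is a generalized helix whose axis is the axis $V$ of the cylinder. -/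

import Mathlib

open Set Bundle
open scoped Manifold ContDiff

noncomputable section

/-! ### Riemannian geometry in coordinates -/

/-- The Christoffel symbols of a metric `g` given on (an open part of) a vector space, as the
bilinear map `Γ` determined by
`g (Γ a b) c = (1/2) * (D_a g (b, c) + D_b g (a, c) - D_c g (a, b))`. -/
def christoffel {E : Type*} [NormedAddCommGroup E] [NormedSpace ℝ E]
    (g : E → E →L[ℝ] E →L[ℝ] ℝ) (y a b : E) : E :=
  let koszul : E →L[ℝ] ℝ := (1 / 2 : ℝ) •
    (fderiv ℝ (fun z => g z b) y a + fderiv ℝ (fun z => g z a) y b - fderiv ℝ (fun z => g z a b) y)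
  (g y).inverse koszul

/-- The Riemann curvature tensor `R(a, b) c = ∇_a ∇_b c - ∇_b ∇_a c` (for coordinate-constant
fields `a, b, c`) of a metric given on (an open part of) a vector space. -/
def riemannCurvature {E : Type*} [NormedAddCommGroup E] [NormedSpace ℝ E]
    (g : E → E →L[ℝ] E →L[ℝ] ℝ) (y a b c : E) : E :=
  fderiv ℝ (fun z => christoffel g z b c) y a - fderiv ℝ (fun z => christoffel g z a c) y b
    + christoffel g y a (christoffel g y b c) - christoffel g y b (christoffel g y a c)

/-- The Gaussian curvature of a metric on (an open part of) the coordinate plane. -/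
def gaussCurvature (g : ℝ × ℝ → ℝ × ℝ →L[ℝ] ℝ × ℝ →L[ℝ] ℝ) (p : ℝ × ℝ) : ℝ :=
  g p (riemannCurvature g p (1, 0) (0, 1) (0, 1)) (1, 0) /
    (g p (1, 0) (1, 0) * g p (0, 1) (0, 1) - g p (1, 0) (0, 1) ^ 2)

/-! ### Riemannian three-manifolds -/

/-- The model space of three-manifolds. -/
abbrev E3 : Type := EuclideanSpace ℝ (Fin 3)

section Manifold

variable {M : Type*} [TopologicalSpace M] [ChartedSpace E3 M]

/-- The velocity field of a curve. -/
def velocity (γ : ℝ → M) (t : ℝ) : TangentSpace (𝓡 3) (γ t) :=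
  mfderiv 𝓘(ℝ, ℝ) (𝓡 3) γ t (1 : ℝ)

/-- The coordinate field `∂f/∂u`. -/
def partialU (f : ℝ × ℝ → M) (p : ℝ × ℝ) : TangentSpace (𝓡 3) (f p) :=
  mfderiv 𝓘(ℝ, ℝ × ℝ) (𝓡 3) f p ((1, 0) : ℝ × ℝ)

/-- The coordinate field `∂f/∂v`. -/
def partialV (f : ℝ × ℝ → M) (p : ℝ × ℝ) : TangentSpace (𝓡 3) (f p) :=
  mfderiv 𝓘(ℝ, ℝ × ℝ) (𝓡 3) f p ((0, 1) : ℝ × ℝ)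

variable [IsManifold (𝓡 3) ∞ M] [RiemannianBundle (fun x : M => TangentSpace (𝓡 3) x)]

/-- The Riemannian metric of `M` in the coordinates of the chart at `x₀`. (The standard
trivialization of the tangent bundle at `x₀` is the one given by the coordinate vector fields of
that chart.) -/
def chartMetric (x₀ : M) (y : E3) : E3 →L[ℝ] E3 →L[ℝ] ℝ :=
  let x : M := (extChartAt (𝓡 3) x₀).symm y
  let L : E3 →L[ℝ] TangentSpace (𝓡 3) x :=
    (trivializationAt E3 (fun z : M => TangentSpace (𝓡 3) z) x₀).symmL ℝ x
  (innerSL ℝ : TangentSpace (𝓡 3) x →L[ℝ] TangentSpace (𝓡 3) x →L[ℝ] ℝ).bilinearComp L L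

variable (M) in
/-- `M` is flat: its Riemann curvature tensor vanishes identically. -/
def IsFlat : Prop :=
  ∀ (x₀ : M), ∀ y ∈ (extChartAt (𝓡 3) x₀).target, ∀ a b c : E3,
    riemannCurvature (chartMetric x₀) y a b c = 0

/-- The Levi-Civita covariant derivative `(D X / dt)(t)` of a vector field `X` along a curve `γ`,
computed in the chart at `γ t` as `ξ' + Γ(y', ξ)`, where `y` and `ξ` are the coordinates of `γ`
and `X`. -/
def covDeriv (γ : ℝ → M) (X : ∀ t, TangentSpace (𝓡 3) (γ t)) (t : ℝ) :
    TangentSpace (𝓡 3) (γ t) :=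
  let e := trivializationAt E3 (fun z : M => TangentSpace (𝓡 3) z) (γ t)
  let y : ℝ → E3 := fun s => extChartAt (𝓡 3) (γ t) (γ s)
  let ξ : ℝ → E3 := fun s => e.continuousLinearMapAt ℝ (γ s) (X s)
  e.symmL ℝ (γ t) (deriv ξ t + christoffel (chartMetric (γ t)) (y t) (deriv y t) (ξ t))

/-- The smooth vector field `X` along `γ` is parallel on the (open) set `J` of parameters. -/
def IsParallelOn (γ : ℝ → M) (X : ∀ t, TangentSpace (𝓡 3) (γ t)) (J : Set ℝ) : Prop :=
  ContMDiffOn 𝓘(ℝ, ℝ) (𝓡 3).tangent ∞ (fun t => (⟨γ t, X t⟩ : TangentBundle (𝓡 3) M)) J ∧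
    ∀ t ∈ J, covDeriv γ X t = 0

/-- `γ` is a smooth geodesic of `M` on the (open) set `J` of parameters. -/
def IsGeodesicOn (γ : ℝ → M) (J : Set ℝ) : Prop :=
  ContMDiffOn 𝓘(ℝ, ℝ) (𝓡 3) ∞ γ J ∧ ∀ t ∈ J, covDeriv γ (velocity γ) t = 0

/-- The geodesic with initial velocity `w` exists (at least) up to time `1`, along `γ`. -/
def IsExpCurve (w : TangentBundle (𝓡 3) M) (γ : ℝ → M) : Prop :=
  (∃ ε > 0, IsGeodesicOn γ (Ioo (-ε) (1 + ε))) ∧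
    (⟨γ 0, velocity γ 0⟩ : TangentBundle (𝓡 3) M) = w

variable (M) in
/-- The domain of the exponential map. -/
def expDomain : Set (TangentBundle (𝓡 3) M) := {w | ∃ γ : ℝ → M, IsExpCurve w γ}

open Classical in
/-- The exponential map: `exp w = γ 1`, where `γ` is the geodesic with initial velocity `w`. (The
value outside `expDomain` is irrelevant.) -/
def expMap (w : TangentBundle (𝓡 3) M) : M :=
  if h : w ∈ expDomain M then h.choose 1 else w.proj

open Classical in
/-- The parallel transport along `γ`, over the interval `J`, of the vector `w` tangent to `M` at
`γ t₀`, as a vector field along `γ`. -/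
def parallelTransport (γ : ℝ → M) (J : Set ℝ) (t₀ : ℝ) (w : TangentBundle (𝓡 3) M) (t : ℝ) :
    TangentSpace (𝓡 3) (γ t) :=
  if h : ∃ X : ∀ t, TangentSpace (𝓡 3) (γ t),
      IsParallelOn γ X J ∧ (⟨γ t₀, X t₀⟩ : TangentBundle (𝓡 3) M) = w
  then h.choose t else 0

/-- On the interval `J`, the regular curve `γ` is a (parallel) generalized helix with axis `X`:
`X` is a unit field, parallel along `γ`, that makes a constant angle with the tangent of `γ`. -/
def IsGeneralizedHelixOn (γ : ℝ → M) (X : ∀ t, TangentSpace (𝓡 3) (γ t)) (J : Set ℝ) : Prop :=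
  ContMDiffOn 𝓘(ℝ, ℝ) (𝓡 3) ∞ γ J ∧ (∀ t ∈ J, velocity γ t ≠ 0) ∧
    IsParallelOn γ X J ∧ (∀ t ∈ J, ‖X t‖ = 1) ∧
    ∃ θ : ℝ, ∀ t ∈ J, InnerProductGeometry.angle (velocity γ t) (X t) = θ

/-! ### Parametrized surfaces -/

/-- The first fundamental form (induced metric) of a parametrized surface. -/
def firstFundamentalForm (f : ℝ × ℝ → M) (p : ℝ × ℝ) : ℝ × ℝ →L[ℝ] ℝ × ℝ →L[ℝ] ℝ :=
  let L : ℝ × ℝ →L[ℝ] TangentSpace (𝓡 3) (f p) := mfderiv 𝓘(ℝ, ℝ × ℝ) (𝓡 3) f p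
  (innerSL ℝ : TangentSpace (𝓡 3) (f p) →L[ℝ] TangentSpace (𝓡 3) (f p) →L[ℝ] ℝ).bilinearComp L L

/-- `ν` is a unit normal of the surface `f` at the parameter `p`. -/
def IsUnitNormal (f : ℝ × ℝ → M) (p : ℝ × ℝ) (ν : TangentSpace (𝓡 3) (f p)) : Prop :=
  ‖ν‖ = 1 ∧ inner ℝ (partialU f p) ν = 0 ∧ inner ℝ (partialV f p) ν = 0

/-- The extrinsic curvature `(h₁₁ h₂₂ - h₁₂²) / (g₁₁ g₂₂ - g₁₂²)` of the surface `f` at the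
parameter `(u, v)`, computed with the unit normal `ν`. -/
def extrinsicCurvature (f : ℝ × ℝ → M) (u v : ℝ) (ν : TangentSpace (𝓡 3) (f (u, v))) : ℝ :=
  let h₁₁ : ℝ := inner ℝ (covDeriv (fun s => f (s, v)) (fun s => partialU f (s, v)) u) ν
  let h₁₂ : ℝ := inner ℝ (covDeriv (fun s => f (s, v)) (fun s => partialV f (s, v)) u) ν
  let h₂₂ : ℝ := inner ℝ (covDeriv (fun s => f (u, s)) (fun s => partialV f (u, s)) v) ν
  let g := firstFundamentalForm f (u, v)
  (h₁₁ * h₂₂ - h₁₂ ^ 2) / (g (1, 0) (1, 0) * g (0, 1) (0, 1) - g (1, 0) (0, 1) ^ 2)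

/-- The curve with parameter functions `c` is a geodesic of the parametrized surface `f`, i.e. a
geodesic of the induced metric. -/
def IsSurfaceGeodesicOn (f : ℝ × ℝ → M) (c : ℝ → ℝ × ℝ) (J : Set ℝ) : Prop :=
  ContDiffOn ℝ ∞ c J ∧ ∀ t ∈ J,
    deriv (deriv c) t +
      christoffel (firstFundamentalForm f) (c t) (deriv c t) (deriv c t) = 0

end Manifold

/-! ### Intrinsic cylinders -/

section Cylinder

variable (M : Type*) [TopologicalSpace M] [ChartedSpace E3 M] [IsManifold (𝓡 3) ∞ M]
  [RiemannianBundle (fun x : M => TangentSpace (𝓡 3) x)]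

/-- An intrinsic cylinder `(u, v) ↦ exp_{β(u)} (v V(u))`: the basis `β` is a curve on an open
interval `I`, the director `V` is a unit field parallel along `β`, and the surface is considered on
an open neighbourhood `W` of `I × {0}`, swept out by segments of rulings that start on `β`, on which
it is defined and a regular surface, i.e. a smooth immersion. -/
structure IntrinsicCylinder where
  /-- the interval of definition of the basis -/
  I : Set ℝ
  isOpen_I : IsOpen I
  ordConnected_I : I.OrdConnected
  nonempty_I : I.Nonempty
  /-- the basis -/
  β : ℝ → M
  /-- the director -/
  V : ∀ u, TangentSpace (𝓡 3) (β u)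
  smooth_β : ContMDiffOn 𝓘(ℝ, ℝ) (𝓡 3) ∞ β I
  regular_β : ∀ u ∈ I, velocity β u ≠ 0
  parallel_V : IsParallelOn β V I
  norm_V : ∀ u ∈ I, ‖V u‖ = 1
  /-- the domain of the parametrization -/
  W : Set (ℝ × ℝ)
  isOpen_W : IsOpen W
  fst_mem : ∀ p ∈ W, p.1 ∈ I
  basis_mem : ∀ u ∈ I, (u, (0 : ℝ)) ∈ W
  ordConnected_ruling : ∀ u ∈ I, {v : ℝ | (u, v) ∈ W}.OrdConnected
  mem_expDomain : ∀ p ∈ W, (⟨β p.1, p.2 • V p.1⟩ : TangentBundle (𝓡 3) M) ∈ expDomain M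
  smooth : ContMDiffOn 𝓘(ℝ, ℝ × ℝ) (𝓡 3) ∞
    (fun p : ℝ × ℝ => expMap (⟨β p.1, p.2 • V p.1⟩ : TangentBundle (𝓡 3) M)) W
  immersion : ∀ p ∈ W, Function.Injective (mfderiv 𝓘(ℝ, ℝ × ℝ) (𝓡 3)
    (fun p : ℝ × ℝ => expMap (⟨β p.1, p.2 • V p.1⟩ : TangentBundle (𝓡 3) M)) p)

namespace IntrinsicCylinder

variable {M}
variable (C : IntrinsicCylinder M)

/-- The parametrization `(u, v) ↦ exp_{β(u)} (v V(u))`. -/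
def param (p : ℝ × ℝ) : M :=
  expMap (⟨C.β p.1, p.2 • C.V p.1⟩ : TangentBundle (𝓡 3) M)

/-- The axis: the extension of `V` to the cylinder by parallel transport along the rulings. -/
def axis (p : ℝ × ℝ) : TangentSpace (𝓡 3) (C.param p) :=
  parallelTransport (fun v => C.param (p.1, v)) {v : ℝ | (p.1, v) ∈ C.W} 0 ⟨C.β p.1, C.V p.1⟩ p.2

/-- The axis is parallel along every (smooth) curve of the cylinder. -/
def AxisParallel : Prop :=
  ∀ (J : Set ℝ) (c : ℝ → ℝ × ℝ), IsOpen J → J.OrdConnected → ContDiffOn ℝ ∞ c J →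
    MapsTo c J C.W → IsParallelOn (fun t => C.param (c t)) (fun t => C.axis (c t)) J

/-- The Gaussian curvature of the induced metric vanishes. -/
def IntrinsicallyFlat : Prop :=
  ∀ p ∈ C.W, gaussCurvature (firstFundamentalForm C.param) p = 0

/-- The extrinsic curvature vanishes. -/
def ExtrinsicallyFlat : Prop :=
  ∀ u v, (u, v) ∈ C.W → ∀ ν : TangentSpace (𝓡 3) (C.param (u, v)),
    IsUnitNormal C.param (u, v) ν → extrinsicCurvature C.param u v ν = 0

/-- Every (regular) geodesic of the cylinder is a generalized helix whose axis is the axis of the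
cylinder. -/
def GeodesicsAreHelices : Prop :=
  ∀ (J : Set ℝ) (c : ℝ → ℝ × ℝ), IsOpen J → J.OrdConnected → MapsTo c J C.W →
    IsSurfaceGeodesicOn C.param c J → (∀ t ∈ J, deriv c t ≠ 0) →
      IsGeneralizedHelixOn (fun t => C.param (c t)) (fun t => C.axis (c t)) J

end IntrinsicCylinder

end Cylinder

end

noncomputable section

/-! Everything is governed by the field `A = ∇_u ∂_v` (`axisDeriv`), the derivative of the axis
across the rulings. The rulings are geodesics with initial velocity `V(u)`, so the axis is the
coordinate field `∂_v` (`axis_eq`) and `∇_v ∂_v = 0`. Along a curve `(u(t), v(t))` of the cylinder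
the axis therefore has covariant derivative `u' A` (`covDeriv_axis`), and it is parallel along every
curve exactly when `A = 0` (`axisParallel_iff`). Two facts hold on every cylinder: `A = 0` on the
basis, because `V` is parallel along `β`, and `A ⊥ ∂_v`, because `∂_v` has unit length.

Each flatness condition kills one of the two remaining components of `A`. Normal part: `h₂₂ = 0`, so
`det II = -⟨A, ν⟩²` (`extrinsicCurvature_eq_zero_iff`). Tangential part: the induced metric is `E
du² + 2F du dv + dv²` with `F_v = 0` and `E_v = 2⟨A, ∂_u⟩`. If its curvature vanishes, the intrinsic
derivative of `∂_v` in the direction `∂_u` is parallel along the rulings; it is zero on the basis,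
hence zero everywhere, so `E_v = 0` (`gaussCurvature_eq_zero`, `intrinsicallyFlat_iff`).

For helices, a surface geodesic leaving `p` in the direction `∂_u` detects `A` at `p`. Conversely,
if `A = 0` then `∂_v` is parallel for the induced connection, so it makes a constant angle with
every surface geodesic (`geodesicsAreHelices_iff`).

Finally `∇_v A = R(∂_v, ∂_u)∂_v` (`coordVec_covDir_axisDeriv`). In a flat manifold `A` is thus
parallel along the rulings and starts at zero. Conversely, a cylinder exists through each point with
any independent basis direction `a` and unit director `b` (`exists_of_chart`). If all these
cylinders have `A = 0`, then `R(b, a)b = 0` for all such `a, b`, and polarization with the first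
Bianchi identity gives `R = 0` (`IsMetricOn.riemannCurvature_eq_zero`).

The construction of these cylinders, and of geodesics on a cylinder, rests on smooth dependence of
solutions of differential equations on initial values. This is obtained from the inverse function
theorem applied to the integral equation in `C([0, 1], E)`. -/

/-! ### Smooth dependence of solutions of differential equations on the initial value -/

/-! ### Superposition operators `γ ↦ F ∘ γ` on spaces of continuous maps -/

section Nemytskii

set_option maxSynthPendingDepth 3

variable {K : Type*} [TopologicalSpace K] [CompactSpace K]
  {E : Type} [NormedAddCommGroup E] [NormedSpace ℝ E]
  {E' : Type} [NormedAddCommGroup E'] [NormedSpace ℝ E']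

/-- Pointwise application of a continuous family of linear maps to a continuous family of
vectors. -/
def pointwiseApply (K : Type*) [TopologicalSpace K] [CompactSpace K]
    (E : Type) [NormedAddCommGroup E] [NormedSpace ℝ E]
    (E' : Type) [NormedAddCommGroup E'] [NormedSpace ℝ E'] :
    C(K, E →L[ℝ] E') →L[ℝ] C(K, E) →L[ℝ] C(K, E') :=
  LinearMap.mkContinuous₂
    (LinearMap.mk₂ ℝ (fun (A : C(K, E →L[ℝ] E')) (h : C(K, E)) =>
        (⟨fun t => A t (h t), by fun_prop⟩ : C(K, E')))
      (fun A B h => by ext; simp) (fun c A h => by ext; simp)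
      (fun A h k => by ext; simp) (fun c A h => by ext; simp)) 1
    (fun A h => by
      rw [ContinuousMap.norm_le _ (by positivity)]
      intro t
      simp only [LinearMap.mk₂_apply, ContinuousMap.coe_mk, one_mul]
      exact ((A t).le_opNorm _).trans (mul_le_mul (A.norm_coe_le_norm t) (h.norm_coe_le_norm t)
        (norm_nonneg _) (norm_nonneg _)))

/-- The range of `γ` is compact, so `F'` is uniformly continuous near it; the mean value inequality
on balls of one common radius makes the remainder small uniformly in the parameter. -/
lemma hasFDerivAt_continuousMap_comp {F : E → E'} (hF : ContDiff ℝ 1 F) (γ : C(K, E)) :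
    HasFDerivAt (fun γ : C(K, E) => (⟨F, hF.continuous⟩ : C(E, E')).comp γ)
      (pointwiseApply K E E'
        ((⟨fderiv ℝ F, hF.continuous_fderiv (by norm_num)⟩ : C(E, E →L[ℝ] E')).comp γ)) γ := by
  have hcont : Continuous (fderiv ℝ F) := hF.continuous_fderiv (by norm_num)
  rw [hasFDerivAt_iff_isLittleO_nhds_zero, Asymptotics.isLittleO_iff]
  intro c hc
  have hcomp : IsCompact (range γ) := isCompact_range γ.continuous
  obtain ⟨δ, hδ, H⟩ : ∃ δ > 0, ∀ x ∈ range γ, ∀ y, dist x y < δ →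
      dist (fderiv ℝ F x) (fderiv ℝ F y) < c := by
    have h1 := hcomp.uniformContinuousAt_of_continuousAt (fderiv ℝ F)
      (fun x _ => hcont.continuousAt) (Metric.dist_mem_uniformity hc)
    obtain ⟨δ, hδ, h2⟩ := Metric.mem_uniformity_dist.1 h1
    exact ⟨δ, hδ, fun x hx y hxy => h2 hxy hx⟩
  filter_upwards [Metric.ball_mem_nhds (0 : C(K, E)) hδ] with h hh
  rw [ContinuousMap.norm_le _ (by positivity)]
  intro t
  have hht : ‖h t‖ < δ := (h.norm_coe_le_norm t).trans_lt (by simpa using hh)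
  have key := (convex_ball (γ t) δ).norm_image_sub_le_of_norm_hasFDerivWithin_le'
    (f := F) (f' := fderiv ℝ F) (φ := fderiv ℝ F (γ t)) (C := c) (x := γ t) (y := γ t + h t)
    (fun x _ => ((hF.differentiable (by norm_num)) x).hasFDerivAt.hasFDerivWithinAt)
    (fun x hx => by
      rw [← dist_eq_norm, dist_comm]
      exact (H (γ t) ⟨t, rfl⟩ x (by rw [dist_comm]; exact hx)).le)
    (Metric.mem_ball_self hδ) (by simpa [dist_eq_norm] using hht)
  simp only [add_sub_cancel_left] at key
  refine key.trans ?_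
  exact mul_le_mul_of_nonneg_left (h.norm_coe_le_norm t) hc.le

/-- The derivative is again a superposition operator, that of `F'`, followed by the bounded bilinear
map `pointwiseApply`. The target space is generalized in the induction because `F'` takes its values
in `E →L[ℝ] E'`. -/
lemma contDiff_continuousMap_comp_nat (n : ℕ) :
    ∀ {E' : Type} [NormedAddCommGroup E'] [NormedSpace ℝ E'] {F : E → E'} (hF : ContDiff ℝ n F),
      ContDiff ℝ n (fun γ : C(K, E) => (⟨F, hF.continuous⟩ : C(E, E')).comp γ) := by
  induction n with
  | zero =>
    intro E' _ _ F hF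
    simp only [Nat.cast_zero, contDiff_zero]
    exact ContinuousMap.continuous_postcomp _
  | succ n ih =>
    intro E' _ _ F hF
    have h1 : ContDiff ℝ 1 F := hF.of_le (by exact_mod_cast Nat.le_add_left 1 n)
    have hd : ContDiff ℝ n (fderiv ℝ F) := hF.fderiv_right le_rfl
    have key : ∀ m : WithTop ℕ∞, m = (n : WithTop ℕ∞) + 1 →
        ContDiff ℝ m (fun γ : C(K, E) => (⟨F, hF.continuous⟩ : C(E, E')).comp γ) := by
      rintro m rfl
      rw [contDiff_succ_iff_hasFDerivAt]
      exact ⟨_, (pointwiseApply K E E').contDiff.comp (ih hd),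
        fun γ => hasFDerivAt_continuousMap_comp h1 γ⟩
    exact key _ (by push_cast; rfl)

lemma contDiff_continuousMap_comp {F : E → E'} (hF : ContDiff ℝ ∞ F) :
    ContDiff ℝ ∞ (fun γ : C(K, E) => (⟨F, hF.continuous⟩ : C(E, E')).comp γ) :=
  contDiff_infty.2 fun n => contDiff_continuousMap_comp_nat n (contDiff_infty.1 hF n)

end Nemytskii

/-! ### Local flows from the inverse function theorem in a space of curves -/

section Flow

set_option maxSynthPendingDepth 3

open Filter Topology intervalIntegral MeasureTheory

variable {E : Type} [NormedAddCommGroup E] [NormedSpace ℝ E] [CompleteSpace E]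

/-- The primitive vanishing at `0` of a continuous curve on the unit interval. -/
def unitPrimitive (E : Type) [NormedAddCommGroup E] [NormedSpace ℝ E] [CompleteSpace E] :
    C(Icc (0 : ℝ) 1, E) →L[ℝ] C(Icc (0 : ℝ) 1, E) :=
  LinearMap.mkContinuous
    { toFun := fun γ => ⟨fun t => ∫ s in (0 : ℝ)..t, IccExtend zero_le_one γ s, by
        have h : Continuous (IccExtend (zero_le_one' ℝ) γ) := γ.continuous.Icc_extend'
        exact (continuous_primitive (fun a b => h.intervalIntegrable a b) 0).comp
          continuous_subtype_val⟩
      map_add' := fun γ η => by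
        have h (γ : C(Icc (0 : ℝ) 1, E)) : Continuous (IccExtend (zero_le_one' ℝ) γ) :=
          γ.continuous.Icc_extend'
        ext t
        simp only [ContinuousMap.coe_mk, ContinuousMap.add_apply]
        rw [← integral_add ((h γ).intervalIntegrable _ _) ((h η).intervalIntegrable _ _)]
        rfl
      map_smul' := fun c γ => by
        ext t
        simp only [ContinuousMap.coe_mk, ContinuousMap.smul_apply, RingHom.id_apply]
        rw [← intervalIntegral.integral_smul]
        rfl } 1
    (fun γ => by
      rw [ContinuousMap.norm_le _ (by positivity)]
      intro t
      have h := norm_integral_le_of_norm_le_const (a := 0) (b := (t : ℝ))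
        (f := IccExtend (zero_le_one' ℝ) γ) (C := ‖γ‖) (fun s _ => γ.norm_coe_le_norm _)
      refine h.trans ?_
      rw [sub_zero, abs_of_nonneg t.2.1, one_mul]
      exact mul_le_of_le_one_right (norm_nonneg _) t.2.2)

lemma unitPrimitive_apply (γ : C(Icc (0 : ℝ) 1, E)) (t : Icc (0 : ℝ) 1) :
    unitPrimitive E γ t = ∫ s in (0 : ℝ)..t, IccExtend zero_le_one γ s := rfl

/-- The map whose zeros `(x, ε, γ) ↦ (x, ε, 0)` are the solutions of
`γ' = ε F(γ)`, `γ 0 = x`, on the unit interval. -/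
def integralEquation (F : E → E) (hF : Continuous F) (z : E × ℝ × C(Icc (0 : ℝ) 1, E)) :
    E × ℝ × C(Icc (0 : ℝ) 1, E) :=
  (z.1, z.2.1, z.2.2 - ContinuousMap.const _ z.1 -
    z.2.1 • unitPrimitive E ((⟨F, hF⟩ : C(E, E)).comp z.2.2))

/-- Constant maps, as a continuous linear map. -/
def constL (E : Type) [NormedAddCommGroup E] [NormedSpace ℝ E] : E →L[ℝ] C(Icc (0 : ℝ) 1, E) :=
  LinearMap.mkContinuous
    { toFun := fun x => ContinuousMap.const _ x
      map_add' := fun _ _ => rfl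
      map_smul' := fun _ _ => rfl } 1
    (fun x => by
      rw [ContinuousMap.norm_le _ (by positivity)]
      intro t
      simp only [one_mul]
      exact le_rfl)

lemma contDiff_integralEquation {F : E → E} (hF : ContDiff ℝ ∞ F) :
    ContDiff ℝ ∞ (integralEquation F hF.continuous) := by
  have h1 : ContDiff ℝ ∞ (fun z : E × ℝ × C(Icc (0 : ℝ) 1, E) =>
      (⟨F, hF.continuous⟩ : C(E, E)).comp z.2.2) :=
    (contDiff_continuousMap_comp hF).comp (contDiff_snd.comp contDiff_snd)
  have h2 : ContDiff ℝ ∞ (fun z : E × ℝ × C(Icc (0 : ℝ) 1, E) => constL E z.1) :=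
    (constL E).contDiff.comp contDiff_fst
  have h3 := (unitPrimitive E).contDiff.comp h1
  have h4 : ContDiff ℝ ∞ (fun z : E × ℝ × C(Icc (0 : ℝ) 1, E) => z.2.1) := by fun_prop
  have h5 : ContDiff ℝ ∞ (fun z : E × ℝ × C(Icc (0 : ℝ) 1, E) => z.2.2) := by fun_prop
  exact contDiff_fst.prodMk (h4.prodMk ((h5.sub h2).sub (h4.smul h3)))

/-- A shear of a product. -/
def shearEquiv (c : C(Icc (0 : ℝ) 1, E)) :
    (E × ℝ × C(Icc (0 : ℝ) 1, E)) ≃L[ℝ] (E × ℝ × C(Icc (0 : ℝ) 1, E)) :=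
  ContinuousLinearEquiv.equivOfInverse
    ((ContinuousLinearMap.fst ℝ _ _).prod
      (((ContinuousLinearMap.fst ℝ _ _).comp (ContinuousLinearMap.snd ℝ _ _)).prod
        (((ContinuousLinearMap.snd ℝ _ _).comp (ContinuousLinearMap.snd ℝ _ _))
          - (constL E).comp (ContinuousLinearMap.fst ℝ _ _)
          - ((ContinuousLinearMap.fst ℝ _ _).comp (ContinuousLinearMap.snd ℝ _ _)).smulRight c)))
    ((ContinuousLinearMap.fst ℝ _ _).prod
      (((ContinuousLinearMap.fst ℝ _ _).comp (ContinuousLinearMap.snd ℝ _ _)).prod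
        (((ContinuousLinearMap.snd ℝ _ _).comp (ContinuousLinearMap.snd ℝ _ _))
          + (constL E).comp (ContinuousLinearMap.fst ℝ _ _)
          + ((ContinuousLinearMap.fst ℝ _ _).comp (ContinuousLinearMap.snd ℝ _ _)).smulRight c)))
    (fun z => by ext <;> simp; abel) (fun z => by ext <;> simp; abel)

/-- At `ε = 0` the nonlinear term `ε • ∫ F(γ)` contributes to the derivative only through the
variation of `ε`, so the derivative is triangular with identity diagonal, hence invertible whatever
`F` is. -/
lemma hasFDerivAt_integralEquation {F : E → E} (hF : ContDiff ℝ ∞ F) (x₀ : E) :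
    HasFDerivAt (integralEquation F hF.continuous)
      (shearEquiv (unitPrimitive E ((⟨F, hF.continuous⟩ : C(E, E)).comp
        (ContinuousMap.const _ x₀))) : (E × ℝ × C(Icc (0 : ℝ) 1, E)) →L[ℝ] _)
      (x₀, 0, ContinuousMap.const _ x₀) := by
  have h1 : HasFDerivAt (fun z : E × ℝ × C(Icc (0 : ℝ) 1, E) => z.1)
    (ContinuousLinearMap.fst ℝ _ _) (x₀, 0, ContinuousMap.const _ x₀) := hasFDerivAt_fst
  have h2 : HasFDerivAt (fun z : E × ℝ × C(Icc (0 : ℝ) 1, E) => z.2)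
    (ContinuousLinearMap.snd ℝ _ _) (x₀, 0, ContinuousMap.const _ x₀) := hasFDerivAt_snd
  have h3 := h2.fst
  have h4 := h2.snd
  have h5 := (constL E).hasFDerivAt.comp (x₀, (0 : ℝ), ContinuousMap.const (Icc (0 : ℝ) 1) x₀) h1
  have h6 : DifferentiableAt ℝ (fun z : E × ℝ × C(Icc (0 : ℝ) 1, E) =>
      unitPrimitive E ((⟨F, hF.continuous⟩ : C(E, E)).comp z.2.2))
      (x₀, 0, ContinuousMap.const _ x₀) :=
    ((unitPrimitive E).contDiff.comp ((contDiff_continuousMap_comp hF).comp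
      (contDiff_snd.comp contDiff_snd))).differentiable (by simp) _
  have h7 := h1.prodMk (h3.prodMk ((h4.sub h5).sub (h3.smul h6.hasFDerivAt)))
  refine h7.congr_fderiv ?_
  ext z <;> simp [shearEquiv]

/-- Smooth dependence on parameters: the local inverse of `integralEquation`. -/
lemma exists_smooth_solution {F : E → E} (hF : ContDiff ℝ ∞ F) (x₀ : E) :
    ∃ δ > 0, ∃ r > 0, ∃ S : E × ℝ → C(Icc (0 : ℝ) 1, E),
      ContDiffOn ℝ ∞ S (Metric.ball x₀ δ ×ˢ Ioo (-δ) δ) ∧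
      S (x₀, 0) = ContinuousMap.const _ x₀ ∧
      ∀ x ∈ Metric.ball x₀ δ, ∀ ε ∈ Ioo (-δ) δ,
        dist (S (x, ε)) (ContinuousMap.const _ x₀) < r ∧
        ∀ γ : C(Icc (0 : ℝ) 1, E), dist γ (ContinuousMap.const _ x₀) < r →
          (γ = S (x, ε) ↔ γ = ContinuousMap.const _ x +
            ε • unitPrimitive E ((⟨F, hF.continuous⟩ : C(E, E)).comp γ)) := by
  set z₀ : E × ℝ × C(Icc (0 : ℝ) 1, E) := (x₀, 0, ContinuousMap.const _ x₀) with hz₀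
  set Ψ := integralEquation F hF.continuous with hΨ
  have hsm := contDiff_integralEquation hF
  set P := hsm.contDiffAt.toOpenPartialHomeomorph Ψ (hasFDerivAt_integralEquation hF x₀)
    (by simp) with hP
  have hPc : ∀ z, P z = Ψ z := fun z => rfl
  have hz₀s : z₀ ∈ P.source := ContDiffAt.mem_toOpenPartialHomeomorph_source _ _ _
  have hΨz₀ : Ψ z₀ = (x₀, 0, 0) := by
    simp [hΨ, integralEquation, hz₀]
  -- Smoothness of the local inverse is needed on a whole neighbourhood, so the derivative must be
  -- invertible near `z₀` and not only there; invertible operators form an open set.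
  have hinv : ∀ᶠ z in 𝓝 z₀, ∃ e : (E × ℝ × C(Icc (0 : ℝ) 1, E)) ≃L[ℝ] (E × ℝ × C(Icc (0 : ℝ) 1, E)),
      (e : _ →L[ℝ] _) = fderiv ℝ Ψ z := by
    have hc : Continuous (fderiv ℝ Ψ) := hsm.continuous_fderiv (by simp)
    have := (hasFDerivAt_integralEquation hF x₀).fderiv
    have h : range ((↑) : ((E × ℝ × C(Icc (0 : ℝ) 1, E)) ≃L[ℝ] (E × ℝ × C(Icc (0 : ℝ) 1, E))) →
        (E × ℝ × C(Icc (0 : ℝ) 1, E)) →L[ℝ] (E × ℝ × C(Icc (0 : ℝ) 1, E))) ∈ 𝓝 (fderiv ℝ Ψ z₀) := by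
      rw [this]
      exact ContinuousLinearEquiv.nhds _
    exact hc.continuousAt.eventually h
  have hsrc : ∀ᶠ z in 𝓝 z₀, z ∈ P.source := P.open_source.mem_nhds hz₀s
  obtain ⟨r, hr, H⟩ := Metric.eventually_nhds_iff.1 (hinv.and hsrc)
  -- the inverse
  have hsymm : P.symm (x₀, 0, 0) = z₀ := by
    rw [← hΨz₀, ← hPc, P.left_inv hz₀s]
  have ht₀ : (x₀, (0 : ℝ), (0 : C(Icc (0 : ℝ) 1, E))) ∈ P.target := by
    rw [← hΨz₀, ← hPc]; exact P.map_source hz₀s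
  have hcont : ContinuousAt P.symm (x₀, 0, 0) := P.continuousAt_symm ht₀
  have hιc : Continuous (fun q : E × ℝ => (q.1, q.2, (0 : C(Icc (0 : ℝ) 1, E)))) := by fun_prop
  have h1 : ∀ᶠ q : E × ℝ in 𝓝 (x₀, 0), (q.1, q.2, (0 : C(Icc (0 : ℝ) 1, E))) ∈ P.target ∧
      dist (P.symm (q.1, q.2, 0)) z₀ < r := by
    have h2 : ∀ᶠ y in 𝓝 (x₀, (0 : ℝ), (0 : C(Icc (0 : ℝ) 1, E))), y ∈ P.target ∧
        dist (P.symm y) z₀ < r := by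
      refine Filter.Eventually.and (P.open_target.mem_nhds ht₀) ?_
      have h : ∀ᶠ y in 𝓝 (P.symm (x₀, 0, 0)), dist y z₀ < r := by
        rw [hsymm]
        exact Metric.ball_mem_nhds _ hr
      exact hcont.eventually h
    exact (hιc.tendsto (x₀, 0)).eventually h2
  obtain ⟨δ', hδ', H'⟩ := Metric.eventually_nhds_iff.1 h1
  have hmem : ∀ q ∈ Metric.ball x₀ (min δ' r) ×ˢ Ioo (-(min δ' r)) (min δ' r),
      dist q (x₀, 0) < min δ' r := by
    rintro ⟨x, ε⟩ ⟨hx, hε⟩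
    rw [Prod.dist_eq]
    refine max_lt hx ?_
    rw [Real.dist_eq, sub_zero]
    exact abs_lt.2 hε
  -- `δ'` keeps `(x, ε, 0)` in the domain of the inverse. Bounding by `r` too puts `(x, ε, γ)` in
  -- the `r`-ball about `z₀`, where `Ψ` is injective; this gives the uniqueness clause.
  refine ⟨min δ' r, lt_min hδ' hr, r, hr, fun q => (P.symm (q.1, q.2, 0)).2.2, ?_, ?_, ?_⟩
  · intro q hq
    obtain ⟨ha, hb⟩ := H' ((hmem q hq).trans_le (min_le_left _ _))
    obtain ⟨⟨e, he⟩, -⟩ := H hb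
    have hd : ContDiffAt ℝ ∞ P.symm (q.1, q.2, 0) := by
      refine P.contDiffAt_symm (f₀' := e) ha ?_ hsm.contDiffAt
      rw [he]
      exact (hsm.differentiable (by simp) _).hasFDerivAt
    have hι : ContDiffAt ℝ ∞ (fun q : E × ℝ => (q.1, q.2, (0 : C(Icc (0 : ℝ) 1, E)))) q := by
      fun_prop
    have h3 := hd.comp q hι
    exact (contDiffAt_snd.comp q (contDiffAt_snd.comp q h3)).contDiffWithinAt
  · simp [hsymm, hz₀]
  · intro x hx ε hε
    have hq := hmem (x, ε) ⟨hx, hε⟩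
    obtain ⟨ha, hb⟩ := H' (hq.trans_le (min_le_left _ _))
    have hright : Ψ (P.symm (x, ε, 0)) = (x, ε, 0) := P.right_inv ha
    have e1 : (P.symm (x, ε, 0)).1 = x := congrArg (fun z => z.1) hright
    have e2 : (P.symm (x, ε, 0)).2.1 = ε := congrArg (fun z => z.2.1) hright
    refine ⟨?_, fun γ hγ => ?_⟩
    · rw [Prod.dist_eq, Prod.dist_eq] at hb
      exact (le_max_right _ _).trans_lt ((le_max_right _ _).trans_lt hb)
    · have hγs : (x, ε, γ) ∈ P.source := by
        refine (H ?_).2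
        rw [Prod.dist_eq] at hq ⊢
        rw [Prod.dist_eq]
        exact max_lt ((le_max_left _ _).trans_lt (hq.trans_le (min_le_right _ _)))
          (max_lt ((le_max_right _ _).trans_lt (hq.trans_le (min_le_right _ _))) hγ)
      constructor
      · intro h
        have h4 : P.symm (x, ε, 0) = (x, ε, γ) := by
          rw [h]; exact Prod.ext e1 (Prod.ext e2 rfl)
        rw [h4] at hright
        have h5 : γ - ContinuousMap.const _ x -
          ε • unitPrimitive E ((⟨F, hF.continuous⟩ : C(E, E)).comp γ) = 0 :=
          congrArg (fun z => z.2.2) hright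
        rw [sub_sub, sub_eq_zero] at h5
        exact h5
      · intro h
        have h6 : Ψ (x, ε, γ) = (x, ε, 0) := by
          refine Prod.ext rfl (Prod.ext rfl ?_)
          change γ - ContinuousMap.const _ x -
            ε • unitPrimitive E ((⟨F, hF.continuous⟩ : C(E, E)).comp γ) = 0
          rw [sub_sub, sub_eq_zero]
          exact h
        have h7 : P.symm (x, ε, 0) = (x, ε, γ) := by
          rw [← h6, ← hPc, P.left_inv hγs]
        simp only [h7]

/-- A globally defined smooth vector field has a smooth local flow. -/
lemma exists_smooth_flow_of_contDiff {F : E → E} (hF : ContDiff ℝ ∞ F) (x₀ : E) :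
    ∃ δ > 0, ∃ φ : E × ℝ → E,
      ContDiffOn ℝ ∞ φ (Metric.ball x₀ δ ×ˢ Ioo (-δ) δ) ∧
      ∀ x ∈ Metric.ball x₀ δ, φ (x, 0) = x ∧
        ∀ t ∈ Ioo (-δ) δ, HasDerivAt (fun s => φ (x, s)) (F (φ (x, t))) t := by
  obtain ⟨δ, hδ, r, hr, S, hS, -, H⟩ := exists_smooth_solution hF x₀
  have I0 : (0 : ℝ) ∈ Icc (0 : ℝ) 1 := by simp
  have I1 : (1 : ℝ) ∈ Icc (0 : ℝ) 1 := by simp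
  have hev : ContDiff ℝ ∞ (fun γ : C(Icc (0 : ℝ) 1, E) => γ ⟨1, I1⟩) :=
    (ContinuousMap.evalCLM ℝ (⟨1, I1⟩ : Icc (0 : ℝ) 1) : C(Icc (0 : ℝ) 1, E) →L[ℝ] E).contDiff
  have hφ : ContDiffOn ℝ ∞ (fun q => S q ⟨1, I1⟩) (Metric.ball x₀ δ ×ˢ Ioo (-δ) δ) :=
    hev.comp_contDiffOn hS
  -- Running the field `ε F` for unit time is running `F` for time `ε`, so the flow is the endpoint
  -- of the solution with parameter `ε`.
  refine ⟨δ, hδ, fun q => S q ⟨1, I1⟩, hφ, fun x hx => ?_⟩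
  -- the integral equation
  have hint : ∀ ε ∈ Ioo (-δ) δ, ∀ t : Icc (0 : ℝ) 1, S (x, ε) t =
      x + ε • ∫ s in (0 : ℝ)..t, F (IccExtend zero_le_one (S (x, ε)) s) := by
    intro ε hε t
    obtain ⟨h1, h2⟩ := H x hx ε hε
    have h3 := congrArg (fun γ : C(Icc (0 : ℝ) 1, E) => γ t) ((h2 _ h1).1 rfl)
    exact h3
  -- The slowed curve `t ↦ S(x, ε)(s t)` solves the equation with parameter `ε s` and stays within
  -- `r` of the constant curve, so it is the solution by uniqueness.
  have hscale : ∀ ε ∈ Ioo (-δ) δ, ∀ s : Icc (0 : ℝ) 1, S (x, ε) s = S (x, ε * s) ⟨1, I1⟩ := by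
    intro ε hε s
    have hεs : ε * s ∈ Ioo (-δ) δ := by
      rw [mem_Ioo, ← abs_lt] at hε ⊢
      rw [abs_mul, abs_of_nonneg s.2.1]
      exact (mul_le_of_le_one_right (abs_nonneg _) s.2.2).trans_lt hε
    obtain ⟨h1, -⟩ := H x hx ε hε
    obtain ⟨-, h2⟩ := H x hx (ε * s) hεs
    set m : C(Icc (0 : ℝ) 1, Icc (0 : ℝ) 1) :=
      ⟨fun t => ⟨s * t, mul_nonneg s.2.1 t.2.1, mul_le_one₀ s.2.2 t.2.1 t.2.2⟩, by fun_prop⟩ with hm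
    have h3 : dist ((S (x, ε)).comp m) (ContinuousMap.const _ x₀) < r := by
      refine lt_of_le_of_lt ?_ h1
      rw [ContinuousMap.dist_le dist_nonneg]
      intro t
      exact ContinuousMap.dist_apply_le_dist (f := S (x, ε)) (g := ContinuousMap.const _ x₀) (m t)
    have h4 : (S (x, ε)).comp m = S (x, ε * s) := by
      rw [h2 _ h3]
      ext t
      simp only [ContinuousMap.comp_apply, ContinuousMap.add_apply, ContinuousMap.smul_apply,
        ContinuousMap.const_apply, unitPrimitive_apply]
      rw [hint ε hε, mul_smul]
      congr 2
      have h5 := intervalIntegral.smul_integral_comp_mul_left (a := 0) (b := (t : ℝ))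
        (fun y => F (IccExtend zero_le_one (S (x, ε)) y)) (s : ℝ)
      rw [mul_zero] at h5
      change ∫ y in (0 : ℝ)..(s * t : ℝ), _ = _
      rw [← h5]
      congr 1
      refine intervalIntegral.integral_congr fun y hy => ?_
      rw [uIcc_of_le t.2.1] at hy
      have hy' : y ∈ Icc (0 : ℝ) 1 := ⟨hy.1, hy.2.trans t.2.2⟩
      rw [IccExtend_of_mem _ _ hy', IccExtend_of_mem (x := (s : ℝ) * y) _ _
        ⟨mul_nonneg s.2.1 hy'.1, mul_le_one₀ s.2.2 hy'.1 hy'.2⟩]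
      rfl
    rw [← h4]
    simp only [ContinuousMap.comp_apply]
    congr 1
    exact Subtype.ext (by simp [hm])
  have hcontS : ContinuousOn (fun t : ℝ => S (x, t) ⟨1, I1⟩) (Ioo (-δ) δ) :=
    hφ.continuousOn.comp (by fun_prop) (fun t ht => ⟨hx, ht⟩)
  -- The substitution `τ = ε y` turns the equation on the unit interval into the usual integral
  -- equation in the time `ε`.
  have hprim : ∀ ε ∈ Ioo (-δ) δ, S (x, ε) ⟨1, I1⟩ =
      x + ∫ τ in (0 : ℝ)..ε, F (S (x, τ) ⟨1, I1⟩) := by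
    intro ε hε
    rw [hint ε hε]
    congr 1
    have h5 := intervalIntegral.smul_integral_comp_mul_left (a := 0) (b := (1 : ℝ))
        (fun y => F (S (x, y) ⟨1, I1⟩)) ε
    rw [mul_zero, mul_one] at h5
    rw [← h5]
    congr 1
    refine intervalIntegral.integral_congr fun y hy => ?_
    rw [uIcc_of_le zero_le_one] at hy
    rw [IccExtend_of_mem _ _ hy, hscale ε hε]
  have h0 : (0 : ℝ) ∈ Ioo (-δ) δ := ⟨by linarith, hδ⟩
  refine ⟨(hprim 0 h0).trans (by rw [intervalIntegral.integral_same, add_zero]), fun t ht => ?_⟩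
  have hcF : ContinuousOn (fun τ : ℝ => F (S (x, τ) ⟨1, I1⟩)) (Ioo (-δ) δ) :=
    hF.continuous.comp_continuousOn hcontS
  have hsub : uIcc 0 t ⊆ Ioo (-δ) δ := (ordConnected_Ioo).uIcc_subset h0 ht
  have hd : HasDerivAt (fun ε => ∫ τ in (0 : ℝ)..ε, F (S (x, τ) ⟨1, I1⟩))
      (F (S (x, t) ⟨1, I1⟩)) t :=
    intervalIntegral.integral_hasDerivAt_right ((hcF.mono hsub).intervalIntegrable)
      (hcF.stronglyMeasurableAtFilter isOpen_Ioo t ht)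
      (hcF.continuousAt (isOpen_Ioo.mem_nhds ht))
  refine (hd.const_add x).congr_of_eventuallyEq ?_
  filter_upwards [isOpen_Ioo.mem_nhds ht] with ε hε using hprim ε hε

/-- A smooth vector field on an open set has a smooth local flow. -/
theorem exists_smooth_flow [FiniteDimensional ℝ E] {U : Set E} (hU : IsOpen U) {F : E → E}
    (hF : ContDiffOn ℝ ∞ F U) {x₀ : E} (hx₀ : x₀ ∈ U) :
    ∃ δ > 0, ∃ φ : E × ℝ → E,
      ContDiffOn ℝ ∞ φ (Metric.ball x₀ δ ×ˢ Ioo (-δ) δ) ∧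
      ∀ x ∈ Metric.ball x₀ δ, φ (x, 0) = x ∧
        ∀ t ∈ Ioo (-δ) δ, φ (x, t) ∈ U ∧ HasDerivAt (fun s => φ (x, s)) (F (φ (x, t))) t := by
  obtain ⟨R, hR, hRU⟩ := Metric.nhds_basis_closedBall.mem_iff.1 (hU.mem_nhds hx₀)
  -- Cutting off makes the field globally smooth. For short times the flow stays in the ball of
  -- radius `R / 2`, where `χ = 1` and the field is unchanged.
  let χ : ContDiffBump x₀ := ⟨R / 2, R, by positivity, by linarith⟩
  have hG : ContDiff ℝ ∞ (fun x => χ x • F x) := by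
    rw [contDiff_iff_contDiffAt]
    intro x
    by_cases hx : x ∈ U
    · exact χ.contDiff.contDiffAt.smul (hF.contDiffAt (hU.mem_nhds hx))
    · have hx' : x ∈ (Metric.closedBall x₀ R)ᶜ := fun h => hx (hRU h)
      refine (contDiffAt_const (c := (0 : E))).congr_of_eventuallyEq ?_
      filter_upwards [Metric.isClosed_closedBall.isOpen_compl.mem_nhds hx'] with y hy
      have : χ y = 0 := by
        rw [← Function.notMem_support, χ.support_eq]
        exact fun h => hy (Metric.ball_subset_closedBall h)
      rw [this, zero_smul]
  obtain ⟨δ, hδ, φ, hφ, H⟩ := exists_smooth_flow_of_contDiff hG x₀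
  have hmem : (x₀, (0 : ℝ)) ∈ Metric.ball x₀ δ ×ˢ Ioo (-δ) δ :=
    ⟨Metric.mem_ball_self hδ, by linarith, hδ⟩
  have hopen : IsOpen (Metric.ball x₀ δ ×ˢ Ioo (-δ) δ) := Metric.isOpen_ball.prod isOpen_Ioo
  have hc : ContinuousAt φ (x₀, 0) := hφ.continuousOn.continuousAt (hopen.mem_nhds hmem)
  have hev : ∀ᶠ q in 𝓝 (x₀, (0 : ℝ)), φ q ∈ Metric.ball x₀ (R / 2) := by
    have h : Metric.ball x₀ (R / 2) ∈ 𝓝 (φ (x₀, 0)) := by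
      rw [(H x₀ (Metric.mem_ball_self hδ)).1]
      exact Metric.ball_mem_nhds _ (by positivity)
    exact hc.eventually h
  obtain ⟨ε, hε, Hε⟩ := Metric.eventually_nhds_iff.1 hev
  have hb : Metric.ball x₀ (min δ ε) ⊆ Metric.ball x₀ δ := Metric.ball_subset_ball (min_le_left _ _)
  have hI : Ioo (-(min δ ε)) (min δ ε) ⊆ Ioo (-δ) δ :=
    Ioo_subset_Ioo (neg_le_neg (min_le_left _ _)) (min_le_left _ _)
  refine ⟨min δ ε, lt_min hδ hε, φ, hφ.mono (prod_mono hb hI), fun x hx =>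
    ⟨(H x (hb hx)).1, fun t ht => ?_⟩⟩
  have h1 : φ (x, t) ∈ Metric.ball x₀ (R / 2) := by
    refine Hε ?_
    rw [Prod.dist_eq]
    refine max_lt (hx.trans_le (min_le_right _ _)) ?_
    rw [Real.dist_eq, sub_zero]
    exact (abs_lt.2 ht).trans_le (min_le_right _ _)
  refine ⟨hRU (Metric.ball_subset_closedBall (Metric.ball_subset_ball (by linarith) h1)), ?_⟩
  have h2 := (H x (hb hx)).2 t (hI ht)
  have h3 : χ (φ (x, t)) = 1 := χ.one_of_mem_closedBall (Metric.ball_subset_closedBall h1)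
  rwa [h3, one_smul] at h2

end Flow

/-! ### Local Riemannian geometry -/

section LocalGeometry

set_option maxSynthPendingDepth 3

open Filter Topology

variable {E : Type*} [NormedAddCommGroup E] [NormedSpace ℝ E]
  {P : Type*} [NormedAddCommGroup P] [NormedSpace ℝ P]

lemma two_le_infty : (2 : WithTop ℕ∞) ≤ ∞ := ENat.LEInfty.out

/-- `g` is a smooth Riemannian metric on the open set `U` of a vector space. -/
structure IsMetricOn (g : E → E →L[ℝ] E →L[ℝ] ℝ) (U : Set E) : Prop where
  isOpen : IsOpen U
  contDiffOn : ContDiffOn ℝ ∞ g U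
  symm : ∀ y ∈ U, ∀ a b, g y a b = g y b a
  pos : ∀ y ∈ U, ∀ a, a ≠ 0 → 0 < g y a a

/-- The lower-index Christoffel symbols, as a bilinear map with values in the dual. -/
def koszulForm (g : E → E →L[ℝ] E →L[ℝ] ℝ) (y : E) : E →L[ℝ] E →L[ℝ] E →L[ℝ] ℝ :=
  (1 / 2 : ℝ) • (fderiv ℝ g y + (fderiv ℝ g y).flip -
    ((ContinuousLinearMap.flipₗᵢ ℝ E E ℝ : (E →L[ℝ] E →L[ℝ] ℝ) →L[ℝ] (E →L[ℝ] E →L[ℝ] ℝ))).comp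
      (fderiv ℝ g y).flip)

lemma koszulForm_apply (g : E → E →L[ℝ] E →L[ℝ] ℝ) (y a b c : E) :
    koszulForm g y a b c = (1 / 2 : ℝ) *
      (fderiv ℝ g y a b c + fderiv ℝ g y b a c - fderiv ℝ g y c a b) := rfl

/-- The Christoffel symbols as a continuous bilinear map. -/
def christoffelB (g : E → E →L[ℝ] E →L[ℝ] ℝ) (y : E) : E →L[ℝ] E →L[ℝ] E :=
  (ContinuousLinearMap.compL ℝ E (E →L[ℝ] ℝ) E (g y).inverse).comp (koszulForm g y)

/-- Evaluation at fixed vectors commutes with `fderiv` at a point of differentiability. The bilinear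
form of the symbols is the one to which product rules and smoothness arguments apply. -/
lemma christoffel_eq {g : E → E →L[ℝ] E →L[ℝ] ℝ} {y : E} (hg : DifferentiableAt ℝ g y)
    (a b : E) : christoffel g y a b = christoffelB g y a b := by
  have h1 (b : E) : fderiv ℝ (fun z => g z b) y = (fderiv ℝ g y).flip b := by
    rw [fderiv_clm_apply hg (differentiableAt_const b)]
    simp
  have h2 : fderiv ℝ (fun z => g z a b) y = ((fderiv ℝ g y).flip a).flip b := by
    have h3 : DifferentiableAt ℝ (fun z => g z a) y := hg.clm_apply (differentiableAt_const a)
    rw [fderiv_clm_apply h3 (differentiableAt_const b), h1]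
    simp
  simp only [christoffel, h1, h2]
  rfl

namespace IsMetricOn

variable {g : E → E →L[ℝ] E →L[ℝ] ℝ} {U : Set E}

lemma contDiffAt (hg : IsMetricOn g U) {y : E} (hy : y ∈ U) : ContDiffAt ℝ ∞ g y :=
  hg.contDiffOn.contDiffAt (hg.isOpen.mem_nhds hy)

lemma differentiableAt (hg : IsMetricOn g U) {y : E} (hy : y ∈ U) : DifferentiableAt ℝ g y :=
  (hg.contDiffAt hy).differentiableAt (by simp)

lemma ext_left (hg : IsMetricOn g U) {y : E} (hy : y ∈ U) {a b : E}
    (h : ∀ c, g y a c = g y b c) : a = b := by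
  by_contra hab
  have h1 := hg.pos y hy (a - b) (sub_ne_zero.2 hab)
  rw [ContinuousLinearMap.map_sub₂, h, sub_self] at h1
  exact lt_irrefl _ h1

lemma fderiv_apply_apply (hg : IsMetricOn g U) {y : E} (hy : y ∈ U) (a b c : E) :
    fderiv ℝ (fun z => g z b c) y a = fderiv ℝ g y a b c := by
  have hd := hg.differentiableAt hy
  have h3 : DifferentiableAt ℝ (fun z => g z b) y := hd.clm_apply (differentiableAt_const b)
  rw [fderiv_clm_apply h3 (differentiableAt_const c),
    fderiv_clm_apply hd (differentiableAt_const b)]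
  simp

lemma fderiv_symm (hg : IsMetricOn g U) {y : E} (hy : y ∈ U) (a b c : E) :
    fderiv ℝ g y a b c = fderiv ℝ g y a c b := by
  rw [← hg.fderiv_apply_apply hy, ← hg.fderiv_apply_apply hy]
  have : (fun z => g z b c) =ᶠ[𝓝 y] (fun z => g z c b) := by
    filter_upwards [hg.isOpen.mem_nhds hy] with z hz using hg.symm z hz b c
  rw [this.fderiv_eq]

variable [FiniteDimensional ℝ E]

/-- The metric as an isomorphism with the dual space. -/
lemma exists_equiv (hg : IsMetricOn g U) {y : E} (hy : y ∈ U) :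
    ∃ e : E ≃L[ℝ] (E →L[ℝ] ℝ), (e : E →L[ℝ] (E →L[ℝ] ℝ)) = g y := by
  have hinj : Function.Injective (g y) := fun a b hab =>
    hg.ext_left hy fun c => by rw [hab]
  have hdim : Module.finrank ℝ E = Module.finrank ℝ (E →L[ℝ] ℝ) := by
    rw [← (LinearMap.toContinuousLinearMap : (E →ₗ[ℝ] ℝ) ≃ₗ[ℝ] (E →L[ℝ] ℝ)).finrank_eq]
    exact (Subspace.dual_finrank_eq (K := ℝ) (V := E)).symm
  refine ⟨(LinearEquiv.ofInjectiveOfFinrankEq (g y : E →ₗ[ℝ] (E →L[ℝ] ℝ)) hinj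
    hdim).toContinuousLinearEquiv, ?_⟩
  ext a b
  rfl

lemma apply_inverse (hg : IsMetricOn g U) {y : E} (hy : y ∈ U) (k : E →L[ℝ] ℝ) :
    g y ((g y).inverse k) = k := by
  obtain ⟨e, he⟩ := hg.exists_equiv hy
  rw [← he]
  simp

lemma apply_christoffelB (hg : IsMetricOn g U) {y : E} (hy : y ∈ U) (a b c : E) :
    g y (christoffelB g y a b) c = koszulForm g y a b c := by
  change g y ((g y).inverse (koszulForm g y a b)) c = _
  rw [hg.apply_inverse hy]

lemma christoffelB_symm (hg : IsMetricOn g U) {y : E} (hy : y ∈ U) (a b : E) :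
    christoffelB g y a b = christoffelB g y b a := by
  refine hg.ext_left hy fun c => ?_
  rw [hg.apply_christoffelB hy, hg.apply_christoffelB hy, koszulForm_apply, koszulForm_apply,
    hg.fderiv_symm hy c a b]
  ring

/-- A positive definite metric is an isomorphism onto the dual, and inversion of operators is smooth
at isomorphisms. -/
lemma contDiffOn_christoffelB (hg : IsMetricOn g U) : ContDiffOn ℝ ∞ (christoffelB g) U := by
  intro y hy
  have hd : ContDiffAt ℝ ∞ (fderiv ℝ g) y := (hg.contDiffAt hy).fderiv_right (by simp)
  have hflip : ContDiffAt ℝ ∞ (fun z => (fderiv ℝ g z).flip) y :=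
    (ContinuousLinearMap.flipₗᵢ ℝ E E (E →L[ℝ] ℝ)).contDiff.contDiffAt.comp y hd
  have hk : ContDiffAt ℝ ∞ (koszulForm g) y := by
    have h3 : ContDiffAt ℝ ∞ (fun z => ((ContinuousLinearMap.flipₗᵢ ℝ E E ℝ :
        (E →L[ℝ] E →L[ℝ] ℝ) →L[ℝ] (E →L[ℝ] E →L[ℝ] ℝ))).comp (fderiv ℝ g z).flip) y :=
      contDiffAt_const.clm_comp hflip
    exact ((hd.add hflip).sub h3).const_smul (1 / 2 : ℝ)
  have hinv : ContDiffAt ℝ ∞ (fun z => (g z).inverse) y := by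
    obtain ⟨e, he⟩ := hg.exists_equiv hy
    have : ContDiffAt ℝ ∞ ContinuousLinearMap.inverse (g y) := by
      rw [← he]
      exact contDiffAt_map_inverse e
    exact this.comp y (hg.contDiffAt hy)
  have hc : ContDiffAt ℝ ∞
      (fun z => ContinuousLinearMap.compL ℝ E (E →L[ℝ] ℝ) E (g z).inverse) y :=
    (ContinuousLinearMap.compL ℝ E (E →L[ℝ] ℝ) E).contDiff.contDiffAt.comp y hinv
  exact (hc.clm_comp hk).contDiffWithinAt

lemma contDiffAt_christoffelB (hg : IsMetricOn g U) {y : E} (hy : y ∈ U) :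
    ContDiffAt ℝ ∞ (christoffelB g) y :=
  hg.contDiffOn_christoffelB.contDiffAt (hg.isOpen.mem_nhds hy)

end IsMetricOn

/-- The covariant derivative, in the direction `w`, of the vector field `ξ` along the map `φ`. -/
def covD (g : E → E →L[ℝ] E →L[ℝ] ℝ) (φ ξ : P → E) (p w : P) : E :=
  fderiv ℝ ξ p w + christoffelB g (φ p) (fderiv ℝ φ p w) (ξ p)

lemma covD_add_dir (g : E → E →L[ℝ] E →L[ℝ] ℝ) (φ ξ : P → E) (p w w' : P) :
    covD g φ ξ p (w + w') = covD g φ ξ p w + covD g φ ξ p w' := by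
  simp only [covD, map_add, add_apply]
  abel

lemma covD_smul_dir (g : E → E →L[ℝ] E →L[ℝ] ℝ) (φ ξ : P → E) (p w : P) (c : ℝ) :
    covD g φ ξ p (c • w) = c • covD g φ ξ p w := by
  simp only [covD, map_smul, smul_apply, smul_add]

lemma covD_congr {g : E → E →L[ℝ] E →L[ℝ] ℝ} {φ ξ φ' ξ' : P → E} {p : P} (hφ : φ =ᶠ[𝓝 p] φ')
    (hξ : ξ =ᶠ[𝓝 p] ξ') (w : P) : covD g φ ξ p w = covD g φ' ξ' p w := by
  simp only [covD, hφ.fderiv_eq, hξ.fderiv_eq, hφ.eq_of_nhds, hξ.eq_of_nhds]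

/-- The chain rule for covariant derivatives. -/
lemma covD_comp {Q : Type*} [NormedAddCommGroup Q] [NormedSpace ℝ Q]
    (g : E → E →L[ℝ] E →L[ℝ] ℝ) {φ ξ : P → E} {c : Q → P} {q : Q}
    (hφ : DifferentiableAt ℝ φ (c q)) (hξ : DifferentiableAt ℝ ξ (c q))
    (hc : DifferentiableAt ℝ c q) (w : Q) :
    covD g (φ ∘ c) (ξ ∘ c) q w = covD g φ ξ (c q) (fderiv ℝ c q w) := by
  simp only [covD, fderiv_comp q hφ hc, fderiv_comp q hξ hc]
  rfl

lemma contDiffAt_covD [FiniteDimensional ℝ E] {g : E → E →L[ℝ] E →L[ℝ] ℝ} {U : Set E}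
    (hg : IsMetricOn g U) {φ ξ : P → E} {p : P} (hφ : ContDiffAt ℝ ∞ φ p)
    (hξ : ContDiffAt ℝ ∞ ξ p) (hp : φ p ∈ U) (w : P) :
    ContDiffAt ℝ ∞ (fun q => covD g φ ξ q w) p := by
  have h1 : ContDiffAt ℝ ∞ (fderiv ℝ ξ) p := hξ.fderiv_right (by simp)
  have h2 : ContDiffAt ℝ ∞ (fderiv ℝ φ) p := hφ.fderiv_right (by simp)
  have h3 : ContDiffAt ℝ ∞ (fun q => christoffelB g (φ q)) p :=
    (hg.contDiffAt_christoffelB hp).comp p hφ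
  exact (h1.clm_apply contDiffAt_const).add
    ((h3.clm_apply (h2.clm_apply contDiffAt_const)).clm_apply hξ)

/-! ### Metric compatibility, torsion-freeness and the curvature commutator -/

section Identities

variable [FiniteDimensional ℝ E] {g : E → E →L[ℝ] E →L[ℝ] ℝ} {U : Set E}

/-- Compatibility of the covariant derivative with the metric. -/
lemma hasFDerivAt_metric (hg : IsMetricOn g U) {φ ξ η : P → E} {p : P} (hp : φ p ∈ U)
    (hφ : DifferentiableAt ℝ φ p) (hξ : DifferentiableAt ℝ ξ p) (hη : DifferentiableAt ℝ η p) :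
    DifferentiableAt ℝ (fun q => g (φ q) (ξ q) (η q)) p ∧
    ∀ w, fderiv ℝ (fun q => g (φ q) (ξ q) (η q)) p w =
      g (φ p) (covD g φ ξ p w) (η p) + g (φ p) (ξ p) (covD g φ η p w) := by
  have h1 : DifferentiableAt ℝ (fun q => g (φ q)) p := (hg.differentiableAt hp).comp p hφ
  have h1' : fderiv ℝ (fun q => g (φ q)) p = (fderiv ℝ g (φ p)).comp (fderiv ℝ φ p) :=
    fderiv_comp p (hg.differentiableAt hp) hφ
  have h2 : DifferentiableAt ℝ (fun q => g (φ q) (ξ q)) p := h1.clm_apply hξ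
  refine ⟨h2.clm_apply hη, fun w => ?_⟩
  rw [fderiv_clm_apply h2 hη, fderiv_clm_apply h1 hξ, h1']
  simp only [covD, map_add, add_apply, ContinuousLinearMap.comp_apply,
    ContinuousLinearMap.flip_apply]
  rw [hg.apply_christoffelB hp, hg.symm _ hp (ξ p) (christoffelB g (φ p) _ _),
    hg.apply_christoffelB hp, koszulForm_apply, koszulForm_apply,
    hg.fderiv_symm hp _ (η p) (ξ p), hg.fderiv_symm hp (ξ p) _ (η p),
    hg.fderiv_symm hp (η p) _ (ξ p)]
  ring

/-- The covariant derivative is torsion free. -/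
lemma covD_torsion (hg : IsMetricOn g U) {φ : P → E} {p : P} (hp : φ p ∈ U)
    (hφ : ContDiffAt ℝ ∞ φ p) (a b : P) :
    covD g φ (fun q => fderiv ℝ φ q a) p b = covD g φ (fun q => fderiv ℝ φ q b) p a := by
  have h2 : DifferentiableAt ℝ (fderiv ℝ φ) p :=
    (hφ.fderiv_right (m := ∞) (by simp)).differentiableAt (by simp)
  have hs : IsSymmSndFDerivAt ℝ φ p := hφ.isSymmSndFDerivAt (by simpa using two_le_infty)
  simp only [covD, fderiv_clm_apply h2 (differentiableAt_const _)]
  simp only [fderiv_fun_const, Pi.zero_apply, ContinuousLinearMap.comp_zero, zero_add,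
    ContinuousLinearMap.flip_apply]
  rw [hs.eq a b, hg.christoffelB_symm hp]

/-- The curvature tensor measures the failure of covariant derivatives to commute. -/
lemma covD_commutator (hg : IsMetricOn g U) {φ ξ : P → E} {p : P} (hp : φ p ∈ U)
    (hφ : ContDiffAt ℝ ∞ φ p) (hξ : ContDiffAt ℝ ∞ ξ p) (a b : P) :
    covD g φ (fun q => covD g φ ξ q b) p a - covD g φ (fun q => covD g φ ξ q a) p b =
      riemannCurvature g (φ p) (fderiv ℝ φ p a) (fderiv ℝ φ p b) (ξ p) := by
  have hφd : DifferentiableAt ℝ φ p := hφ.differentiableAt (by simp)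
  have hξd : DifferentiableAt ℝ ξ p := hξ.differentiableAt (by simp)
  have h1 : DifferentiableAt ℝ (fderiv ℝ ξ) p :=
    (hξ.fderiv_right (m := ∞) (by simp)).differentiableAt (by simp)
  have h2 : DifferentiableAt ℝ (fderiv ℝ φ) p :=
    (hφ.fderiv_right (m := ∞) (by simp)).differentiableAt (by simp)
  have hΓ : DifferentiableAt ℝ (christoffelB g) (φ p) :=
    (hg.contDiffAt_christoffelB hp).differentiableAt (by simp)
  have h3 : DifferentiableAt ℝ (fun q => christoffelB g (φ q)) p := hΓ.comp p hφd
  have h3' : fderiv ℝ (fun q => christoffelB g (φ q)) p =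
      (fderiv ℝ (christoffelB g) (φ p)).comp (fderiv ℝ φ p) := fderiv_comp p hΓ hφd
  have hsξ : IsSymmSndFDerivAt ℝ ξ p := hξ.isSymmSndFDerivAt (by simpa using two_le_infty)
  have hsφ : IsSymmSndFDerivAt ℝ φ p := hφ.isSymmSndFDerivAt (by simpa using two_le_infty)
  -- Under the exchange of `a` and `b`, the first and third terms are symmetric, by symmetry of
  -- second derivatives, and the fourth and fifth are swapped. Only the second and the last survive
  -- antisymmetrization, and they make up the curvature.
  have key : ∀ a b : P, covD g φ (fun q => covD g φ ξ q b) p a =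
      fderiv ℝ (fderiv ℝ ξ) p a b
      + fderiv ℝ (christoffelB g) (φ p) (fderiv ℝ φ p a) (fderiv ℝ φ p b) (ξ p)
      + christoffelB g (φ p) (fderiv ℝ (fderiv ℝ φ) p a b) (ξ p)
      + christoffelB g (φ p) (fderiv ℝ φ p b) (fderiv ℝ ξ p a)
      + christoffelB g (φ p) (fderiv ℝ φ p a) (fderiv ℝ ξ p b)
      + christoffelB g (φ p) (fderiv ℝ φ p a)
          (christoffelB g (φ p) (fderiv ℝ φ p b) (ξ p)) := by
    intro a b
    have e1 : DifferentiableAt ℝ (fun q => fderiv ℝ ξ q b) p :=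
      h1.clm_apply (differentiableAt_const b)
    have e2 : DifferentiableAt ℝ (fun q => fderiv ℝ φ q b) p :=
      h2.clm_apply (differentiableAt_const b)
    have e3 : DifferentiableAt ℝ (fun q => christoffelB g (φ q) (fderiv ℝ φ q b)) p :=
      h3.clm_apply e2
    have e4 : DifferentiableAt ℝ (fun q => christoffelB g (φ q) (fderiv ℝ φ q b) (ξ q)) p :=
      e3.clm_apply hξd
    simp only [covD]
    rw [fderiv_fun_add e1 e4, fderiv_clm_apply h1 (differentiableAt_const b),
      fderiv_clm_apply e3 hξd, fderiv_clm_apply h3 e2,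
      fderiv_clm_apply h2 (differentiableAt_const b), h3']
    simp only [fderiv_fun_const, Pi.zero_apply, ContinuousLinearMap.comp_zero, zero_add,
      ContinuousLinearMap.flip_apply, add_apply, ContinuousLinearMap.comp_apply, map_add]
    abel
  have hR : ∀ x y z : E, riemannCurvature g (φ p) x y z =
      fderiv ℝ (christoffelB g) (φ p) x y z - fderiv ℝ (christoffelB g) (φ p) y x z
      + christoffelB g (φ p) x (christoffelB g (φ p) y z)
      - christoffelB g (φ p) y (christoffelB g (φ p) x z) := by
    intro x y z
    have e (x y : E) : fderiv ℝ (fun u => christoffel g u y z) (φ p) x =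
        fderiv ℝ (christoffelB g) (φ p) x y z := by
      have : (fun u => christoffel g u y z) =ᶠ[𝓝 (φ p)] fun u => christoffelB g u y z := by
        filter_upwards [hg.isOpen.mem_nhds hp] with u hu
        exact christoffel_eq (hg.differentiableAt hu) _ _
      rw [this.fderiv_eq]
      have e1 : DifferentiableAt ℝ (fun u => christoffelB g u y) (φ p) :=
        hΓ.clm_apply (differentiableAt_const y)
      rw [fderiv_clm_apply e1 (differentiableAt_const z),
        fderiv_clm_apply hΓ (differentiableAt_const y)]
      simp
    simp only [riemannCurvature, e, christoffel_eq (hg.differentiableAt hp)]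
  rw [key, key, hR, hsξ.eq a b, hsφ.eq a b]
  abel

end Identities

/-! ### Invariance under local isometries -/

section Isometry

variable [FiniteDimensional ℝ E] {g : E → E →L[ℝ] E →L[ℝ] ℝ} {U : Set E}
  {E' : Type*} [NormedAddCommGroup E'] [NormedSpace ℝ E'] [FiniteDimensional ℝ E']
  {g' : E' → E' →L[ℝ] E' →L[ℝ] ℝ} {U' : Set E'}

/-- The transformation law of the Christoffel symbols under local isometries. -/
lemma christoffelB_map (hg : IsMetricOn g U) (hg' : IsMetricOn g' U') {τ : E → E'} {y : E}
    (hy : y ∈ U) (hτy : τ y ∈ U') (hτ : ContDiffAt ℝ ∞ τ y)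
    (hiso : ∀ᶠ z in 𝓝 y, ∀ a b, g z a b = g' (τ z) (fderiv ℝ τ z a) (fderiv ℝ τ z b))
    (hsurj : Function.Surjective (fderiv ℝ τ y)) (a b : E) :
    fderiv ℝ (fderiv ℝ τ) y a b + christoffelB g' (τ y) (fderiv ℝ τ y a) (fderiv ℝ τ y b) =
      fderiv ℝ τ y (christoffelB g y a b) := by
  have hs : IsSymmSndFDerivAt ℝ τ y := hτ.isSymmSndFDerivAt (by simpa using two_le_infty)
  have hd1 : DifferentiableAt ℝ τ y := hτ.differentiableAt (by simp)
  have hd2 : DifferentiableAt ℝ (fderiv ℝ τ) y :=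
    (hτ.fderiv_right (m := ∞) (by simp)).differentiableAt (by simp)
  have h1 : DifferentiableAt ℝ (fun q => g' (τ q)) y := (hg'.differentiableAt hτy).comp y hd1
  have h1' : fderiv ℝ (fun q => g' (τ q)) y = (fderiv ℝ g' (τ y)).comp (fderiv ℝ τ y) :=
    fderiv_comp y (hg'.differentiableAt hτy) hd1
  -- The first derivative of the identity expressing that `g` is the pullback of `g'` by `τ`.
  have key (a b c : E) : fderiv ℝ g y a b c =
      fderiv ℝ g' (τ y) (fderiv ℝ τ y a) (fderiv ℝ τ y b) (fderiv ℝ τ y c)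
      + g' (τ y) (fderiv ℝ (fderiv ℝ τ) y a b) (fderiv ℝ τ y c)
      + g' (τ y) (fderiv ℝ (fderiv ℝ τ) y a c) (fderiv ℝ τ y b) := by
    have e : (fun z => g z b c) =ᶠ[𝓝 y]
        fun z => g' (τ z) (fderiv ℝ τ z b) (fderiv ℝ τ z c) := by
      filter_upwards [hiso] with z hz using hz b c
    have e1 (b : E) : DifferentiableAt ℝ (fun q => fderiv ℝ τ q b) y :=
      hd2.clm_apply (differentiableAt_const b)
    rw [← hg.fderiv_apply_apply hy, e.fderiv_eq, fderiv_clm_apply (h1.clm_apply (e1 b)) (e1 c),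
      fderiv_clm_apply h1 (e1 b), fderiv_clm_apply hd2 (differentiableAt_const b),
      fderiv_clm_apply hd2 (differentiableAt_const c), h1']
    simp only [fderiv_fun_const, Pi.zero_apply, ContinuousLinearMap.comp_zero, zero_add,
      ContinuousLinearMap.flip_apply, add_apply, ContinuousLinearMap.comp_apply]
    rw [hg'.symm _ hτy _ (fderiv ℝ (fderiv ℝ τ) y a c)]
    ring
  -- In the Koszul combination of the three instances of `key`, the second derivatives of `τ` cancel
  -- except for `D²τ(a, b)`. Surjectivity lets every test vector be written as `Dτ(c)`.
  refine hg'.ext_left hτy fun c' => ?_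
  obtain ⟨c, rfl⟩ := hsurj c'
  rw [← hiso.self_of_nhds, hg.apply_christoffelB hy, map_add, add_apply,
    hg'.apply_christoffelB hτy, koszulForm_apply, koszulForm_apply, key, key, key,
    hs.eq b a, hs.eq c a, hs.eq c b]
  ring

/-- Covariant derivatives are invariant under local isometries. -/
lemma covD_map (hg : IsMetricOn g U) (hg' : IsMetricOn g' U') {τ : E → E'} {φ ξ : P → E} {p : P}
    (hy : φ p ∈ U) (hτy : τ (φ p) ∈ U') (hτ : ContDiffAt ℝ ∞ τ (φ p))
    (hiso : ∀ᶠ z in 𝓝 (φ p), ∀ a b, g z a b = g' (τ z) (fderiv ℝ τ z a) (fderiv ℝ τ z b))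
    (hsurj : Function.Surjective (fderiv ℝ τ (φ p))) (hφ : DifferentiableAt ℝ φ p)
    (hξ : DifferentiableAt ℝ ξ p) (w : P) :
    covD g' (fun q => τ (φ q)) (fun q => fderiv ℝ τ (φ q) (ξ q)) p w =
      fderiv ℝ τ (φ p) (covD g φ ξ p w) := by
  have hd1 : DifferentiableAt ℝ τ (φ p) := hτ.differentiableAt (by simp)
  have hd2 : DifferentiableAt ℝ (fderiv ℝ τ) (φ p) :=
    (hτ.fderiv_right (m := ∞) (by simp)).differentiableAt (by simp)
  have h1 : DifferentiableAt ℝ (fun q => fderiv ℝ τ (φ q)) p := hd2.comp p hφ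
  have h1' : fderiv ℝ (fun q => fderiv ℝ τ (φ q)) p =
      (fderiv ℝ (fderiv ℝ τ) (φ p)).comp (fderiv ℝ φ p) := fderiv_comp p hd2 hφ
  have h2 : fderiv ℝ (fun q => τ (φ q)) p = (fderiv ℝ τ (φ p)).comp (fderiv ℝ φ p) :=
    fderiv_comp p hd1 hφ
  have := christoffelB_map hg hg' hy hτy hτ hiso hsurj (fderiv ℝ φ p w) (ξ p)
  simp only [covD, map_add, ← this, h2]
  rw [fderiv_clm_apply h1 hξ, h1']
  simp only [ContinuousLinearMap.flip_apply, add_apply, ContinuousLinearMap.comp_apply]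
  abel

end Isometry

end LocalGeometry

/-! ### Coordinates on a Riemannian manifold -/

section Coordinates

open Filter Topology

set_option maxSynthPendingDepth 3

variable {M : Type*} [TopologicalSpace M] [ChartedSpace E3 M]
  {P : Type*} [NormedAddCommGroup P] [NormedSpace ℝ P]

/-- The coordinates of a point of `M` in the chart at `x₀`. -/
def coord (x₀ : M) : M → E3 := extChartAt (𝓡 3) x₀

/-- The point of `M` with given coordinates in the chart at `x₀`. -/
def ofCoord (x₀ : M) : E3 → M := (extChartAt (𝓡 3) x₀).symm

/-- The image of the chart at `x₀`. -/
def coordTarget (x₀ : M) : Set E3 := (extChartAt (𝓡 3) x₀).target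

/-- The domain of the chart at `x₀`. -/
def coordSource (x₀ : M) : Set M := (chartAt E3 x₀).source

lemma isOpen_coordSource (x₀ : M) : IsOpen (coordSource x₀) := (chartAt E3 x₀).open_source

lemma mem_coordSource (x₀ : M) : x₀ ∈ coordSource x₀ := mem_chart_source E3 x₀

lemma isOpen_coordTarget (x₀ : M) : IsOpen (coordTarget x₀) := isOpen_extChartAt_target x₀

lemma coord_mem {x₀ x : M} (hx : x ∈ coordSource x₀) : coord x₀ x ∈ coordTarget x₀ :=
  (extChartAt (𝓡 3) x₀).map_source (by rwa [extChartAt_source])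

lemma ofCoord_coord {x₀ x : M} (hx : x ∈ coordSource x₀) :
    ofCoord x₀ (coord x₀ x) = x :=
  (extChartAt (𝓡 3) x₀).left_inv (by rwa [extChartAt_source])

lemma coord_ofCoord {x₀ : M} {y : E3} (hy : y ∈ coordTarget x₀) :
    coord x₀ (ofCoord x₀ y) = y :=
  (extChartAt (𝓡 3) x₀).right_inv hy

lemma ofCoord_mem {x₀ : M} {y : E3} (hy : y ∈ coordTarget x₀) :
    ofCoord x₀ y ∈ coordSource x₀ := by
  have := (extChartAt (𝓡 3) x₀).map_target hy
  rwa [extChartAt_source] at this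

/-- The change of coordinates from the chart at `x₀` to the chart at `x₁`. -/
def coordChange (x₀ x₁ : M) (y : E3) : E3 := coord x₁ (ofCoord x₀ y)

lemma coordChange_coord {x₀ x₁ x : M} (h₀ : x ∈ coordSource x₀) :
    coordChange x₀ x₁ (coord x₀ x) = coord x₁ x := by
  rw [coordChange, ofCoord_coord h₀]

variable [IsManifold (𝓡 3) ∞ M]

/-- The coordinates of a tangent vector at `x` in the chart at `x₀`. -/
def coordVec (x₀ x : M) : TangentSpace (𝓡 3) x →L[ℝ] E3 :=
  (trivializationAt E3 (fun z : M => TangentSpace (𝓡 3) z) x₀).continuousLinearMapAt ℝ x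

/-- The tangent vector at `x` with given coordinates in the chart at `x₀`. -/
def ofCoordVec (x₀ x : M) : E3 →L[ℝ] TangentSpace (𝓡 3) x :=
  (trivializationAt E3 (fun z : M => TangentSpace (𝓡 3) z) x₀).symmL ℝ x

lemma mem_baseSet {x₀ x : M} (hx : x ∈ coordSource x₀) :
    x ∈ (trivializationAt E3 (fun z : M => TangentSpace (𝓡 3) z) x₀).baseSet := hx

lemma ofCoordVec_coordVec {x₀ x : M} (hx : x ∈ coordSource x₀) (X : TangentSpace (𝓡 3) x) :
    ofCoordVec x₀ x (coordVec x₀ x X) = X :=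
  Trivialization.symmL_continuousLinearMapAt _ (mem_baseSet hx) X

lemma coordVec_ofCoordVec {x₀ x : M} (hx : x ∈ coordSource x₀) (a : E3) :
    coordVec x₀ x (ofCoordVec x₀ x a) = a :=
  Trivialization.continuousLinearMapAt_symmL _ (mem_baseSet hx) a

lemma coordVec_injective {x₀ x : M} (hx : x ∈ coordSource x₀) :
    Function.Injective (coordVec x₀ x) :=
  Function.LeftInverse.injective (ofCoordVec_coordVec hx)

lemma contMDiffAt_coord {x₀ x : M} (hx : x ∈ coordSource x₀) :
    ContMDiffAt (𝓡 3) 𝓘(ℝ, E3) ∞ (coord x₀) x :=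
  contMDiffAt_extChartAt' hx

lemma contMDiffAt_ofCoord {x₀ : M} {y : E3} (hy : y ∈ coordTarget x₀) :
    ContMDiffAt 𝓘(ℝ, E3) (𝓡 3) ∞ (ofCoord x₀) y :=
  (contMDiffOn_extChartAt_symm x₀).contMDiffAt ((isOpen_coordTarget x₀).mem_nhds hy)

lemma coordVec_eq_mfderiv {x₀ x : M} (hx : x ∈ coordSource x₀) :
    coordVec x₀ x = mfderiv (𝓡 3) 𝓘(ℝ, E3) (coord x₀) x :=
  TangentBundle.continuousLinearMapAt_trivializationAt hx

lemma contDiffAt_coord_comp {x₀ : M} {f : P → M} {p : P} {n : WithTop ℕ∞}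
    (hf : ContMDiffAt 𝓘(ℝ, P) (𝓡 3) n f p) (hn : n ≤ ∞) (hp : f p ∈ coordSource x₀) :
    ContDiffAt ℝ n (coord x₀ ∘ f) p :=
  (((contMDiffAt_coord hp).of_le hn).comp p hf).contDiffAt

lemma coordVec_mfderiv {x₀ : M} {f : P → M} {p : P}
    (hf : MDifferentiableAt 𝓘(ℝ, P) (𝓡 3) f p) (hp : f p ∈ coordSource x₀) (w : P) :
    coordVec x₀ (f p) (mfderiv 𝓘(ℝ, P) (𝓡 3) f p w) = fderiv ℝ (coord x₀ ∘ f) p w := by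
  have h1 : MDifferentiableAt (𝓡 3) 𝓘(ℝ, E3) (coord x₀) (f p) :=
    (contMDiffAt_coord hp).mdifferentiableAt (by simp)
  have h2 := mfderiv_comp p h1 hf
  rw [mfderiv_eq_fderiv] at h2
  rw [coordVec_eq_mfderiv hp, h2]
  rfl

/-- A vector field along `f` is smooth if and only if its coordinates are. -/
lemma contMDiffAt_field_iff {x₀ : M} {f : P → M} {X : ∀ p, TangentSpace (𝓡 3) (f p)} {p : P}
    (hp : f p ∈ coordSource x₀) :
    ContMDiffAt 𝓘(ℝ, P) (𝓡 3).tangent ∞ (fun q => (⟨f q, X q⟩ : TangentBundle (𝓡 3) M)) p ↔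
      ContMDiffAt 𝓘(ℝ, P) (𝓡 3) ∞ f p ∧ ContDiffAt ℝ ∞ (fun q => coordVec x₀ (f q) (X q)) p := by
  have h1 := (trivializationAt E3 (fun z : M => TangentSpace (𝓡 3) z) x₀).contMDiffAt_iff
    (IM := 𝓘(ℝ, P)) (IB := 𝓡 3) (n := ∞)
    (f := fun q => (⟨f q, X q⟩ : TangentBundle (𝓡 3) M)) (x₀ := p)
    (by rw [Trivialization.mem_source]; exact mem_baseSet hp)
  refine h1.trans (and_congr_right fun hf => ?_)
  rw [contMDiffAt_iff_contDiffAt]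
  have h2 : (fun q => (trivializationAt E3 (fun z : M => TangentSpace (𝓡 3) z) x₀
      (⟨f q, X q⟩ : TangentBundle (𝓡 3) M)).2) =ᶠ[𝓝 p] fun q => coordVec x₀ (f q) (X q) := by
    filter_upwards [hf.continuousAt.eventually ((isOpen_coordSource x₀).mem_nhds hp)] with q hq
    exact (Trivialization.continuousLinearMapAt_apply_of_mem (R := ℝ) (hb := mem_baseSet hq) _ _).symm
  exact ⟨fun h => h.congr_of_eventuallyEq h2.symm, fun h => h.congr_of_eventuallyEq h2⟩

lemma contMDiffAt_ofCoordVec {x₀ : M} {y : E3} (hy : y ∈ coordTarget x₀) (a : E3) :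
    ContMDiffAt 𝓘(ℝ, E3) (𝓡 3).tangent ∞ (fun y => (⟨ofCoord x₀ y,
      ofCoordVec x₀ (ofCoord x₀ y) a⟩ : TangentBundle (𝓡 3) M)) y := by
  refine (contMDiffAt_field_iff (ofCoord_mem hy)).2 ⟨contMDiffAt_ofCoord hy, ?_⟩
  refine (contDiffAt_const (c := a)).congr_of_eventuallyEq ?_
  filter_upwards [(isOpen_coordTarget x₀).mem_nhds hy] with z hz
  exact coordVec_ofCoordVec (ofCoord_mem hz) a

lemma contDiffAt_coordChange {x₀ x₁ x : M} (h₀ : x ∈ coordSource x₀) (h₁ : x ∈ coordSource x₁) :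
    ContDiffAt ℝ ∞ (coordChange x₀ x₁) (coord x₀ x) :=
  contDiffAt_coord_comp (contMDiffAt_ofCoord (coord_mem h₀)) le_rfl
    (by rwa [ofCoord_coord h₀])

lemma fderiv_coordChange {x₀ x₁ x : M} (h₀ : x ∈ coordSource x₀) (h₁ : x ∈ coordSource x₁)
    (X : TangentSpace (𝓡 3) x) :
    fderiv ℝ (coordChange x₀ x₁) (coord x₀ x) (coordVec x₀ x X) = coordVec x₁ x X := by
  have h2 : MDifferentiableAt 𝓘(ℝ, E3) 𝓘(ℝ, E3) (coordChange x₀ x₁) (coord x₀ x) :=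
    ((contDiffAt_coordChange h₀ h₁).differentiableAt (by simp)).mdifferentiableAt
  have h3 : MDifferentiableAt (𝓡 3) 𝓘(ℝ, E3) (coord x₀) x :=
    (contMDiffAt_coord h₀).mdifferentiableAt (by simp)
  have h4 := mfderiv_comp x h2 h3
  have h5 : coordChange x₀ x₁ ∘ coord x₀ =ᶠ[𝓝 x] coord x₁ := by
    filter_upwards [(isOpen_coordSource x₀).mem_nhds h₀] with z hz using coordChange_coord hz
  rw [h5.mfderiv_eq, mfderiv_eq_fderiv] at h4
  rw [coordVec_eq_mfderiv h₀, coordVec_eq_mfderiv h₁, h4]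
  rfl

variable [RiemannianBundle (fun x : M => TangentSpace (𝓡 3) x)]

lemma chartMetric_apply (x₀ : M) (y a b : E3) : chartMetric x₀ y a b =
    inner ℝ (ofCoordVec x₀ (ofCoord x₀ y) a)
      (ofCoordVec x₀ (ofCoord x₀ y) b) := rfl

lemma chartMetric_coord {x₀ x : M} (hx : x ∈ coordSource x₀) (X Y : TangentSpace (𝓡 3) x) :
    chartMetric x₀ (coord x₀ x) (coordVec x₀ x X) (coordVec x₀ x Y) = inner ℝ X Y := by
  rw [chartMetric_apply, ofCoord_coord hx, ofCoordVec_coordVec hx, ofCoordVec_coordVec hx]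

variable [IsContMDiffRiemannianBundle (𝓡 3) ∞ E3 (fun x : M => TangentSpace (𝓡 3) x)]

lemma isMetricOn_chartMetric (x₀ : M) : IsMetricOn (chartMetric x₀) (coordTarget x₀) where
  isOpen := isOpen_coordTarget x₀
  contDiffOn := by
    refine contDiffOn_clm_apply.2 fun a => contDiffOn_clm_apply.2 fun b => fun y hy => ?_
    have h := ContMDiffAt.inner_bundle (contMDiffAt_ofCoordVec hy a) (contMDiffAt_ofCoordVec hy b)
    exact h.contDiffAt.contDiffWithinAt
  symm y _ a b := by
    rw [chartMetric_apply, chartMetric_apply, real_inner_comm]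
  pos y hy a ha := by
    rw [chartMetric_apply, real_inner_self_eq_norm_sq]
    refine pow_pos (norm_pos_iff.2 fun h => ha ?_) 2
    rw [← coordVec_ofCoordVec (ofCoord_mem hy) a, h, map_zero]

/-- The covariant derivative, in the direction `w`, of a vector field along a map. -/
def covDir (f : P → M) (X : ∀ p, TangentSpace (𝓡 3) (f p)) (p w : P) : TangentSpace (𝓡 3) (f p) :=
  ofCoordVec (f p) (f p) (covD (chartMetric (f p)) (coord (f p) ∘ f)
    (fun q => coordVec (f p) (f q) (X q)) p w)

lemma covDeriv_eq_covDir (γ : ℝ → M) (X : ∀ t, TangentSpace (𝓡 3) (γ t)) (t : ℝ) :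
    covDeriv γ X t = covDir γ X t 1 :=
  congrArg (fun a => ofCoordVec (γ t) (γ t) (deriv (fun s => coordVec (γ t) (γ s) (X s)) t + a))
    (christoffel_eq ((isMetricOn_chartMetric (γ t)).differentiableAt
      (coord_mem (mem_coordSource (γ t)))) _ _)

/-- The covariant derivative in a fixed chart. -/
lemma coordVec_covDir {x₀ : M} {f : P → M} {X : ∀ p, TangentSpace (𝓡 3) (f p)} {p : P}
    (hX : ContMDiffAt 𝓘(ℝ, P) (𝓡 3).tangent ∞ (fun q => (⟨f q, X q⟩ : TangentBundle (𝓡 3) M)) p)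
    (hp : f p ∈ coordSource x₀) (w : P) :
    coordVec x₀ (f p) (covDir f X p w) =
      covD (chartMetric x₀) (coord x₀ ∘ f) (fun q => coordVec x₀ (f q) (X q)) p w := by
  have h₁ : f p ∈ coordSource (f p) := mem_coordSource (f p)
  obtain ⟨hf, hξ⟩ := (contMDiffAt_field_iff (x₀ := x₀) hp).1 hX
  have hφ := contDiffAt_coord_comp hf le_rfl hp
  have hsrc : ∀ᶠ s in 𝓝 p, f s ∈ coordSource x₀ ∩ coordSource (f p) :=
    hf.continuousAt.eventually
      (((isOpen_coordSource x₀).inter (isOpen_coordSource (f p))).mem_nhds ⟨hp, h₁⟩)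
  have hsurj : ∀ X, ∃ a, fderiv ℝ (coordChange x₀ (f p)) (coord x₀ (f p)) a = X := fun X =>
    ⟨coordVec x₀ (f p) (ofCoordVec (f p) (f p) X), by
      rw [fderiv_coordChange hp h₁, coordVec_ofCoordVec h₁]⟩
  -- Both chart metrics compute the same inner product on `M`, so the change of coordinates is a
  -- local isometry between them and `covD_map` applies.
  have hiso : ∀ᶠ z in 𝓝 (coord x₀ (f p)), ∀ a b, chartMetric x₀ z a b =
      chartMetric (f p) (coordChange x₀ (f p) z) (fderiv ℝ (coordChange x₀ (f p)) z a)
        (fderiv ℝ (coordChange x₀ (f p)) z b) := by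
    have hc : ∀ᶠ z in 𝓝 (coord x₀ (f p)), ofCoord x₀ z ∈ coordSource (f p) := by
      refine (contMDiffAt_ofCoord (coord_mem hp)).continuousAt.eventually
        ((isOpen_coordSource _).mem_nhds ?_)
      rw [ofCoord_coord hp]
      exact h₁
    filter_upwards [(isOpen_coordTarget x₀).mem_nhds (coord_mem hp), hc] with z hz hz' a b
    have e := ofCoord_mem hz
    rw [← coord_ofCoord hz, ← coordVec_ofCoordVec e a, ← coordVec_ofCoordVec e b,
      fderiv_coordChange e hz', fderiv_coordChange e hz', coordChange_coord e,
      chartMetric_coord hz', chartMetric_coord e]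
  have hmap := covD_map (isMetricOn_chartMetric x₀) (isMetricOn_chartMetric (f p))
    (τ := coordChange x₀ (f p)) (φ := coord x₀ ∘ f) (ξ := fun s => coordVec x₀ (f s) (X s))
    (p := p) (coord_mem hp)
    (by rw [Function.comp_apply, coordChange_coord hp]; exact coord_mem h₁)
    (contDiffAt_coordChange hp h₁) hiso hsurj (hφ.differentiableAt (by simp))
    (hξ.differentiableAt (by simp)) w
  have key : covD (chartMetric (f p)) (coord (f p) ∘ f) (fun q => coordVec (f p) (f q) (X q)) p w =
      fderiv ℝ (coordChange x₀ (f p)) (coord x₀ (f p))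
        (covD (chartMetric x₀) (coord x₀ ∘ f) (fun q => coordVec x₀ (f q) (X q)) p w) := by
    refine Eq.trans (covD_congr ?_ ?_ w) hmap
    · filter_upwards [hsrc] with s hs using (coordChange_coord hs.1).symm
    · filter_upwards [hsrc] with s hs using (fderiv_coordChange hs.1 hs.2 (X s)).symm
  rw [covDir, key, ← coordVec_ofCoordVec hp (covD (chartMetric x₀) _ _ p w),
    fderiv_coordChange hp h₁, ofCoordVec_coordVec h₁]

end Coordinates

/-! ### Covariant differentiation along maps -/

section AlongMaps

open Filter Topology

set_option maxSynthPendingDepth 3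

variable {M : Type*} [TopologicalSpace M] [ChartedSpace E3 M]
  {P : Type*} [NormedAddCommGroup P] [NormedSpace ℝ P]

lemma eventually_mem_coordSource {x₀ : M} {f : P → M} {p : P}
    (hf : ContMDiffAt 𝓘(ℝ, P) (𝓡 3) ∞ f p) (hp : f p ∈ coordSource x₀) :
    ∀ᶠ q in 𝓝 p, f q ∈ coordSource x₀ :=
  hf.continuousAt.eventually ((isOpen_coordSource x₀).mem_nhds hp)

variable [IsManifold (𝓡 3) ∞ M]

/-- `X` is a smooth vector field along `f` near `p`. -/
abbrev IsSmoothFieldAt (f : P → M) (X : ∀ p, TangentSpace (𝓡 3) (f p)) (p : P) : Prop :=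
  ContMDiffAt 𝓘(ℝ, P) (𝓡 3).tangent ∞ (fun q => (⟨f q, X q⟩ : TangentBundle (𝓡 3) M)) p

lemma IsSmoothFieldAt.base {f : P → M} {X : ∀ p, TangentSpace (𝓡 3) (f p)} {p : P}
    (h : IsSmoothFieldAt f X p) : ContMDiffAt 𝓘(ℝ, P) (𝓡 3) ∞ f p :=
  ((contMDiffAt_field_iff (mem_coordSource (f p))).1 h).1

lemma IsSmoothFieldAt.coordVec {x₀ : M} {f : P → M} {X : ∀ p, TangentSpace (𝓡 3) (f p)} {p : P}
    (h : IsSmoothFieldAt f X p) (hp : f p ∈ coordSource x₀) :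
    ContDiffAt ℝ ∞ (fun q => coordVec x₀ (f q) (X q)) p :=
  ((contMDiffAt_field_iff hp).1 h).2

lemma IsSmoothFieldAt.comp {Q : Type*} [NormedAddCommGroup Q] [NormedSpace ℝ Q]
    {f : P → M} {X : ∀ p, TangentSpace (𝓡 3) (f p)} {c : Q → P} {q : Q}
    (h : IsSmoothFieldAt f X (c q)) (hc : ContDiffAt ℝ ∞ c q) :
    IsSmoothFieldAt (fun q => f (c q)) (fun q => X (c q)) q :=
  ContMDiffAt.comp q h hc.contMDiffAt

lemma eventually_coordVec_mfderiv {x₀ : M} {f : P → M} {p : P}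
    (hf : ContMDiffAt 𝓘(ℝ, P) (𝓡 3) ∞ f p) (hp : f p ∈ coordSource x₀) (w : P) :
    (fun q => coordVec x₀ (f q) (mfderiv 𝓘(ℝ, P) (𝓡 3) f q w)) =ᶠ[𝓝 p]
      fun q => fderiv ℝ (coord x₀ ∘ f) q w := by
  have h1 : ∀ᶠ q in 𝓝 p, ContMDiffAt 𝓘(ℝ, P) (𝓡 3) 1 f q :=
    (contMDiffAt_iff_contMDiffAt_nhds (by simp)).1 (hf.of_le (m := 1) (by simp))
  filter_upwards [h1, eventually_mem_coordSource hf hp] with q hq hq'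
  exact coordVec_mfderiv (hq.mdifferentiableAt (by simp)) hq' w

lemma isSmoothFieldAt_mfderiv {f : P → M} {p : P}
    (hf : ContMDiffAt 𝓘(ℝ, P) (𝓡 3) ∞ f p) (w : P) :
    IsSmoothFieldAt f (fun q => mfderiv 𝓘(ℝ, P) (𝓡 3) f q w) p := by
  have hp := mem_coordSource (f p)
  refine (contMDiffAt_field_iff hp).2 ⟨hf, ?_⟩
  have h1 : ContDiffAt ℝ ∞ (fderiv ℝ (coord (f p) ∘ f)) p :=
    (contDiffAt_coord_comp hf le_rfl hp).fderiv_right (by simp)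
  exact (h1.clm_apply contDiffAt_const).congr_of_eventuallyEq (eventually_coordVec_mfderiv hf hp w)

lemma IsSmoothFieldAt.sub {f : P → M} {X Y : ∀ p, TangentSpace (𝓡 3) (f p)} {p : P}
    (hX : IsSmoothFieldAt f X p) (hY : IsSmoothFieldAt f Y p) :
    IsSmoothFieldAt f (fun q => X q - Y q) p := by
  have hp := mem_coordSource (f p)
  refine (contMDiffAt_field_iff hp).2 ⟨hX.base, ?_⟩
  simp only [map_sub]
  exact (hX.coordVec hp).sub (hY.coordVec hp)

lemma IsSmoothFieldAt.const_smul {f : P → M} {X : ∀ p, TangentSpace (𝓡 3) (f p)} {p : P}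
    (hX : IsSmoothFieldAt f X p) (a : ℝ) : IsSmoothFieldAt f (fun q => a • X q) p := by
  have hp := mem_coordSource (f p)
  refine (contMDiffAt_field_iff hp).2 ⟨hX.base, ?_⟩
  simp only [map_smul]
  exact (hX.coordVec hp).const_smul a

variable [RiemannianBundle (fun x : M => TangentSpace (𝓡 3) x)]

lemma covDir_add_dir (f : P → M) (X : ∀ p, TangentSpace (𝓡 3) (f p)) (p w w' : P) :
    covDir f X p (w + w') = covDir f X p w + covDir f X p w' := by
  simp only [covDir, covD_add_dir, map_add]

lemma covDir_smul_dir (f : P → M) (X : ∀ p, TangentSpace (𝓡 3) (f p)) (p w : P) (a : ℝ) :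
    covDir f X p (a • w) = a • covDir f X p w := by
  simp only [covDir, covD_smul_dir, map_smul]

/-- The covariant derivative along a curve, as a function on curves in the tangent bundle. -/
def covDerivTotal (F : ℝ → TangentBundle (𝓡 3) M) (t : ℝ) : TangentBundle (𝓡 3) M :=
  ⟨(F t).1, covDeriv (fun s => (F s).1) (fun s => (F s).2) t⟩

/-- Fields along two curves that agree only near `t` have different types, so locality has to be
expressed for curves in the tangent bundle. -/
lemma covDerivTotal_congr {F G : ℝ → TangentBundle (𝓡 3) M} {t : ℝ} (h : F =ᶠ[𝓝 t] G) :
    covDerivTotal F t = covDerivTotal G t := by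
  have h1 (K : TangentBundle (𝓡 3) M → E3) :
      deriv (fun s => K (F s)) t = deriv (fun s => K (G s)) t :=
    (h.fun_comp K).deriv_eq
  -- The covariant derivative depends on `F` only through `F t` and the derivatives at `t` of
  -- `E3`-valued functions of `F`. With this dependence packaged in `Φ`, no rewriting under
  -- dependent types is necessary.
  obtain ⟨Φ, hΦ⟩ : ∃ Φ : TangentBundle (𝓡 3) M → ((TangentBundle (𝓡 3) M → E3) → E3) →
      TangentBundle (𝓡 3) M, ∀ F : ℝ → TangentBundle (𝓡 3) M, covDerivTotal F t =
        Φ (F t) (fun K => deriv (fun s => K (F s)) t) :=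
    ⟨fun w D => ⟨w.1, ofCoordVec w.1 w.1 (D (fun z => coordVec w.1 z.1 z.2) +
      christoffel (chartMetric w.1) (coord w.1 w.1) (D (fun z => coord w.1 z.1))
        (coordVec w.1 w.1 w.2))⟩, fun F => rfl⟩
  rw [hΦ, hΦ, h.eq_of_nhds, funext h1]

lemma covDeriv_congr {γ : ℝ → M} {X Y : ∀ t, TangentSpace (𝓡 3) (γ t)} {t : ℝ}
    (h : ∀ᶠ s in 𝓝 t, X s = Y s) : covDeriv γ X t = covDeriv γ Y t := by
  have := covDerivTotal_congr (F := fun s => (⟨γ s, X s⟩ : TangentBundle (𝓡 3) M))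
    (G := fun s => (⟨γ s, Y s⟩ : TangentBundle (𝓡 3) M)) (t := t)
    (by filter_upwards [h] with s hs; rw [hs])
  exact TotalSpace.mk_injective (F := E3) _ this

lemma covDir_sub {f : P → M} {X Y : ∀ p, TangentSpace (𝓡 3) (f p)} {p : P}
    (hX : IsSmoothFieldAt f X p) (hY : IsSmoothFieldAt f Y p) (w : P) :
    covDir f (fun q => X q - Y q) p w = covDir f X p w - covDir f Y p w := by
  have hp := mem_coordSource (f p)
  simp only [covDir, covD, map_sub]
  rw [fderiv_fun_sub ((hX.coordVec hp).differentiableAt (by simp))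
    ((hY.coordVec hp).differentiableAt (by simp))]
  simp only [sub_apply, map_sub, map_add]
  abel

lemma covDir_const_smul {f : P → M} {X : ∀ p, TangentSpace (𝓡 3) (f p)} {p : P}
    (hX : IsSmoothFieldAt f X p) (a : ℝ) (w : P) :
    covDir f (fun q => a • X q) p w = a • covDir f X p w := by
  have hp := mem_coordSource (f p)
  simp only [covDir, covD, map_smul]
  rw [fderiv_fun_const_smul ((hX.coordVec hp).differentiableAt (by simp))]
  simp only [smul_apply, map_add, smul_add, map_smul]

variable [IsContMDiffRiemannianBundle (𝓡 3) ∞ E3 (fun x : M => TangentSpace (𝓡 3) x)]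

/-- The chain rule. -/
lemma covDeriv_comp {f : P → M} {X : ∀ p, TangentSpace (𝓡 3) (f p)} {c : ℝ → P} {t : ℝ}
    (hX : IsSmoothFieldAt f X (c t)) (hc : ContDiffAt ℝ ∞ c t) :
    covDeriv (fun s => f (c s)) (fun s => X (c s)) t = covDir f X (c t) (deriv c t) := by
  have hp := mem_coordSource (f (c t))
  rw [covDeriv_eq_covDir]
  refine coordVec_injective hp ?_
  rw [coordVec_covDir hX hp, coordVec_covDir (hX.comp hc) hp]
  exact covD_comp _ ((contDiffAt_coord_comp hX.base le_rfl hp).differentiableAt (by simp))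
    ((hX.coordVec hp).differentiableAt (by simp)) (hc.differentiableAt (by simp)) 1

lemma IsSmoothFieldAt.covDir {f : P → M} {X : ∀ p, TangentSpace (𝓡 3) (f p)} {p : P}
    (hX : ∀ᶠ q in 𝓝 p, IsSmoothFieldAt f X q) (w : P) :
    IsSmoothFieldAt f (fun q => covDir f X q w) p := by
  have hp := mem_coordSource (f p)
  have hf := hX.self_of_nhds.base
  refine (contMDiffAt_field_iff hp).2 ⟨hf, ?_⟩
  refine (contDiffAt_covD (isMetricOn_chartMetric (f p)) (contDiffAt_coord_comp hf le_rfl hp)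
    (hX.self_of_nhds.coordVec hp) (coord_mem hp) w).congr_of_eventuallyEq ?_
  filter_upwards [hX, eventually_mem_coordSource hf hp] with q hq hq'
  exact coordVec_covDir hq hq' w

/-- Compatibility with the metric. -/
lemma fderiv_inner {f : P → M} {X Y : ∀ p, TangentSpace (𝓡 3) (f p)} {p : P}
    (hX : IsSmoothFieldAt f X p) (hY : IsSmoothFieldAt f Y p) :
    DifferentiableAt ℝ (fun q => inner ℝ (X q) (Y q)) p ∧
    ∀ w, fderiv ℝ (fun q => inner ℝ (X q) (Y q)) p w =
      inner ℝ (covDir f X p w) (Y p) + inner ℝ (X p) (covDir f Y p w) := by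
  have hp := mem_coordSource (f p)
  have hf := hX.base
  obtain ⟨h1, h2⟩ := hasFDerivAt_metric (isMetricOn_chartMetric (f p)) (φ := coord (f p) ∘ f)
    (ξ := fun q => coordVec (f p) (f q) (X q)) (η := fun q => coordVec (f p) (f q) (Y q)) (p := p)
    (coord_mem hp) ((contDiffAt_coord_comp hf le_rfl hp).differentiableAt (by simp))
    ((hX.coordVec hp).differentiableAt (by simp)) ((hY.coordVec hp).differentiableAt (by simp))
  have h3 : (fun q => inner ℝ (X q) (Y q)) =ᶠ[𝓝 p] fun q => chartMetric (f p)
      ((coord (f p) ∘ f) q) (coordVec (f p) (f q) (X q)) (coordVec (f p) (f q) (Y q)) := by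
    filter_upwards [eventually_mem_coordSource hf hp] with q hq
    exact (chartMetric_coord hq _ _).symm
  refine ⟨h1.congr_of_eventuallyEq h3, fun w => ?_⟩
  rw [h3.fderiv_eq, h2, ← coordVec_covDir hX hp, ← coordVec_covDir hY hp]
  change chartMetric (f p) (coord (f p) (f p)) _ _ + chartMetric (f p) (coord (f p) (f p)) _ _ = _
  rw [chartMetric_coord hp, chartMetric_coord hp]

lemma hasDerivAt_inner {γ : ℝ → M} {X Y : ∀ t, TangentSpace (𝓡 3) (γ t)} {t : ℝ}
    (hX : IsSmoothFieldAt γ X t) (hY : IsSmoothFieldAt γ Y t) :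
    HasDerivAt (fun s => inner ℝ (X s) (Y s))
      (inner ℝ (covDeriv γ X t) (Y t) + inner ℝ (X t) (covDeriv γ Y t)) t := by
  obtain ⟨h1, h2⟩ := fderiv_inner hX hY
  rw [covDeriv_eq_covDir, covDeriv_eq_covDir, ← h2]
  exact h1.hasDerivAt

/-- Torsion-freeness. -/
lemma covDir_mfderiv_comm {f : P → M} {p : P} (hf : ContMDiffAt 𝓘(ℝ, P) (𝓡 3) ∞ f p) (a b : P) :
    covDir f (fun q => mfderiv 𝓘(ℝ, P) (𝓡 3) f q a) p b =
      covDir f (fun q => mfderiv 𝓘(ℝ, P) (𝓡 3) f q b) p a := by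
  have hp := mem_coordSource (f p)
  refine coordVec_injective hp ?_
  rw [coordVec_covDir (isSmoothFieldAt_mfderiv hf a) hp,
    coordVec_covDir (isSmoothFieldAt_mfderiv hf b) hp,
    covD_congr (EventuallyEq.refl _ _) (eventually_coordVec_mfderiv hf hp a),
    covD_congr (EventuallyEq.refl _ _) (eventually_coordVec_mfderiv hf hp b)]
  exact covD_torsion (isMetricOn_chartMetric (f p)) (φ := coord (f p) ∘ f) (coord_mem hp)
    (contDiffAt_coord_comp hf le_rfl hp) a b

/-- The commutator of covariant derivatives, in a chart. -/
lemma covDir_commutator {x₀ : M} {f : P → M} {X : ∀ p, TangentSpace (𝓡 3) (f p)} {p : P}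
    (hX : ∀ᶠ q in 𝓝 p, IsSmoothFieldAt f X q) (hp : f p ∈ coordSource x₀) (a b : P) :
    coordVec x₀ (f p) (covDir f (fun q => covDir f X q b) p a -
        covDir f (fun q => covDir f X q a) p b) =
      riemannCurvature (chartMetric x₀) (coord x₀ (f p)) (fderiv ℝ (coord x₀ ∘ f) p a)
        (fderiv ℝ (coord x₀ ∘ f) p b) (coordVec x₀ (f p) (X p)) := by
  have hf := hX.self_of_nhds.base
  have h1 (b : P) : (fun q => coordVec x₀ (f q) (covDir f X q b)) =ᶠ[𝓝 p] fun q =>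
      covD (chartMetric x₀) (coord x₀ ∘ f) (fun q => coordVec x₀ (f q) (X q)) q b := by
    filter_upwards [hX, eventually_mem_coordSource hf hp] with q hq hq'
    exact coordVec_covDir hq hq' b
  rw [map_sub, coordVec_covDir (IsSmoothFieldAt.covDir hX b) hp,
    coordVec_covDir (IsSmoothFieldAt.covDir hX a) hp,
    covD_congr (EventuallyEq.refl _ _) (h1 a), covD_congr (EventuallyEq.refl _ _) (h1 b)]
  exact covD_commutator (isMetricOn_chartMetric x₀) (φ := coord x₀ ∘ f) (coord_mem hp)
    (contDiffAt_coord_comp hf le_rfl hp) (hX.self_of_nhds.coordVec hp) a b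

end AlongMaps

/-! ### Parallel fields and geodesics -/

section ParallelFields

open Filter Topology

set_option maxSynthPendingDepth 3

/-- The geodesic spray of a metric. -/
def spray {E : Type*} [NormedAddCommGroup E] [NormedSpace ℝ E]
    (g : E → E →L[ℝ] E →L[ℝ] ℝ) (q : E × E) : E × E :=
  (q.2, -christoffelB g q.1 q.2 q.2)

lemma contDiffOn_spray {E : Type*} [NormedAddCommGroup E] [NormedSpace ℝ E]
    [FiniteDimensional ℝ E] {g : E → E →L[ℝ] E →L[ℝ] ℝ} {U : Set E} (hg : IsMetricOn g U) :
    ContDiffOn ℝ ∞ (spray g) (U ×ˢ univ) := by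
  have h1 : ContDiffOn ℝ ∞ (fun q : E × E => christoffelB g q.1) (U ×ˢ univ) :=
    hg.contDiffOn_christoffelB.comp contDiff_fst.contDiffOn fun q hq => hq.1
  exact contDiff_snd.contDiffOn.prodMk
    ((h1.clm_apply contDiff_snd.contDiffOn).clm_apply contDiff_snd.contDiffOn).neg

variable {M : Type*} [TopologicalSpace M] [ChartedSpace E3 M]
  {P : Type*} [NormedAddCommGroup P]

lemma eventually_coord_ofCoord {x₀ : M} {φ : P → E3} {p : P} (hφ : ContinuousAt φ p)
    (hp : φ p ∈ coordTarget x₀) : (coord x₀ ∘ fun q => ofCoord x₀ (φ q)) =ᶠ[𝓝 p] φ := by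
  filter_upwards [hφ.eventually ((isOpen_coordTarget x₀).mem_nhds hp)] with q hq
  exact coord_ofCoord hq

section

variable [IsManifold (𝓡 3) ∞ M]

lemma eventually_coordVec_ofCoordVec {x₀ : M}
    {φ ξ : P → E3} {p : P} (hφ : ContinuousAt φ p)
    (hp : φ p ∈ coordTarget x₀) :
    (fun q => coordVec x₀ (ofCoord x₀ (φ q)) (ofCoordVec x₀ (ofCoord x₀ (φ q)) (ξ q))) =ᶠ[𝓝 p] ξ := by
  filter_upwards [hφ.eventually ((isOpen_coordTarget x₀).mem_nhds hp)] with q hq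
  exact coordVec_ofCoordVec (ofCoord_mem hq) _

end

variable [NormedSpace ℝ P]

lemma totalSpace_mk_eq_zero_iff {x y : M} {X : TangentSpace (𝓡 3) x} {Y : TangentSpace (𝓡 3) y}
    (h : (⟨x, X⟩ : TangentBundle (𝓡 3) M) = ⟨y, Y⟩) : X = 0 ↔ Y = 0 := by
  cases h
  rfl

lemma velocity_comp {f : P → M} {c : ℝ → P} {t : ℝ}
    {v : P} (hf : MDifferentiableAt 𝓘(ℝ, P) (𝓡 3) f (c t)) (hc : HasDerivAt c v t) :
    velocity (fun s => f (c s)) t = mfderiv 𝓘(ℝ, P) (𝓡 3) f (c t) v := by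
  have h := mfderiv_comp t hf hc.differentiableAt.mdifferentiableAt
  rw [mfderiv_eq_fderiv] at h
  rw [← hc.deriv]
  exact congrArg (fun L : ℝ →L[ℝ] E3 => L 1) h

lemma velocity_scale {γ : ℝ → M} {a t : ℝ}
    (h : ContMDiffAt 𝓘(ℝ, ℝ) (𝓡 3) ∞ γ (a * t)) :
    velocity (fun s => γ (a * s)) t = a • velocity γ (a * t) := by
  have hc : HasDerivAt (fun s : ℝ => a * s) (a • (1 : ℝ)) t := by
    simpa using (hasDerivAt_id t).const_mul a
  exact (velocity_comp (c := fun s => a * s) (h.mdifferentiableAt (by simp)) hc).trans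
    (map_smul _ a (1 : ℝ))

lemma velocity_total_congr {γ δ : ℝ → M} {t : ℝ} (h : γ =ᶠ[𝓝 t] δ) :
    (⟨γ t, velocity γ t⟩ : TangentBundle (𝓡 3) M) = ⟨δ t, velocity δ t⟩ := by
  have h1 := h.mfderiv_eq (I := 𝓘(ℝ, ℝ)) (I' := 𝓡 3)
  exact TotalSpace.ext h.eq_of_nhds
    (heq_of_eq (congrArg (fun L : ℝ →L[ℝ] E3 => L 1) h1))

variable [IsManifold (𝓡 3) ∞ M]

lemma isSmoothFieldAt_velocity {γ : ℝ → M} {t : ℝ} (h : ContMDiffAt 𝓘(ℝ, ℝ) (𝓡 3) ∞ γ t) :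
    IsSmoothFieldAt γ (velocity γ) t := isSmoothFieldAt_mfderiv h 1

lemma contMDiffAt_ofCoord_comp {x₀ : M} {φ : P → E3} {p : P} (hφ : ContDiffAt ℝ ∞ φ p)
    (hp : φ p ∈ coordTarget x₀) : ContMDiffAt 𝓘(ℝ, P) (𝓡 3) ∞ (fun q => ofCoord x₀ (φ q)) p :=
  (contMDiffAt_ofCoord hp).comp p hφ.contMDiffAt

lemma isSmoothFieldAt_ofCoord {x₀ : M} {φ ξ : P → E3} {p : P} (hφ : ContDiffAt ℝ ∞ φ p)
    (hξ : ContDiffAt ℝ ∞ ξ p) (hp : φ p ∈ coordTarget x₀) :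
    IsSmoothFieldAt (fun q => ofCoord x₀ (φ q))
      (fun q => ofCoordVec x₀ (ofCoord x₀ (φ q)) (ξ q)) p :=
  (contMDiffAt_field_iff (f := fun q => ofCoord x₀ (φ q)) (p := p) (ofCoord_mem hp)).2
    ⟨contMDiffAt_ofCoord_comp hφ hp,
    hξ.congr_of_eventuallyEq (eventually_coordVec_ofCoordVec hφ.continuousAt hp)⟩

lemma mfderiv_ofCoord_comp {x₀ : M} {φ : P → E3} {p : P} (hφ : ContDiffAt ℝ ∞ φ p)
    (hp : φ p ∈ coordTarget x₀) (w : P) :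
    mfderiv 𝓘(ℝ, P) (𝓡 3) (fun q => ofCoord x₀ (φ q)) p w =
      ofCoordVec x₀ (ofCoord x₀ (φ p)) (fderiv ℝ φ p w) := by
  refine coordVec_injective (x₀ := x₀) (ofCoord_mem hp) ?_
  refine (coordVec_mfderiv ((contMDiffAt_ofCoord_comp hφ hp).mdifferentiableAt (by simp))
    (ofCoord_mem hp) w).trans ?_
  rw [(eventually_coord_ofCoord hφ.continuousAt hp).fderiv_eq]
  exact (coordVec_ofCoordVec (ofCoord_mem hp) _).symm

variable [RiemannianBundle (fun x : M => TangentSpace (𝓡 3) x)]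

/-- `γ` is a geodesic near the parameter `t`. -/
def IsGeodesicAt (γ : ℝ → M) (t : ℝ) : Prop :=
  ContMDiffAt 𝓘(ℝ, ℝ) (𝓡 3) ∞ γ t ∧ covDeriv γ (velocity γ) t = 0

lemma isGeodesicOn_iff {γ : ℝ → M} {J : Set ℝ} (hJ : IsOpen J) :
    IsGeodesicOn γ J ↔ ∀ t ∈ J, IsGeodesicAt γ t :=
  ⟨fun h t ht => ⟨h.1.contMDiffAt (hJ.mem_nhds ht), h.2 t ht⟩,
    fun h => ⟨fun t ht => (h t ht).1.contMDiffWithinAt, fun t ht => (h t ht).2⟩⟩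

lemma IsGeodesicAt.congr {γ δ : ℝ → M} {t : ℝ} (hγ : IsGeodesicAt γ t) (h : γ =ᶠ[𝓝 t] δ) :
    IsGeodesicAt δ t := by
  refine ⟨hγ.1.congr_of_eventuallyEq h.symm, ?_⟩
  have h1 := covDerivTotal_congr (F := fun s => (⟨γ s, velocity γ s⟩ : TangentBundle (𝓡 3) M))
    (G := fun s => (⟨δ s, velocity δ s⟩ : TangentBundle (𝓡 3) M)) (t := t)
    (h.eventuallyEq_nhds.mono fun s hs => velocity_total_congr hs)
  exact (totalSpace_mk_eq_zero_iff h1).1 hγ.2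

lemma isParallelOn_iff {γ : ℝ → M} {X : ∀ t, TangentSpace (𝓡 3) (γ t)} {J : Set ℝ}
    (hJ : IsOpen J) : IsParallelOn γ X J ↔
      ∀ t ∈ J, IsSmoothFieldAt γ X t ∧ covDeriv γ X t = 0 :=
  ⟨fun h t ht => ⟨h.1.contMDiffAt (hJ.mem_nhds ht), h.2 t ht⟩,
    fun h => ⟨fun t ht => (h t ht).1.contMDiffWithinAt, fun t ht => (h t ht).2⟩⟩

lemma IsGeodesicOn.isParallelOn {γ : ℝ → M} {J : Set ℝ} (hJ : IsOpen J) (h : IsGeodesicOn γ J) :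
    IsParallelOn γ (velocity γ) J :=
  (isParallelOn_iff hJ).2 fun t ht =>
    ⟨isSmoothFieldAt_velocity (h.1.contMDiffAt (hJ.mem_nhds ht)), h.2 t ht⟩

variable [IsContMDiffRiemannianBundle (𝓡 3) ∞ E3 (fun x : M => TangentSpace (𝓡 3) x)]

/-- Metric compatibility makes the derivative of the inner product zero, and `J` is an interval. -/
lemma inner_eq_of_covDeriv_eq_zero {γ : ℝ → M} {X Y : ∀ t, TangentSpace (𝓡 3) (γ t)} {J : Set ℝ}
    (hJ : IsOpen J) (hJc : J.OrdConnected)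
    (hX : IsParallelOn γ X J) (hY : IsParallelOn γ Y J)
    {s t : ℝ} (hs : s ∈ J) (ht : t ∈ J) : inner ℝ (X s) (Y s) = inner ℝ (X t) (Y t) := by
  rw [isParallelOn_iff hJ] at hX hY
  have h : ∀ t ∈ J, HasDerivAt (fun s => inner ℝ (X s) (Y s)) 0 t := fun t ht => by
    have := hasDerivAt_inner (hX t ht).1 (hY t ht).1
    rwa [(hX t ht).2, (hY t ht).2, inner_zero_left, inner_zero_right, add_zero] at this
  exact hJ.is_const_of_deriv_eq_zero hJc.isPreconnected
    (fun t ht => (h t ht).differentiableAt.differentiableWithinAt) (fun t ht => (h t ht).deriv)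
    hs ht

lemma IsParallelOn.sub {γ : ℝ → M} {X Y : ∀ t, TangentSpace (𝓡 3) (γ t)} {J : Set ℝ}
    (hJ : IsOpen J) (hX : IsParallelOn γ X J) (hY : IsParallelOn γ Y J) :
    IsParallelOn γ (fun t => X t - Y t) J := by
  rw [isParallelOn_iff hJ] at hX hY ⊢
  refine fun t ht => ⟨(hX t ht).1.sub (hY t ht).1, ?_⟩
  rw [covDeriv_eq_covDir, covDir_sub (hX t ht).1 (hY t ht).1, ← covDeriv_eq_covDir,
    ← covDeriv_eq_covDir, (hX t ht).2, (hY t ht).2, sub_zero]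

lemma IsParallelOn.norm_eq {γ : ℝ → M} {X : ∀ t, TangentSpace (𝓡 3) (γ t)} {J : Set ℝ}
    (hJ : IsOpen J) (hJc : J.OrdConnected) (hX : IsParallelOn γ X J)
    {s t : ℝ} (hs : s ∈ J) (ht : t ∈ J) : ‖X s‖ = ‖X t‖ := by
  have h := inner_eq_of_covDeriv_eq_zero hJ hJc hX hX hs ht
  rw [real_inner_self_eq_norm_sq, real_inner_self_eq_norm_sq] at h
  exact (sq_eq_sq₀ (norm_nonneg _) (norm_nonneg _)).1 h

/-- A parallel field is determined by its value at one point. -/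
lemma IsParallelOn.unique {γ : ℝ → M} {X Y : ∀ t, TangentSpace (𝓡 3) (γ t)} {J : Set ℝ}
    (hJ : IsOpen J) (hJc : J.OrdConnected) (hX : IsParallelOn γ X J) (hY : IsParallelOn γ Y J)
    {t₀ t : ℝ} (h₀ : t₀ ∈ J) (h : X t₀ = Y t₀) (ht : t ∈ J) : X t = Y t := by
  have h1 := (hX.sub hJ hY).norm_eq hJ hJc ht h₀
  rw [h, sub_self, norm_zero, norm_eq_zero, sub_eq_zero] at h1
  exact h1

/-- Recasts the second-order geodesic equation as a first-order system, to which uniqueness for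
Lipschitz fields applies. -/
lemma IsGeodesicAt.hasDerivAt {x₀ : M} {γ : ℝ → M} {t : ℝ} (hγ : IsGeodesicAt γ t)
    (ht : γ t ∈ coordSource x₀) :
    HasDerivAt (fun s => ((coord x₀ ∘ γ) s, deriv (coord x₀ ∘ γ) s))
      (spray (chartMetric x₀) ((coord x₀ ∘ γ) t, deriv (coord x₀ ∘ γ) t)) t := by
  have hy := contDiffAt_coord_comp hγ.1 le_rfl ht
  have hd1 : HasDerivAt (coord x₀ ∘ γ) (deriv (coord x₀ ∘ γ) t) t :=
    (hy.differentiableAt (by simp)).hasDerivAt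
  have hd2 : DifferentiableAt ℝ (fderiv ℝ (coord x₀ ∘ γ)) t :=
    (hy.fderiv_right (m := ∞) (by simp)).differentiableAt (by simp)
  have hd3 : DifferentiableAt ℝ (deriv (coord x₀ ∘ γ)) t :=
    hd2.clm_apply (differentiableAt_const 1)
  have h1 := congrArg (coordVec x₀ (γ t)) hγ.2
  rw [map_zero, covDeriv_eq_covDir,
    coordVec_covDir (isSmoothFieldAt_velocity hγ.1) ht] at h1
  replace h1 := (covD_congr (EventuallyEq.refl _ _)
    (eventually_coordVec_mfderiv hγ.1 ht 1).symm 1).trans h1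
  have h2 : deriv (deriv (coord x₀ ∘ γ)) t = -christoffelB (chartMetric x₀) ((coord x₀ ∘ γ) t)
      (deriv (coord x₀ ∘ γ) t) (deriv (coord x₀ ∘ γ) t) := eq_neg_of_add_eq_zero_left h1
  have h3 := hd1.prodMk hd3.hasDerivAt
  rw [h2] at h3
  exact h3

/-- Local uniqueness of geodesics. -/
lemma IsGeodesicAt.eventuallyEq {γ δ : ℝ → M} {t : ℝ}
    (hγ : ∀ᶠ s in 𝓝 t, IsGeodesicAt γ s) (hδ : ∀ᶠ s in 𝓝 t, IsGeodesicAt δ s) (h0 : γ t = δ t)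
    (h1 : deriv (coord (γ t) ∘ γ) t = deriv (coord (γ t) ∘ δ) t) : γ =ᶠ[𝓝 t] δ := by
  set x₀ := γ t with hx₀
  have hsγ : γ t ∈ coordSource x₀ := mem_coordSource x₀
  have hsδ : δ t ∈ coordSource x₀ := by rw [← h0]; exact mem_coordSource x₀
  have heγ := eventually_mem_coordSource hγ.self_of_nhds.1 hsγ
  have heδ := eventually_mem_coordSource hδ.self_of_nhds.1 hsδ
  have hmem : ((coord x₀ ∘ γ) t, deriv (coord x₀ ∘ γ) t) ∈ coordTarget x₀ ×ˢ (univ : Set E3) :=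
    ⟨coord_mem hsγ, mem_univ _⟩
  have hopen : IsOpen (coordTarget x₀ ×ˢ (univ : Set E3)) := (isOpen_coordTarget x₀).prod isOpen_univ
  have hF := (contDiffOn_spray (isMetricOn_chartMetric x₀)).contDiffAt (hopen.mem_nhds hmem)
  obtain ⟨K, s, hs, hL⟩ := (hF.of_le (m := 1) (by simp)).exists_lipschitzOnWith
  have hcγ := (hγ.self_of_nhds.hasDerivAt hsγ).continuousAt
  have hcδ := (hδ.self_of_nhds.hasDerivAt hsδ).continuousAt
  have e0 : ((coord x₀ ∘ γ) t, deriv (coord x₀ ∘ γ) t) =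
      ((coord x₀ ∘ δ) t, deriv (coord x₀ ∘ δ) t) :=
    Prod.ext (congrArg (coord x₀) h0) h1
  have hu := ODE_solution_unique_of_eventually (v := fun _ => spray (chartMetric x₀))
    (s := fun _ => s) (K := K) (t₀ := t) (Eventually.of_forall fun _ => hL)
    (f := fun s => ((coord x₀ ∘ γ) s, deriv (coord x₀ ∘ γ) s))
    (g := fun s => ((coord x₀ ∘ δ) s, deriv (coord x₀ ∘ δ) s))
    (by
      filter_upwards [hγ, heγ, hcγ.eventually hs] with r h1 h2 h3
      exact ⟨h1.hasDerivAt h2, h3⟩)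
    (by
      rw [e0] at hs
      filter_upwards [hδ, heδ, hcδ.eventually hs] with r h1 h2 h3
      exact ⟨h1.hasDerivAt h2, h3⟩)
    e0
  filter_upwards [hu, heγ, heδ] with r h1 h2 h3
  have h4 : coord x₀ (γ r) = coord x₀ (δ r) := congrArg Prod.fst h1
  rw [← ofCoord_coord h2, h4, ofCoord_coord h3]

/-- Uniqueness of geodesics. -/
lemma IsGeodesicOn.eqOn [T2Space M] {γ δ : ℝ → M} {J : Set ℝ} (hJ : IsOpen J)
    (hJc : J.OrdConnected) (hγ : IsGeodesicOn γ J) (hδ : IsGeodesicOn δ J) {t₀ : ℝ} (h₀ : t₀ ∈ J)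
    (h : (⟨γ t₀, velocity γ t₀⟩ : TangentBundle (𝓡 3) M) = ⟨δ t₀, velocity δ t₀⟩) :
    EqOn γ δ J := by
  rw [isGeodesicOn_iff hJ] at hγ hδ
  have hγe : ∀ t ∈ J, ∀ᶠ s in 𝓝 t, IsGeodesicAt γ s := fun t ht =>
    eventually_of_mem (hJ.mem_nhds ht) hγ
  have hδe : ∀ t ∈ J, ∀ᶠ s in 𝓝 t, IsGeodesicAt δ s := fun t ht =>
    eventually_of_mem (hJ.mem_nhds ht) hδ
  -- The set of parameters where the two germs agree is open, so by connectedness of `J` it suffices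
  -- that it is closed in `J`. At a limit point the values agree because `M` is Hausdorff, the chart
  -- velocities agree by continuity, and local uniqueness concludes.
  have hsub : J ⊆ {t | γ =ᶠ[𝓝 t] δ} := by
    refine hJc.isPreconnected.subset_of_closure_inter_subset isOpen_setOfPred_eventually_nhds
      ⟨t₀, h₀, ?_⟩ ?_
    · have h1 : γ t₀ = δ t₀ := congrArg TotalSpace.proj h
      refine IsGeodesicAt.eventuallyEq (hγe t₀ h₀) (hδe t₀ h₀) h1 ?_
      have hs : γ t₀ ∈ coordSource (γ t₀) := mem_coordSource _
      have e1 := coordVec_mfderiv (x₀ := γ t₀) ((hγ t₀ h₀).1.mdifferentiableAt (by simp)) hs (1 : ℝ)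
      have e2 := coordVec_mfderiv (x₀ := γ t₀) ((hδ t₀ h₀).1.mdifferentiableAt (by simp)) (h1 ▸ hs) (1 : ℝ)
      have e3 := congrArg (fun z : TangentBundle (𝓡 3) M => coordVec (γ t₀) z.1 z.2) h
      exact e1.symm.trans (e3.trans e2)
    · rintro t ⟨htc, htJ⟩
      have hfreq : ∃ᶠ s in 𝓝 t, γ =ᶠ[𝓝 s] δ := mem_closure_iff_frequently.1 htc
      have h1 : γ t = δ t := by
        have hc : ContinuousAt (fun s => (γ s, δ s)) t :=
          (hγ t htJ).1.continuousAt.prodMk (hδ t htJ).1.continuousAt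
        by_contra hne
        have hev : ∀ᶠ s in 𝓝 t, (γ s, δ s) ∈ (diagonal M)ᶜ :=
          hc.eventually (isClosed_diagonal.isOpen_compl.mem_nhds hne)
        obtain ⟨s, hs1, hs2⟩ := (hfreq.and_eventually hev).exists
        exact hs2 hs1.eq_of_nhds
      refine IsGeodesicAt.eventuallyEq (hγe t htJ) (hδe t htJ) h1 ?_
      have hs : γ t ∈ coordSource (γ t) := mem_coordSource _
      have hcγ : ContinuousAt (deriv (coord (γ t) ∘ γ)) t :=
        continuous_snd.continuousAt.comp ((hγ t htJ).hasDerivAt hs).continuousAt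
      have hcδ : ContinuousAt (deriv (coord (γ t) ∘ δ)) t :=
        continuous_snd.continuousAt.comp ((hδ t htJ).hasDerivAt (h1 ▸ hs)).continuousAt
      by_contra hne
      have hev : ∀ᶠ s in 𝓝 t, deriv (coord (γ t) ∘ γ) s ≠ deriv (coord (γ t) ∘ δ) s :=
        (hcγ.ne_iff_eventually_ne hcδ).1 hne
      obtain ⟨s, hs1, hs2⟩ := (hfreq.and_eventually hev).exists
      exact hs2 (hs1.fun_comp (coord (γ t))).deriv_eq
  exact fun t ht => (hsub ht).eq_of_nhds

/-- The velocity picks up a factor `a`, and the chain rule a second one, in front of the vanishing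
acceleration. The value `a = 0` is allowed; it covers the zero vector in the exponential map. -/
lemma IsGeodesicAt.scale {γ : ℝ → M} {a t : ℝ} (hγ : ∀ᶠ s in 𝓝 (a * t), IsGeodesicAt γ s) :
    IsGeodesicAt (fun s => γ (a * s)) t := by
  have hca : ContDiffAt ℝ ∞ (fun s : ℝ => a * s) t := by fun_prop
  have hc : HasDerivAt (fun s : ℝ => a * s) (a • (1 : ℝ)) t := by
    simpa using (hasDerivAt_id t).const_mul a
  have h0 := hγ.self_of_nhds
  refine ⟨h0.1.comp t hca.contMDiffAt, ?_⟩
  have hev : ∀ᶠ s in 𝓝 t, velocity (fun s => γ (a * s)) s = a • velocity γ (a * s) := by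
    filter_upwards [hca.continuousAt.eventually hγ] with s hs
    exact velocity_scale hs.1
  have hv := isSmoothFieldAt_velocity h0.1
  rw [covDeriv_congr hev, covDeriv_comp (f := γ) (X := fun s => a • velocity γ s)
    (c := fun s => a * s) (hv.const_smul a) hca, covDir_const_smul hv, hc.deriv,
    covDir_smul_dir, ← covDeriv_eq_covDir, h0.2, smul_zero, smul_zero]

lemma coordVec_covDir_ofCoord {x₀ : M} {φ ξ : P → E3} {p : P} (hφ : ContDiffAt ℝ ∞ φ p)
    (hξ : ContDiffAt ℝ ∞ ξ p) (hp : φ p ∈ coordTarget x₀) (w : P) :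
    coordVec x₀ (ofCoord x₀ (φ p)) (covDir (fun q => ofCoord x₀ (φ q))
      (fun q => ofCoordVec x₀ (ofCoord x₀ (φ q)) (ξ q)) p w) = covD (chartMetric x₀) φ ξ p w := by
  refine (coordVec_covDir (isSmoothFieldAt_ofCoord hφ hξ hp) (ofCoord_mem hp) w).trans ?_
  exact covD_congr (eventually_coord_ofCoord hφ.continuousAt hp)
    (eventually_coordVec_ofCoordVec hφ.continuousAt hp) w

/-- Solutions of the parallel transport equation in a chart are parallel fields. -/
lemma isParallelOn_ofCoord {x₀ : M} {y ξ : ℝ → E3} {J : Set ℝ} (hJ : IsOpen J)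
    (hy : ContDiffOn ℝ ∞ y J) (hξ : ContDiffOn ℝ ∞ ξ J) (hmem : ∀ t ∈ J, y t ∈ coordTarget x₀)
    (h : ∀ t ∈ J, covD (chartMetric x₀) y ξ t 1 = 0) :
    IsParallelOn (fun t => ofCoord x₀ (y t)) (fun t => ofCoordVec x₀ (ofCoord x₀ (y t)) (ξ t)) J := by
  refine (isParallelOn_iff hJ).2 fun t ht => ?_
  have h1 := hy.contDiffAt (hJ.mem_nhds ht)
  have h2 := hξ.contDiffAt (hJ.mem_nhds ht)
  refine ⟨isSmoothFieldAt_ofCoord h1 h2 (hmem t ht), ?_⟩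
  rw [covDeriv_eq_covDir]
  refine coordVec_injective (x₀ := x₀) (ofCoord_mem (hmem t ht)) ?_
  refine (coordVec_covDir_ofCoord h1 h2 (hmem t ht) 1).trans ?_
  rw [h t ht]
  exact (map_zero _).symm

/-- Solutions of the geodesic equation in a chart are geodesics. -/
lemma isGeodesicOn_ofCoord {x₀ : M} {y w : ℝ → E3} {J : Set ℝ} (hJ : IsOpen J)
    (hy : ContDiffOn ℝ ∞ y J) (hmem : ∀ t ∈ J, y t ∈ coordTarget x₀)
    (h : ∀ t ∈ J, HasDerivAt (fun s => (y s, w s)) (spray (chartMetric x₀) (y t, w t)) t) :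
    IsGeodesicOn (fun t => ofCoord x₀ (y t)) J ∧ ∀ t ∈ J,
      velocity (fun t => ofCoord x₀ (y t)) t = ofCoordVec x₀ (ofCoord x₀ (y t)) (w t) := by
  have hd : ∀ t ∈ J, HasDerivAt y (w t) t := fun t ht => (h t ht).fst
  have hvel : ∀ t ∈ J, velocity (fun t => ofCoord x₀ (y t)) t =
      ofCoordVec x₀ (ofCoord x₀ (y t)) (w t) := fun t ht => by
    rw [← (hd t ht).deriv]
    exact mfderiv_ofCoord_comp (hy.contDiffAt (hJ.mem_nhds ht)) (hmem t ht) 1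
  have hw : ContDiffOn ℝ ∞ w J := by
    refine ((contDiffOn_infty_iff_deriv_of_isOpen hJ).1 hy).2.congr fun t ht => ?_
    exact (hd t ht).deriv.symm
  have hpar := isParallelOn_ofCoord hJ hy hw hmem (fun t ht => by
    have e : HasDerivAt w (-christoffelB (chartMetric x₀) (y t) (w t) (w t)) t := (h t ht).snd
    change deriv w t + christoffelB (chartMetric x₀) (y t) (deriv y t) (w t) = 0
    rw [e.deriv, (hd t ht).deriv, neg_add_cancel])
  refine ⟨⟨fun t ht => (contMDiffAt_ofCoord_comp (hy.contDiffAt (hJ.mem_nhds ht))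
    (hmem t ht)).contMDiffWithinAt, fun t ht => ?_⟩, hvel⟩
  rw [covDeriv_congr (eventually_of_mem (hJ.mem_nhds ht) hvel)]
  exact hpar.2 t ht

end ParallelFields

/-! ### The exponential map and the rulings of a cylinder -/

section Exponential

open Filter Topology

set_option maxSynthPendingDepth 3

/-- Supplies the margin around `[0, 1]` demanded by `IsExpCurve`. -/
lemma exists_Ioo_subset {K : Set ℝ} (hK : IsOpen K) (hKc : K.OrdConnected) (h0 : (0 : ℝ) ∈ K)
    (h1 : (1 : ℝ) ∈ K) : ∃ ε > 0, Ioo (-ε) (1 + ε) ⊆ K := by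
  obtain ⟨a, ha, hA⟩ := Metric.isOpen_iff.1 hK 0 h0
  obtain ⟨b, hb, hB⟩ := Metric.isOpen_iff.1 hK 1 h1
  refine ⟨min a b, lt_min ha hb, fun t ht => ?_⟩
  rcases le_or_gt t 0 with h | h
  · refine hA ?_
    rw [Metric.mem_ball, Real.dist_eq, sub_zero, abs_lt]
    exact ⟨by linarith [ht.1, min_le_left a b], by linarith⟩
  · rcases le_or_gt 1 t with h' | h'
    · refine hB ?_
      rw [Metric.mem_ball, Real.dist_eq, abs_lt]
      exact ⟨by linarith, by linarith [ht.2, min_le_right a b]⟩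
    · exact hKc.out h0 h1 ⟨h.le, h'.le⟩

lemma ordConnected_preimage_mul {J : Set ℝ} (hJ : J.OrdConnected) (a : ℝ) :
    {t : ℝ | a * t ∈ J}.OrdConnected := by
  rw [← convex_iff_ordConnected] at hJ ⊢
  exact hJ.linear_preimage (LinearMap.mulLeft ℝ a)

variable {M : Type*} [TopologicalSpace M] [ChartedSpace E3 M]

lemma totalSpace_mk_smul {x y : M} {X : TangentSpace (𝓡 3) x} {Y : TangentSpace (𝓡 3) y}
    (h : (⟨x, X⟩ : TangentBundle (𝓡 3) M) = ⟨y, Y⟩) (a : ℝ) :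
    (⟨x, a • X⟩ : TangentBundle (𝓡 3) M) = ⟨y, a • Y⟩ := by
  cases h
  rfl

variable [IsManifold (𝓡 3) ∞ M]
  [RiemannianBundle (fun x : M => TangentSpace (𝓡 3) x)]

namespace IntrinsicCylinder

variable (C : IntrinsicCylinder M)

/-- The parameters of the ruling through `C.β u`. -/
def ruling (u : ℝ) : Set ℝ := {v : ℝ | (u, v) ∈ C.W}

lemma isOpen_ruling (u : ℝ) : IsOpen (C.ruling u) :=
  C.isOpen_W.preimage (by fun_prop : Continuous fun v : ℝ => (u, v))

lemma contMDiffAt_param {p : ℝ × ℝ} (hp : p ∈ C.W) :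
    ContMDiffAt 𝓘(ℝ, ℝ × ℝ) (𝓡 3) ∞ C.param p :=
  C.smooth.contMDiffAt (C.isOpen_W.mem_nhds hp)

lemma velocity_ruling {p : ℝ × ℝ} (hp : p ∈ C.W) :
    velocity (fun v => C.param (p.1, v)) p.2 = partialV C.param p :=
  velocity_comp (c := fun v => (p.1, v))
    ((C.contMDiffAt_param hp).mdifferentiableAt (by simp))
    ((hasDerivAt_const _ _).prodMk (hasDerivAt_id _))

end IntrinsicCylinder

variable [IsContMDiffRiemannianBundle (𝓡 3) ∞ E3 (fun x : M => TangentSpace (𝓡 3) x)]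

lemma IsGeodesicOn.scale {γ : ℝ → M} {J : Set ℝ} (hJ : IsOpen J) (h : IsGeodesicOn γ J) (a : ℝ) :
    IsGeodesicOn (fun t => γ (a * t)) {t : ℝ | a * t ∈ J} := by
  have hJ' : IsOpen {t : ℝ | a * t ∈ J} := hJ.preimage (continuous_const_mul a)
  rw [isGeodesicOn_iff hJ] at h
  rw [isGeodesicOn_iff hJ']
  exact fun t ht => IsGeodesicAt.scale (eventually_of_mem (hJ.mem_nhds ht) h)

/-- The exponential map along a geodesic. -/
lemma isExpCurve_scale {σ : ℝ → M} {J : Set ℝ} (hJ : IsOpen J) (hJc : J.OrdConnected)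
    (hσ : IsGeodesicOn σ J) (h0 : (0 : ℝ) ∈ J) {x : M} {w : TangentSpace (𝓡 3) x}
    (hw : (⟨σ 0, velocity σ 0⟩ : TangentBundle (𝓡 3) M) = ⟨x, w⟩) {s : ℝ} (hs : s ∈ J) :
    IsExpCurve (⟨x, s • w⟩ : TangentBundle (𝓡 3) M) (fun t => σ (s * t)) := by
  obtain ⟨ε, hε, hsub⟩ := exists_Ioo_subset (hJ.preimage (continuous_const_mul s))
    (ordConnected_preimage_mul hJc s) (by simpa using h0) (by simpa using hs)
  have h := hσ.scale hJ s
  refine ⟨⟨ε, hε, h.1.mono hsub, fun t ht => h.2 t (hsub ht)⟩, ?_⟩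
  rw [velocity_scale (by rw [mul_zero]; exact hσ.1.contMDiffAt (hJ.mem_nhds h0))]
  have h1 : (⟨σ (s * 0), velocity σ (s * 0)⟩ : TangentBundle (𝓡 3) M) = ⟨x, w⟩ := by
    rw [mul_zero]; exact hw
  exact totalSpace_mk_smul h1 s

variable [T2Space M]

/-- The curve selected in `expMap` and `γ` are geodesics with the same initial velocity, so they
agree on their common interval, which contains `0` and `1`. -/
lemma expMap_eq {w : TangentBundle (𝓡 3) M} {γ : ℝ → M} (h : IsExpCurve w γ) :
    expMap w = γ 1 := by
  have hw : w ∈ expDomain M := ⟨γ, h⟩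
  rw [expMap, dif_pos hw]
  obtain ⟨⟨ε, hε, hγ⟩, h0⟩ := h
  obtain ⟨⟨ε', hε', hδ⟩, h0'⟩ := hw.choose_spec
  have hm : 0 < min ε ε' := lt_min hε hε'
  have hs : Ioo (-(min ε ε')) (1 + min ε ε') ⊆ Ioo (-ε) (1 + ε) :=
    Ioo_subset_Ioo (neg_le_neg (min_le_left _ _)) (by linarith [min_le_left ε ε'])
  have hs' : Ioo (-(min ε ε')) (1 + min ε ε') ⊆ Ioo (-ε') (1 + ε') :=
    Ioo_subset_Ioo (neg_le_neg (min_le_right _ _)) (by linarith [min_le_right ε ε'])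
  exact IsGeodesicOn.eqOn isOpen_Ioo ordConnected_Ioo (t₀ := 0) (J := Ioo (-(min ε ε'))
    (1 + min ε ε')) ⟨hδ.1.mono hs', fun t ht => hδ.2 t (hs' ht)⟩
    ⟨hγ.1.mono hs, fun t ht => hγ.2 t (hs ht)⟩
    ⟨by linarith, by linarith⟩ (h0'.trans h0.symm) ⟨by linarith, by linarith⟩

lemma expMap_smul {σ : ℝ → M} {J : Set ℝ} (hJ : IsOpen J) (hJc : J.OrdConnected)
    (hσ : IsGeodesicOn σ J) (h0 : (0 : ℝ) ∈ J) {x : M} {w : TangentSpace (𝓡 3) x}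
    (hw : (⟨σ 0, velocity σ 0⟩ : TangentBundle (𝓡 3) M) = ⟨x, w⟩) {s : ℝ} (hs : s ∈ J) :
    expMap (⟨x, s • w⟩ : TangentBundle (𝓡 3) M) = σ s := by
  rw [expMap_eq (isExpCurve_scale hJ hJc hσ h0 hw hs), mul_one]

namespace IntrinsicCylinder

variable (C : IntrinsicCylinder M)

/-- A geodesic witnessing that `v V(u)` lies in the domain of the exponential map becomes, after
rescaling time by `v⁻¹`, a geodesic with initial velocity `V(u)` defined on an interval containing
both `0` and `v`. -/
lemma exists_local_ruling {u v : ℝ} (hv : (u, v) ∈ C.W) (hv0 : v ≠ 0) :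
    ∃ (J : Set ℝ) (σ : ℝ → M), IsOpen J ∧ 0 ∈ J ∧ v ∈ J ∧ IsGeodesicOn σ J ∧
      (⟨σ 0, velocity σ 0⟩ : TangentBundle (𝓡 3) M) = ⟨C.β u, C.V u⟩ ∧
      ∀ s ∈ J, C.param (u, s) = σ s := by
  obtain ⟨γ, ⟨ε, hε, hγ⟩, hγ0⟩ := C.mem_expDomain (u, v) hv
  have h0 : (0 : ℝ) ∈ Ioo (-ε) (1 + ε) := ⟨by linarith, by linarith⟩
  have h1 : (1 : ℝ) ∈ Ioo (-ε) (1 + ε) := ⟨by linarith, by linarith⟩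
  have hJ : IsOpen {t : ℝ | v⁻¹ * t ∈ Ioo (-ε) (1 + ε)} :=
    isOpen_Ioo.preimage (continuous_const_mul _)
  have hJc := ordConnected_preimage_mul (ordConnected_Ioo (a := -ε) (b := 1 + ε)) v⁻¹
  have hσ := hγ.scale isOpen_Ioo v⁻¹
  have hJ0 : (0 : ℝ) ∈ {t : ℝ | v⁻¹ * t ∈ Ioo (-ε) (1 + ε)} := by simpa using h0
  have hJv : v ∈ {t : ℝ | v⁻¹ * t ∈ Ioo (-ε) (1 + ε)} := by
    change v⁻¹ * v ∈ Ioo (-ε) (1 + ε)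
    rwa [inv_mul_cancel₀ hv0]
  have hw : (⟨γ (v⁻¹ * 0), velocity (fun t => γ (v⁻¹ * t)) 0⟩ : TangentBundle (𝓡 3) M) =
      ⟨C.β u, C.V u⟩ := by
    rw [velocity_scale (by rw [mul_zero]; exact hγ.1.contMDiffAt (isOpen_Ioo.mem_nhds h0))]
    have h2 : (⟨γ (v⁻¹ * 0), velocity γ (v⁻¹ * 0)⟩ : TangentBundle (𝓡 3) M) =
        ⟨C.β u, v • C.V u⟩ := by
      rw [mul_zero]; exact hγ0
    rw [totalSpace_mk_smul h2 v⁻¹, smul_smul, inv_mul_cancel₀ hv0, one_smul]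
  exact ⟨_, fun t => γ (v⁻¹ * t), hJ, hJ0, hJv, hσ, hw,
    fun s hs => expMap_smul hJ hJc hσ hJ0 hw hs⟩

/-- At `v = 0` rescaling is impossible; a nearby nonzero parameter of the same ruling serves
instead, since its interval contains `0` as well. -/
lemma exists_local_ruling' {u v : ℝ} (hv : (u, v) ∈ C.W) :
    ∃ (J : Set ℝ) (σ : ℝ → M), IsOpen J ∧ 0 ∈ J ∧ v ∈ J ∧ IsGeodesicOn σ J ∧
      (⟨σ 0, velocity σ 0⟩ : TangentBundle (𝓡 3) M) = ⟨C.β u, C.V u⟩ ∧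
      ∀ s ∈ J, C.param (u, s) = σ s := by
  rcases eq_or_ne v 0 with rfl | hv0
  · obtain ⟨ε, hε, hs⟩ := Metric.isOpen_iff.1 (C.isOpen_ruling u) 0 hv
    have h : ε / 2 ∈ C.ruling u := hs (by
      rw [Metric.mem_ball, Real.dist_eq, sub_zero, abs_of_pos (by positivity)]; linarith)
    obtain ⟨J, σ, h1, h2, -, h3⟩ := C.exists_local_ruling (u := u) h (by positivity)
    exact ⟨J, σ, h1, h2, h2, h3⟩
  · exact C.exists_local_ruling hv hv0

lemma isGeodesicOn_ruling (u : ℝ) : IsGeodesicOn (fun v => C.param (u, v)) (C.ruling u) := by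
  rw [isGeodesicOn_iff (C.isOpen_ruling u)]
  intro v hv
  obtain ⟨J, σ, hJ, -, hvJ, hσ, -, h⟩ := C.exists_local_ruling' hv
  rw [isGeodesicOn_iff hJ] at hσ
  exact (hσ v hvJ).congr (eventually_of_mem (hJ.mem_nhds hvJ) fun s hs => (h s hs).symm)

lemma velocity_ruling_zero {u : ℝ} (hu : u ∈ C.I) :
    (⟨C.param (u, 0), velocity (fun v => C.param (u, v)) 0⟩ : TangentBundle (𝓡 3) M) =
      ⟨C.β u, C.V u⟩ := by
  obtain ⟨J, σ, hJ, h0, -, hσ, hw, h⟩ := C.exists_local_ruling' (C.basis_mem u hu)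
  rw [← hw]
  exact velocity_total_congr (eventually_of_mem (hJ.mem_nhds h0) h)

/-- The velocity of a ruling is parallel along it, because rulings are geodesics, and it starts at
`V(u)`. Uniqueness of parallel fields identifies it with the transported field. -/
lemma axis_eq {p : ℝ × ℝ} (hp : p ∈ C.W) : C.axis p = partialV C.param p := by
  have hu := C.fst_mem p hp
  have hpar := (C.isGeodesicOn_ruling p.1).isParallelOn (C.isOpen_ruling p.1)
  have hex : ∃ X : ∀ t, TangentSpace (𝓡 3) (C.param (p.1, t)),
      IsParallelOn (fun v => C.param (p.1, v)) X {v : ℝ | (p.1, v) ∈ C.W} ∧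
      (⟨C.param (p.1, 0), X 0⟩ : TangentBundle (𝓡 3) M) = ⟨C.β p.1, C.V p.1⟩ :=
    ⟨_, hpar, C.velocity_ruling_zero hu⟩
  rw [← C.velocity_ruling hp]
  have h1 : C.axis p = hex.choose p.2 := by
    rw [axis, parallelTransport, dif_pos hex]
  rw [h1]
  obtain ⟨h2, h3⟩ := hex.choose_spec
  refine h2.unique (C.isOpen_ruling p.1) (C.ordConnected_ruling p.1 hu) hpar
    (t₀ := 0) (C.basis_mem _ hu) ?_ hp
  exact TotalSpace.mk_injective (F := E3) _ (h3.trans (C.velocity_ruling_zero hu).symm)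

end IntrinsicCylinder

end Exponential

/-! ### The derivatives of the axis of a cylinder -/

section AxisDerivative

open Filter Topology

set_option maxSynthPendingDepth 3

variable {M : Type*} [TopologicalSpace M] [ChartedSpace E3 M]
  [RiemannianBundle (fun x : M => TangentSpace (𝓡 3) x)]

lemma totalSpace_norm_eq {x y : M} {X : TangentSpace (𝓡 3) x} {Y : TangentSpace (𝓡 3) y}
    (h : (⟨x, X⟩ : TangentBundle (𝓡 3) M) = ⟨y, Y⟩) : ‖X‖ = ‖Y‖ := by
  cases h
  rfl

lemma firstFundamentalForm_apply (f : ℝ × ℝ → M) (p a b : ℝ × ℝ) :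
    firstFundamentalForm f p a b = inner ℝ (mfderiv 𝓘(ℝ, ℝ × ℝ) (𝓡 3) f p a : TangentSpace (𝓡 3) (f p))
      (mfderiv 𝓘(ℝ, ℝ × ℝ) (𝓡 3) f p b : TangentSpace (𝓡 3) (f p)) := rfl

variable [IsManifold (𝓡 3) ∞ M]

lemma covDir_prod (f : ℝ × ℝ → M) (X : ∀ p, TangentSpace (𝓡 3) (f p)) (p w : ℝ × ℝ) :
    covDir f X p w = w.1 • covDir f X p (1, 0) + w.2 • covDir f X p (0, 1) := by
  rw [← covDir_smul_dir, ← covDir_smul_dir, ← covDir_add_dir]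
  simp

namespace IntrinsicCylinder

variable {C : IntrinsicCylinder M}

lemma isSmoothFieldAt_partialU {p : ℝ × ℝ} (hp : p ∈ C.W) :
    IsSmoothFieldAt C.param (partialU C.param) p :=
  isSmoothFieldAt_mfderiv (C.contMDiffAt_param hp) _

lemma isSmoothFieldAt_partialV {p : ℝ × ℝ} (hp : p ∈ C.W) :
    IsSmoothFieldAt C.param (partialV C.param) p :=
  isSmoothFieldAt_mfderiv (C.contMDiffAt_param hp) _

end IntrinsicCylinder

variable [IsContMDiffRiemannianBundle (𝓡 3) ∞ E3 (fun x : M => TangentSpace (𝓡 3) x)]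

lemma contDiffAt_inner_field {P : Type*} [NormedAddCommGroup P] [NormedSpace ℝ P] {f : P → M}
    {X Y : ∀ p, TangentSpace (𝓡 3) (f p)} {p : P}
    (hX : IsSmoothFieldAt f X p) (hY : IsSmoothFieldAt f Y p) :
    ContDiffAt ℝ ∞ (fun q => inner ℝ (X q) (Y q)) p :=
  (ContMDiffAt.inner_bundle hX hY).contDiffAt

lemma isMetricOn_firstFundamentalForm {f : ℝ × ℝ → M} {U : Set (ℝ × ℝ)} (hU : IsOpen U)
    (hf : ∀ p ∈ U, ContMDiffAt 𝓘(ℝ, ℝ × ℝ) (𝓡 3) ∞ f p)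
    (hinj : ∀ p ∈ U, Function.Injective (mfderiv 𝓘(ℝ, ℝ × ℝ) (𝓡 3) f p)) :
    IsMetricOn (firstFundamentalForm f) U where
  isOpen := hU
  contDiffOn := contDiffOn_clm_apply.2 fun a => contDiffOn_clm_apply.2 fun b => fun p hp =>
    (contDiffAt_inner_field (isSmoothFieldAt_mfderiv (hf p hp) a)
      (isSmoothFieldAt_mfderiv (hf p hp) b)).contDiffWithinAt
  symm p _ a b := by
    rw [firstFundamentalForm_apply, firstFundamentalForm_apply, real_inner_comm]
  pos p hp a ha := by
    rw [firstFundamentalForm_apply, real_inner_self_eq_norm_sq]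
    refine pow_pos (norm_pos_iff.2 fun h => ha (hinj p hp (h.trans ?_))) 2
    exact (map_zero _).symm

namespace IntrinsicCylinder

variable (C : IntrinsicCylinder M)

/-- The covariant derivative of the axis in the direction `∂/∂u`. -/
def axisDeriv (p : ℝ × ℝ) : TangentSpace (𝓡 3) (C.param p) :=
  covDir C.param (partialV C.param) p (1, 0)

variable {C}

lemma isMetricOn : IsMetricOn (firstFundamentalForm C.param) C.W :=
  isMetricOn_firstFundamentalForm C.isOpen_W (fun _ hp => C.contMDiffAt_param hp) C.immersion

lemma isSmoothFieldAt_axisDeriv {p : ℝ × ℝ} (hp : p ∈ C.W) :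
    IsSmoothFieldAt C.param C.axisDeriv p :=
  IsSmoothFieldAt.covDir (eventually_of_mem (C.isOpen_W.mem_nhds hp)
    fun _ hq => isSmoothFieldAt_partialV hq) _

/-- Torsion-freeness: `∇_v ∂_u = ∇_u ∂_v`. -/
lemma covDir_partialU_snd {p : ℝ × ℝ} (hp : p ∈ C.W) :
    covDir C.param (partialU C.param) p (0, 1) = C.axisDeriv p :=
  covDir_mfderiv_comm (C.contMDiffAt_param hp) _ _

lemma covDeriv_comp_ruling {X : ∀ p, TangentSpace (𝓡 3) (C.param p)} {p : ℝ × ℝ}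
    (hX : IsSmoothFieldAt C.param X p) :
    covDeriv (fun v => C.param (p.1, v)) (fun v => X (p.1, v)) p.2 = covDir C.param X p (0, 1) := by
  have hd : HasDerivAt (fun v : ℝ => (p.1, v)) (0, 1) p.2 :=
    (hasDerivAt_const _ _).prodMk (hasDerivAt_id _)
  have h := covDeriv_comp (f := C.param) (X := X) (c := fun v => (p.1, v)) (t := p.2) hX
    (by fun_prop)
  rw [hd.deriv] at h
  exact h

lemma covDeriv_comp_basis {X : ∀ p, TangentSpace (𝓡 3) (C.param p)} {p : ℝ × ℝ}
    (hX : IsSmoothFieldAt C.param X p) :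
    covDeriv (fun u => C.param (u, p.2)) (fun u => X (u, p.2)) p.1 = covDir C.param X p (1, 0) := by
  have hd : HasDerivAt (fun u : ℝ => (u, p.2)) (1, 0) p.1 :=
    (hasDerivAt_id _).prodMk (hasDerivAt_const _ _)
  have h := covDeriv_comp (f := C.param) (X := X) (c := fun u => (u, p.2)) (t := p.1) hX
    (by fun_prop)
  rw [hd.deriv] at h
  exact h

variable [T2Space M]

lemma covDir_partialV_snd {p : ℝ × ℝ} (hp : p ∈ C.W) :
    covDir C.param (partialV C.param) p (0, 1) = 0 := by
  rw [← covDeriv_comp_ruling (isSmoothFieldAt_partialV hp)]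
  refine Eq.trans (covDeriv_congr ?_) ((C.isGeodesicOn_ruling p.1).2 p.2 hp)
  filter_upwards [(C.isOpen_ruling p.1).mem_nhds hp] with v hv
  exact (C.velocity_ruling hv).symm

/-- Since `∇_v ∂_v = 0`, the field `axisDeriv` contains all first-order information on the axis. -/
lemma covDir_partialV {p : ℝ × ℝ} (hp : p ∈ C.W) (w : ℝ × ℝ) :
    covDir C.param (partialV C.param) p w = w.1 • C.axisDeriv p := by
  rw [covDir_prod, covDir_partialV_snd hp, smul_zero, add_zero]
  rfl

lemma isSmoothFieldAt_axis {p : ℝ × ℝ} (hp : p ∈ C.W) : IsSmoothFieldAt C.param C.axis p := by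
  refine (isSmoothFieldAt_partialV hp).congr_of_eventuallyEq ?_
  filter_upwards [C.isOpen_W.mem_nhds hp] with q hq
  rw [C.axis_eq hq]

lemma covDeriv_axis {c : ℝ → ℝ × ℝ} {t : ℝ} (hc : ContDiffAt ℝ ∞ c t) (ht : c t ∈ C.W) :
    covDeriv (fun s => C.param (c s)) (fun s => C.axis (c s)) t =
      (deriv c t).1 • C.axisDeriv (c t) := by
  rw [← covDir_partialV ht, ← covDeriv_comp (isSmoothFieldAt_partialV ht) hc]
  refine covDeriv_congr ?_
  filter_upwards [hc.continuousAt.eventually (C.isOpen_W.mem_nhds ht)] with s hs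
  exact C.axis_eq hs

lemma norm_partialV {p : ℝ × ℝ} (hp : p ∈ C.W) : ‖partialV C.param p‖ = 1 := by
  have hu := C.fst_mem p hp
  rw [← C.velocity_ruling hp, ← C.norm_V p.1 hu, ← totalSpace_norm_eq (C.velocity_ruling_zero hu)]
  exact ((C.isGeodesicOn_ruling p.1).isParallelOn (C.isOpen_ruling p.1)).norm_eq
    (C.isOpen_ruling p.1) (C.ordConnected_ruling p.1 hu) hp (C.basis_mem p.1 hu)

/-- On the basis the axis is `V`, which is parallel along `β`. This is the initial condition of both
arguments along the rulings. -/
lemma axisDeriv_basis {u : ℝ} (hu : u ∈ C.I) : C.axisDeriv (u, 0) = 0 := by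
  have hW := C.basis_mem u hu
  rw [axisDeriv, ← covDeriv_comp_basis (isSmoothFieldAt_partialV hW)]
  -- The curves `s ↦ C.param (s, 0)` and `C.β` agree only propositionally, so the comparison takes
  -- place in the tangent bundle.
  have h1 := covDerivTotal_congr
    (F := fun s => (⟨C.param (s, 0), partialV C.param (s, 0)⟩ : TangentBundle (𝓡 3) M))
    (G := fun s => (⟨C.β s, C.V s⟩ : TangentBundle (𝓡 3) M)) (t := u) (by
      filter_upwards [C.isOpen_I.mem_nhds hu] with s hs
      rw [← C.velocity_ruling (C.basis_mem s hs)]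
      exact C.velocity_ruling_zero hs)
  exact (totalSpace_mk_eq_zero_iff h1).2 (C.parallel_V.2 u hu)

/-- Differentiating `⟨∂_v, ∂_v⟩ = 1` in the direction `∂_u`. -/
lemma inner_axisDeriv_partialV {p : ℝ × ℝ} (hp : p ∈ C.W) :
    inner ℝ (C.axisDeriv p) (partialV C.param p) = 0 := by
  have hs := isSmoothFieldAt_partialV hp
  have h1 := (fderiv_inner hs hs).2 (1, 0)
  have h2 : (fun q => inner ℝ (partialV C.param q) (partialV C.param q)) =ᶠ[𝓝 p] fun _ => (1 : ℝ) := by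
    filter_upwards [C.isOpen_W.mem_nhds hp] with q hq
    rw [real_inner_self_eq_norm_sq, norm_partialV hq, one_pow]
  rw [h2.fderiv_eq, real_inner_comm (covDir _ _ _ _)] at h1
  change (fderiv ℝ (fun _ => (1 : ℝ)) p) (1, 0) = inner ℝ (C.axisDeriv p) (partialV C.param p) +
    inner ℝ (C.axisDeriv p) (partialV C.param p) at h1
  simp only [fderiv_fun_const, Pi.zero_apply, zero_apply] at h1
  linarith

/-- The curves `v = const`, traversed with `u' = 1`, already detect `axisDeriv`; along any other
curve the derivative of the axis is a multiple of it. -/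
lemma axisParallel_iff : C.AxisParallel ↔ ∀ p ∈ C.W, C.axisDeriv p = 0 := by
  constructor
  · intro h p hp
    obtain ⟨ε, hε, hs⟩ := Metric.isOpen_iff.1 (C.isOpen_W.preimage
      (by fun_prop : Continuous fun u : ℝ => (u, p.2))) p.1 hp
    have hd : HasDerivAt (fun u : ℝ => (u, p.2)) (1, 0) p.1 :=
      (hasDerivAt_id _).prodMk (hasDerivAt_const _ _)
    rw [Real.ball_eq_Ioo] at hs
    have h1 := (h _ (fun u => (u, p.2)) isOpen_Ioo ordConnected_Ioo (by fun_prop)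
      (fun u hu => hs hu)).2 p.1 ⟨by linarith, by linarith⟩
    rw [covDeriv_axis (c := fun u => (u, p.2)) (t := p.1) (by fun_prop) hp, hd.deriv, one_smul] at h1
    exact h1
  · intro h J c hJ _ hc hm
    refine (isParallelOn_iff hJ).2 fun t ht => ?_
    have hct := hc.contDiffAt (hJ.mem_nhds ht)
    refine ⟨(isSmoothFieldAt_axis (hm ht)).comp hct, ?_⟩
    rw [covDeriv_axis hct (hm ht), h _ (hm ht), smul_zero]

end IntrinsicCylinder

end AxisDerivative

/-! ### The curvatures of a cylinder -/

/-! ### Plane metrics whose `v`-lines are unit speed geodesics -/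

section PlaneMetrics

open Filter Topology

set_option maxSynthPendingDepth 3

variable {g : ℝ × ℝ → ℝ × ℝ →L[ℝ] ℝ × ℝ →L[ℝ] ℝ} {W : Set (ℝ × ℝ)}

lemma IsMetricOn.ext_plane (hg : IsMetricOn g W) {p a b : ℝ × ℝ} (hp : p ∈ W)
    (h1 : g p a (1, 0) = g p b (1, 0)) (h2 : g p a (0, 1) = g p b (0, 1)) : a = b := by
  refine hg.ext_left hp fun c => ?_
  have hc : c = c.1 • ((1, 0) : ℝ × ℝ) + c.2 • ((0, 1) : ℝ × ℝ) := by simp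
  rw [hc, map_add, map_add, map_smul, map_smul, map_smul, map_smul, h1, h2]

/-- `g` is a metric of the form `E du² + 2 F du dv + dv²` with `F` independent of `v`. -/
structure IsGeodesicMetricOn (g : ℝ × ℝ → ℝ × ℝ →L[ℝ] ℝ × ℝ →L[ℝ] ℝ) (W : Set (ℝ × ℝ)) : Prop
    extends IsMetricOn g W where
  unit : ∀ p ∈ W, g p (0, 1) (0, 1) = 1
  fderiv_mixed : ∀ p ∈ W, fderiv ℝ (fun q => g q (1, 0) (0, 1)) p (0, 1) = 0

namespace IsGeodesicMetricOn

/-- The determinant is the squared length of `∂_u - F ∂_v`, the part of `∂_u` orthogonal to the unit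
vector `∂_v`. -/
lemma det_pos (hg : IsGeodesicMetricOn g W) {p : ℝ × ℝ} (hp : p ∈ W) :
    0 < g p (1, 0) (1, 0) * g p (0, 1) (0, 1) - g p (1, 0) (0, 1) ^ 2 := by
  have h := hg.pos p hp ((1, 0) - g p (1, 0) (0, 1) • (0, 1)) (by simp)
  rw [map_sub, map_sub, sub_apply, sub_apply, map_smul, map_smul, map_smul, smul_apply,
    smul_apply, hg.unit p hp, hg.symm p hp (0, 1) (1, 0)] at h
  simp only [smul_eq_mul] at h
  rw [hg.unit p hp]
  linarith

lemma fderiv_unit (hg : IsGeodesicMetricOn g W) {p : ℝ × ℝ} (hp : p ∈ W) (a : ℝ × ℝ) :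
    fderiv ℝ g p a (0, 1) (0, 1) = 0 := by
  rw [← hg.fderiv_apply_apply hp]
  have h : (fun q => g q (0, 1) (0, 1)) =ᶠ[𝓝 p] fun _ => (1 : ℝ) :=
    eventually_of_mem (hg.isOpen.mem_nhds hp) hg.unit
  rw [h.fderiv_eq, fderiv_fun_const, Pi.zero_apply, zero_apply]

/-- `⟨∇_v ∂_v, ∂_u⟩ = F_v - G_u / 2` and `⟨∇_v ∂_v, ∂_v⟩ = G_v / 2`, where `G = 1` and `F_v = 0`. -/
lemma christoffelB_snd_snd (hg : IsGeodesicMetricOn g W) {p : ℝ × ℝ} (hp : p ∈ W) :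
    christoffelB g p (0, 1) (0, 1) = 0 := by
  have h := hg.fderiv_mixed p hp
  rw [hg.fderiv_apply_apply hp] at h
  refine hg.ext_plane hp ?_ ?_ <;>
  rw [hg.apply_christoffelB hp, koszulForm_apply, hg.fderiv_unit hp, map_zero, zero_apply]
  · rw [hg.fderiv_symm hp _ (0, 1) (1, 0), h]
    norm_num
  · norm_num

lemma apply_christoffelB_fst_snd (hg : IsGeodesicMetricOn g W) {p : ℝ × ℝ} (hp : p ∈ W) :
    g p (christoffelB g p (1, 0) (0, 1)) (0, 1) = 0 := by
  rw [hg.apply_christoffelB hp, koszulForm_apply, hg.fderiv_unit hp]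
  ring

lemma apply_christoffelB_fst_fst (hg : IsGeodesicMetricOn g W) {p : ℝ × ℝ} (hp : p ∈ W) :
    g p (christoffelB g p (1, 0) (0, 1)) (1, 0) =
      1 / 2 * fderiv ℝ (fun q => g q (1, 0) (1, 0)) p (0, 1) := by
  rw [hg.apply_christoffelB hp, koszulForm_apply, hg.fderiv_symm hp (1, 0) (0, 1),
    hg.fderiv_apply_apply hp]
  ring

lemma contDiffAt_christoffelB_fst_snd (hg : IsGeodesicMetricOn g W) {p : ℝ × ℝ} (hp : p ∈ W) :
    ContDiffAt ℝ ∞ (fun q => christoffelB g q (1, 0) (0, 1)) p :=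
  ((hg.contDiffAt_christoffelB hp).clm_apply contDiffAt_const).clm_apply contDiffAt_const

/-- The commutator formula for the identity map and the constant field `∂_v`: as `∇_v ∂_v = 0`, only
`-∇_v ∇_u ∂_v` remains. -/
lemma riemannCurvature_eq (hg : IsGeodesicMetricOn g W) {p : ℝ × ℝ} (hp : p ∈ W) :
    riemannCurvature g p (1, 0) (0, 1) (0, 1) =
      -covD g id (fun q => christoffelB g q (1, 0) (0, 1)) p (0, 1) := by
  have h := covD_commutator hg.toIsMetricOn (φ := id) (ξ := fun _ : ℝ × ℝ => ((0, 1) : ℝ × ℝ))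
    (p := p) hp contDiffAt_id contDiffAt_const (1, 0) (0, 1)
  have h1 (q b : ℝ × ℝ) : covD g id (fun _ : ℝ × ℝ => ((0, 1) : ℝ × ℝ)) q b =
      christoffelB g q b (0, 1) := by
    simp [covD]
  simp only [h1, fderiv_id, id_eq, ContinuousLinearMap.id_apply] at h
  have h2 : (fun q => christoffelB g q (0, 1) (0, 1)) =ᶠ[𝓝 p] fun _ => 0 :=
    eventually_of_mem (hg.isOpen.mem_nhds hp) fun _ hq => hg.christoffelB_snd_snd hq
  rw [← h, covD_congr (EventuallyEq.refl _ _) h2]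
  simp [covD]

lemma apply_covD_snd (hg : IsGeodesicMetricOn g W) {p : ℝ × ℝ} (hp : p ∈ W) :
    g p (covD g id (fun q => christoffelB g q (1, 0) (0, 1)) p (0, 1)) (0, 1) = 0 := by
  have h := (hasFDerivAt_metric hg.toIsMetricOn (φ := id) (p := p)
    (ξ := fun q => christoffelB g q (1, 0) (0, 1)) (η := fun _ => (0, 1)) hp differentiableAt_id
    ((hg.contDiffAt_christoffelB_fst_snd hp).differentiableAt (by simp))
    (differentiableAt_const _)).2 (0, 1)
  have h1 : (fun q => g (id q) (christoffelB g q (1, 0) (0, 1)) (0, 1)) =ᶠ[𝓝 p] fun _ => (0 : ℝ) :=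
    eventually_of_mem (hg.isOpen.mem_nhds hp) fun _ hq => hg.apply_christoffelB_fst_snd hq
  have h2 : covD g id (fun _ : ℝ × ℝ => ((0, 1) : ℝ × ℝ)) p (0, 1) = 0 := by
    simp [covD, hg.christoffelB_snd_snd hp]
  rw [h1.fderiv_eq, h2, map_zero, add_zero, fderiv_fun_const] at h
  exact h.symm

/-- The curvature sees only the `∂_u` component of `∇_v ∇_u ∂_v`, but the `∂_v` component vanishes
anyway by `apply_covD_snd`. -/
lemma gaussCurvature_eq_zero_iff (hg : IsGeodesicMetricOn g W) {p : ℝ × ℝ} (hp : p ∈ W) :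
    gaussCurvature g p = 0 ↔ covD g id (fun q => christoffelB g q (1, 0) (0, 1)) p (0, 1) = 0 := by
  rw [gaussCurvature, div_eq_zero_iff, or_iff_left (hg.det_pos hp).ne', hg.riemannCurvature_eq hp,
    map_neg, neg_apply, neg_eq_zero]
  refine ⟨fun h => hg.ext_plane hp ?_ ?_, fun h => ?_⟩
  · rw [h, map_zero, zero_apply]
  · rw [hg.apply_covD_snd hp, map_zero, zero_apply]
  · rw [h, map_zero, zero_apply]

lemma christoffelB_fst_snd_eq_zero_iff (hg : IsGeodesicMetricOn g W) {p : ℝ × ℝ} (hp : p ∈ W) :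
    christoffelB g p (1, 0) (0, 1) = 0 ↔
      fderiv ℝ (fun q => g q (1, 0) (1, 0)) p (0, 1) = 0 := by
  have h1 := hg.apply_christoffelB_fst_fst hp
  refine ⟨fun h => ?_, fun h => hg.ext_plane hp ?_ ?_⟩
  · rw [h, map_zero, zero_apply] at h1
    linarith
  · rw [h1, h, mul_zero, map_zero, zero_apply]
  · rw [hg.apply_christoffelB_fst_snd hp, map_zero, zero_apply]

/-- On a plane with a metric `E du² + 2 F du dv + dv²`, where `F` does not depend on `v` and
`∂E/∂v` vanishes for `v = 0`, the Gaussian curvature vanishes if and only if `E` does not depend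
on `v`. -/
lemma gaussCurvature_eq_zero (hg : IsGeodesicMetricOn g W)
    (hconn : ∀ p ∈ W, {v : ℝ | (p.1, v) ∈ W}.OrdConnected) (h0 : ∀ p ∈ W, (p.1, (0 : ℝ)) ∈ W)
    (hE : ∀ p ∈ W, fderiv ℝ (fun q => g q (1, 0) (1, 0)) (p.1, 0) (0, 1) = 0) :
    (∀ p ∈ W, gaussCurvature g p = 0) ↔
      ∀ p ∈ W, fderiv ℝ (fun q => g q (1, 0) (1, 0)) p (0, 1) = 0 := by
  constructor
  · intro hK p hp
    have hJ : IsOpen {v : ℝ | (p.1, v) ∈ W} :=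
      hg.isOpen.preimage (by fun_prop : Continuous fun v : ℝ => (p.1, v))
    -- `w = ∇_u ∂_v`. Zero curvature makes it parallel along the `v`-lines, so its length is
    -- constant there; at `v = 0` it vanishes by `hE`.
    set w : ℝ × ℝ → ℝ × ℝ := fun q => christoffelB g q (1, 0) (0, 1) with hw
    have hd : ∀ v ∈ {v : ℝ | (p.1, v) ∈ W},
        HasDerivAt (fun v => g (p.1, v) (w (p.1, v)) (w (p.1, v))) 0 v := fun v hv => by
      have hwd := (hg.contDiffAt_christoffelB_fst_snd hv).differentiableAt (by simp)
      obtain ⟨h1, h2⟩ := hasFDerivAt_metric hg.toIsMetricOn (φ := id) (p := (p.1, v))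
        (ξ := w) (η := w) hv differentiableAt_id hwd hwd
      have h3 := h2 (0, 1)
      rw [(hg.gaussCurvature_eq_zero_iff hv).1 (hK _ hv), map_zero, map_zero, zero_apply,
        add_zero] at h3
      have h4 := h1.hasFDerivAt.comp_hasDerivAt v
        ((hasDerivAt_const v p.1).prodMk (hasDerivAt_id v))
      rw [h3] at h4
      exact h4
    have h5 := hJ.is_const_of_deriv_eq_zero (hconn p hp).isPreconnected
      (fun v hv => (hd v hv).differentiableAt.differentiableWithinAt) (fun v hv => (hd v hv).deriv)
      (x := p.2) (y := 0) hp (h0 p hp)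
    rw [← hg.christoffelB_fst_snd_eq_zero_iff hp]
    by_contra hne
    have h6 := hg.pos p hp _ hne
    have h7 : w (p.1, 0) = 0 := (hg.christoffelB_fst_snd_eq_zero_iff (h0 p hp)).2 (hE p hp)
    simp only [h7, map_zero] at h5
    exact h6.ne' h5
  · intro h p hp
    rw [hg.gaussCurvature_eq_zero_iff hp]
    have h2 : (fun q => christoffelB g q (1, 0) (0, 1)) =ᶠ[𝓝 p] fun _ => 0 :=
      eventually_of_mem (hg.isOpen.mem_nhds hp) fun q hq => (hg.christoffelB_fst_snd_eq_zero_iff hq).2 (h q hq)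
    rw [covD_congr (EventuallyEq.refl _ _) h2]
    simp [covD]

end IsGeodesicMetricOn

end PlaneMetrics

/-! ### Both curvatures of a cylinder in terms of `axisDeriv` -/

section CylinderCurvature

open Filter Topology

set_option maxSynthPendingDepth 3

variable {M : Type*} [TopologicalSpace M] [ChartedSpace E3 M] [IsManifold (𝓡 3) ∞ M]
  [RiemannianBundle (fun x : M => TangentSpace (𝓡 3) x)]
  [IsContMDiffRiemannianBundle (𝓡 3) ∞ E3 (fun x : M => TangentSpace (𝓡 3) x)]

namespace IntrinsicCylinder

variable {C : IntrinsicCylinder M}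

lemma fderiv_firstFundamentalForm {p : ℝ × ℝ} (hp : p ∈ C.W) :
    fderiv ℝ (fun q => firstFundamentalForm C.param q (1, 0) (1, 0)) p (0, 1) =
      2 * inner ℝ (C.axisDeriv p) (partialU C.param p) := by
  refine ((fderiv_inner (isSmoothFieldAt_partialU hp) (isSmoothFieldAt_partialU hp)).2
    (0, 1)).trans ?_
  rw [covDir_partialU_snd hp, real_inner_comm (C.axisDeriv p)]
  ring

variable [T2Space M]

lemma isGeodesicMetricOn : IsGeodesicMetricOn (firstFundamentalForm C.param) C.W where
  toIsMetricOn := isMetricOn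
  unit p hp := by
    rw [firstFundamentalForm_apply, real_inner_self_eq_norm_sq]
    exact (congrArg (· ^ 2) (norm_partialV hp)).trans (one_pow 2)
  fderiv_mixed p hp := by
    refine ((fderiv_inner (isSmoothFieldAt_partialU hp) (isSmoothFieldAt_partialV hp)).2
      (0, 1)).trans ?_
    rw [covDir_partialU_snd hp, covDir_partialV_snd hp, inner_zero_right, add_zero,
      inner_axisDeriv_partialV hp]

/-- Here `E_v = 2⟨∇_u ∂_v, ∂_u⟩`, which vanishes on the basis, so the criterion for plane metrics
applies. -/
lemma intrinsicallyFlat_iff :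
    C.IntrinsicallyFlat ↔ ∀ p ∈ C.W, inner ℝ (C.axisDeriv p) (partialU C.param p) = 0 := by
  have h0 : ∀ p ∈ C.W, (p.1, (0 : ℝ)) ∈ C.W := fun p hp => C.basis_mem _ (C.fst_mem p hp)
  refine (isGeodesicMetricOn.gaussCurvature_eq_zero
    (fun p hp => C.ordConnected_ruling _ (C.fst_mem p hp)) h0 fun p hp => ?_).trans
    (forall₂_congr fun p hp => ?_)
  · rw [fderiv_firstFundamentalForm (h0 p hp), axisDeriv_basis (C.fst_mem p hp), inner_zero_left,
      mul_zero]
  · rw [fderiv_firstFundamentalForm hp, mul_eq_zero, or_iff_right two_ne_zero]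

/-- The rulings are geodesics of `M`, so `h₂₂ = 0` and `det II = -h₁₂²` with `h₁₂ = ⟨axisDeriv, ν⟩`;
the denominator is nonzero. -/
lemma extrinsicCurvature_eq_zero_iff {u v : ℝ} (hp : (u, v) ∈ C.W)
    (ν : TangentSpace (𝓡 3) (C.param (u, v))) :
    extrinsicCurvature C.param u v ν = 0 ↔ inner ℝ (C.axisDeriv (u, v)) ν = 0 := by
  have h1 := covDeriv_comp_basis (isSmoothFieldAt_partialV hp)
  have h2 := (covDeriv_comp_ruling (isSmoothFieldAt_partialV hp)).trans (covDir_partialV_snd hp)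
  simp only at h1 h2
  rw [extrinsicCurvature, h1, h2]
  simp only [inner_zero_left, mul_zero, zero_sub]
  rw [div_eq_zero_iff, or_iff_left (isGeodesicMetricOn.det_pos hp).ne', neg_eq_zero,
    sq_eq_zero_iff]
  rfl

/-- With intrinsic flatness `axisDeriv` is orthogonal to both coordinate fields. Were it nonzero,
its normalization would itself be a unit normal, and extrinsic flatness would make it orthogonal to
itself. -/
lemma axisParallel_iff_flat :
    C.AxisParallel ↔ C.IntrinsicallyFlat ∧ C.ExtrinsicallyFlat := by
  rw [axisParallel_iff, intrinsicallyFlat_iff]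
  constructor
  · refine fun h => ⟨fun p hp => by rw [h p hp, inner_zero_left], fun u v hp ν _ => ?_⟩
    rw [extrinsicCurvature_eq_zero_iff hp, h _ hp, inner_zero_left]
  · rintro ⟨h1, h2⟩ p hp
    by_contra hne
    have h3 := h2 p.1 p.2 hp (‖C.axisDeriv p‖⁻¹ • C.axisDeriv p) ⟨norm_smul_inv_norm hne, by
      rw [inner_smul_right, real_inner_comm, h1 p hp, mul_zero], by
      rw [inner_smul_right, real_inner_comm, inner_axisDeriv_partialV hp, mul_zero]⟩
    rw [extrinsicCurvature_eq_zero_iff hp, inner_smul_right, mul_eq_zero, inner_self_eq_zero,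
      inv_eq_zero, norm_eq_zero, or_self] at h3
    exact hne h3

end IntrinsicCylinder

end CylinderCurvature

/-! ### The geodesics of a cylinder -/

section CylinderGeodesics

open Filter Topology

set_option maxSynthPendingDepth 3

/-- An integral curve of the spray. The interval is shrunk until the velocity has no zero, since
`GeodesicsAreHelices` speaks only of regular geodesics. -/
lemma IsMetricOn.exists_geodesic {E : Type} [NormedAddCommGroup E] [NormedSpace ℝ E]
    [FiniteDimensional ℝ E] {g : E → E →L[ℝ] E →L[ℝ] ℝ} {U : Set E} (hg : IsMetricOn g U)
    {y w : E} (hy : y ∈ U) (hw : w ≠ 0) :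
    ∃ ε > 0, ∃ c : ℝ → E, ContDiffOn ℝ ∞ c (Ioo (-ε) ε) ∧ c 0 = y ∧ deriv c 0 = w ∧
      ∀ t ∈ Ioo (-ε) ε, c t ∈ U ∧ deriv c t ≠ 0 ∧
        deriv (deriv c) t + christoffel g (c t) (deriv c t) (deriv c t) = 0 := by
  obtain ⟨δ, hδ, φ, hφ, h⟩ := exists_smooth_flow (hg.isOpen.prod isOpen_univ)
    (contDiffOn_spray hg) (x₀ := (y, w)) ⟨hy, mem_univ _⟩
  obtain ⟨h0, h⟩ := h (y, w) (Metric.mem_ball_self hδ)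
  set c : ℝ → E := fun t => (φ ((y, w), t)).1 with hc
  have hs : ContDiffOn ℝ ∞ c (Ioo (-δ) δ) := (contDiff_fst.comp_contDiffOn hφ).comp
    (contDiff_prodMk_right (y, w)).contDiffOn fun t ht => ⟨Metric.mem_ball_self hδ, ht⟩
  have hd : ∀ t ∈ Ioo (-δ) δ, deriv c t = (φ ((y, w), t)).2 := fun t ht =>
    HasDerivAt.deriv (f' := (φ ((y, w), t)).2) (h t ht).2.fst
  have hδ0 : (0 : ℝ) ∈ Ioo (-δ) δ := ⟨by linarith, hδ⟩
  have hcont : ContinuousAt (deriv c) 0 :=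
    ((contDiffOn_infty_iff_deriv_of_isOpen isOpen_Ioo).1 hs).2.continuousOn.continuousAt
      (isOpen_Ioo.mem_nhds hδ0)
  have hw0 : deriv c 0 = w := by rw [hd 0 hδ0, h0]
  have hne : ∀ᶠ t in 𝓝 (0 : ℝ), deriv c t ≠ 0 ∧ t ∈ Ioo (-δ) δ :=
    (hcont.eventually_ne (by rwa [hw0])).and (isOpen_Ioo.mem_nhds hδ0)
  obtain ⟨ε, hε, hεs⟩ := Metric.eventually_nhds_iff_ball.1 hne
  rw [Real.ball_eq_Ioo, zero_sub, zero_add] at hεs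
  refine ⟨ε, hε, c, hs.mono fun t ht => (hεs t ht).2, by rw [hc]; simp only [h0], hw0,
    fun t ht => ?_⟩
  obtain ⟨ht1, ht2⟩ := hεs t ht
  obtain ⟨hm, hD⟩ := h t ht2
  refine ⟨hm.1, ht1, ?_⟩
  have hdd : deriv c =ᶠ[𝓝 t] fun s => (φ ((y, w), s)).2 :=
    eventually_of_mem (isOpen_Ioo.mem_nhds ht2) hd
  have h2 : HasDerivAt (fun s => (φ ((y, w), s)).2) (-christoffelB g (c t) (φ ((y, w), t)).2
    (φ ((y, w), t)).2) t := hD.snd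
  rw [christoffel_eq (hg.differentiableAt hm.1), hdd.deriv_eq, h2.deriv, hd t ht2, neg_add_cancel]

/-- The inner product of parallel fields along a curve is constant. -/
lemma IsMetricOn.apply_eq_of_covD_eq_zero {E : Type*} [NormedAddCommGroup E] [NormedSpace ℝ E]
    [FiniteDimensional ℝ E] {g : E → E →L[ℝ] E →L[ℝ] ℝ} {U : Set E} (hg : IsMetricOn g U)
    {c ξ η : ℝ → E} {J : Set ℝ} (hJ : IsOpen J) (hJc : J.OrdConnected) (hm : MapsTo c J U)
    (hc : DifferentiableOn ℝ c J) (hξ : DifferentiableOn ℝ ξ J) (hη : DifferentiableOn ℝ η J)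
    (hξ0 : ∀ t ∈ J, covD g c ξ t 1 = 0) (hη0 : ∀ t ∈ J, covD g c η t 1 = 0) {s t : ℝ}
    (hs : s ∈ J) (ht : t ∈ J) : g (c s) (ξ s) (η s) = g (c t) (ξ t) (η t) := by
  have hd : ∀ t ∈ J, HasDerivAt (fun s => g (c s) (ξ s) (η s)) 0 t := fun t ht => by
    have hn := hJ.mem_nhds ht
    obtain ⟨h1, h2⟩ := hasFDerivAt_metric hg (hm ht) (hc.differentiableAt hn)
      (hξ.differentiableAt hn) (hη.differentiableAt hn)
    have h3 := h2 1
    rw [hξ0 t ht, hη0 t ht, map_zero, map_zero, zero_apply, add_zero] at h3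
    rw [← h3]
    exact h1.hasDerivAt
  exact hJ.is_const_of_deriv_eq_zero hJc.isPreconnected
    (fun t ht => (hd t ht).differentiableAt.differentiableWithinAt) (fun t ht => (hd t ht).deriv)
    hs ht

variable {M : Type*} [TopologicalSpace M] [T2Space M] [ChartedSpace E3 M] [IsManifold (𝓡 3) ∞ M]
  [RiemannianBundle (fun x : M => TangentSpace (𝓡 3) x)]
  [IsContMDiffRiemannianBundle (𝓡 3) ∞ E3 (fun x : M => TangentSpace (𝓡 3) x)]

namespace IntrinsicCylinder

variable {C : IntrinsicCylinder M}

/-- A surface geodesic leaving `p` in the direction `∂_u` has `u' = 1` at time `0`, so parallelism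
of the axis along it says `axisDeriv p = 0`. -/
lemma GeodesicsAreHelices.axisParallel (h : C.GeodesicsAreHelices) : C.AxisParallel := by
  refine axisParallel_iff.2 fun p hp => ?_
  obtain ⟨ε, hε, c, hc, hc0, hd0, hg⟩ := (isMetricOn (C := C)).exists_geodesic (w := (1, 0)) hp
    (by simp)
  have h0 : (0 : ℝ) ∈ Ioo (-ε) ε := ⟨by linarith, hε⟩
  have h1 := (h _ c isOpen_Ioo ordConnected_Ioo (fun t ht => (hg t ht).1)
    ⟨hc, fun t ht => (hg t ht).2.2⟩ (fun t ht => (hg t ht).2.1)).2.2.1.2 0 h0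
  rw [covDeriv_axis (hc.contDiffAt (isOpen_Ioo.mem_nhds h0)) (hg 0 h0).1, hd0, one_smul] at h1
  rwa [hc0] at h1

/-- If `axisDeriv` vanishes, then so does `E_v`, and `∂_v` is parallel for the induced connection.
So is the velocity of a surface geodesic, hence the inner product and the norms that define the
angle are constant. -/
lemma AxisParallel.geodesicsAreHelices (h : C.AxisParallel) : C.GeodesicsAreHelices := by
  intro J c hJ hJc hm hgeo hne
  have hg := isGeodesicMetricOn (C := C)
  set g := firstFundamentalForm C.param with hgdef
  have hcd : DifferentiableOn ℝ c J := hgeo.1.differentiableOn (by simp)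
  have hcd' : DifferentiableOn ℝ (deriv c) J :=
    ((contDiffOn_infty_iff_deriv_of_isOpen hJ).1 hgeo.1).2.differentiableOn (by simp)
  have hvel : ∀ t ∈ J, velocity (fun t => C.param (c t)) t =
      mfderiv 𝓘(ℝ, ℝ × ℝ) (𝓡 3) C.param (c t) (deriv c t) := fun t ht =>
    velocity_comp ((C.contMDiffAt_param (hm ht)).mdifferentiableAt (by simp))
      (hcd.differentiableAt (hJ.mem_nhds ht)).hasDerivAt
  have hΓ : ∀ p ∈ C.W, ∀ w, christoffelB g p w (0, 1) = 0 := fun p hp w => by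
    have h1 : christoffelB g p (1, 0) (0, 1) = 0 := by
      rw [hg.christoffelB_fst_snd_eq_zero_iff hp, fderiv_firstFundamentalForm hp,
        axisParallel_iff.1 h p hp, inner_zero_left, mul_zero]
    have hw : w = w.1 • ((1, 0) : ℝ × ℝ) + w.2 • ((0, 1) : ℝ × ℝ) := by simp
    rw [hw, map_add, map_smul, map_smul, add_apply, smul_apply, smul_apply, h1,
      hg.christoffelB_snd_snd hp, smul_zero, smul_zero, add_zero]
  have hξ : ∀ t ∈ J, covD g c (deriv c) t 1 = 0 := fun t ht => by
    have := hgeo.2 t ht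
    rwa [christoffel_eq (hg.differentiableAt (hm ht))] at this
  have hη : ∀ t ∈ J, covD g c (fun _ => (0, 1)) t 1 = 0 := fun t ht => by
    rw [covD, hΓ _ (hm ht)]
    simp
  have haxis : ∀ t ∈ J, ‖C.axis (c t)‖ = 1 := fun t ht => by
    rw [C.axis_eq (hm ht), norm_partialV (hm ht)]
  refine ⟨fun t ht => ((C.contMDiffAt_param (hm ht)).comp t
    (hgeo.1.contDiffAt (hJ.mem_nhds ht)).contMDiffAt).contMDiffWithinAt, fun t ht h0 => ?_,
    h J c hJ hJc hgeo.1 hm, haxis, ?_⟩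
  · rw [hvel t ht] at h0
    exact hne t ht (C.immersion _ (hm ht) (h0.trans (map_zero _).symm))
  · rcases J.eq_empty_or_nonempty with rfl | ⟨t₀, ht₀⟩
    · exact ⟨0, fun t ht => ht.elim⟩
    refine ⟨InnerProductGeometry.angle (velocity (fun t => C.param (c t)) t₀) (C.axis (c t₀)),
      fun t ht => ?_⟩
    have hin : ∀ t ∈ J, inner ℝ (velocity (fun t => C.param (c t)) t) (C.axis (c t)) =
        g (c t) (deriv c t) (0, 1) := fun t ht => by
      rw [hvel t ht, C.axis_eq (hm ht)]
      rfl
    have hnorm : ∀ t ∈ J, ‖velocity (fun t => C.param (c t)) t‖ =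
        √(g (c t) (deriv c t) (deriv c t)) := fun t ht => by
      rw [norm_eq_sqrt_real_inner, hvel t ht]
      rfl
    rw [InnerProductGeometry.angle, InnerProductGeometry.angle, hin t ht, hin t₀ ht₀, haxis t ht,
      haxis t₀ ht₀, hnorm t ht, hnorm t₀ ht₀,
      hg.toIsMetricOn.apply_eq_of_covD_eq_zero hJ hJc hm hcd hcd' hcd' hξ hξ ht ht₀,
      hg.toIsMetricOn.apply_eq_of_covD_eq_zero hJ hJc hm hcd hcd'
        (differentiableOn_const (c := ((0, 1) : ℝ × ℝ))) hξ hη ht ht₀]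

lemma geodesicsAreHelices_iff : C.GeodesicsAreHelices ↔ C.AxisParallel :=
  ⟨GeodesicsAreHelices.axisParallel, AxisParallel.geodesicsAreHelices⟩

end IntrinsicCylinder

end CylinderGeodesics

/-! ### Algebra of the curvature tensor, and cylinders in flat manifolds -/

section CurvatureAlgebra

open Filter Topology

set_option maxSynthPendingDepth 3

namespace IsMetricOn

variable {E : Type*} [NormedAddCommGroup E] [NormedSpace ℝ E] [FiniteDimensional ℝ E]
  {g : E → E →L[ℝ] E →L[ℝ] ℝ} {U : Set E} {y : E}

lemma riemannCurvature_eq (hg : IsMetricOn g U) (hy : y ∈ U) (a b c : E) :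
    riemannCurvature g y a b c =
      fderiv ℝ (christoffelB g) y a b c - fderiv ℝ (christoffelB g) y b a c
        + christoffelB g y a (christoffelB g y b c) - christoffelB g y b (christoffelB g y a c) := by
  have h (b : E) : (fun z => christoffel g z b c) =ᶠ[𝓝 y] fun z => christoffelB g z b c :=
    eventually_of_mem (hg.isOpen.mem_nhds hy) fun z hz => christoffel_eq (hg.differentiableAt hz) b c
  have hd : DifferentiableAt ℝ (christoffelB g) y :=
    (hg.contDiffAt_christoffelB hy).differentiableAt (by simp)
  have h' (a b : E) : fderiv ℝ (fun z => christoffelB g z b c) y a =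
      fderiv ℝ (christoffelB g) y a b c := by
    have h3 : DifferentiableAt ℝ (fun z => christoffelB g z b) y :=
      hd.clm_apply (differentiableAt_const b)
    rw [fderiv_clm_apply h3 (differentiableAt_const c),
      fderiv_clm_apply hd (differentiableAt_const b)]
    simp
  rw [riemannCurvature, (h b).fderiv_eq, (h a).fderiv_eq, h', h']
  simp only [christoffel_eq (hg.differentiableAt hy)]

lemma fderiv_christoffelB_symm (hg : IsMetricOn g U) (hy : y ∈ U) (a b c : E) :
    fderiv ℝ (christoffelB g) y a b c = fderiv ℝ (christoffelB g) y a c b := by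
  have hd : DifferentiableAt ℝ (christoffelB g) y :=
    (hg.contDiffAt_christoffelB hy).differentiableAt (by simp)
  have h' (b c : E) : fderiv ℝ (fun z => christoffelB g z b c) y a =
      fderiv ℝ (christoffelB g) y a b c := by
    have h3 : DifferentiableAt ℝ (fun z => christoffelB g z b) y :=
      hd.clm_apply (differentiableAt_const b)
    rw [fderiv_clm_apply h3 (differentiableAt_const c),
      fderiv_clm_apply hd (differentiableAt_const b)]
    simp
  rw [← h', ← h']
  have : (fun z => christoffelB g z b c) =ᶠ[𝓝 y] fun z => christoffelB g z c b :=
    eventually_of_mem (hg.isOpen.mem_nhds hy) fun z hz => hg.christoffelB_symm hz b c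
  rw [this.fderiv_eq]

/-- The curvature tensor is determined by the values `R(a, b) b`, for `b` a unit vector that is
not collinear with `a`. -/
lemma riemannCurvature_eq_zero (hg : IsMetricOn g U) (hy : y ∈ U)
    (h : ∀ a b, g y b b = 1 → (Function.Injective fun p : ℝ × ℝ => p.1 • a + p.2 • b) →
      riemannCurvature g y a b b = 0) (a b c : E) : riemannCurvature g y a b c = 0 := by
  -- Both restrictions on `b` are removed: the collinear case vanishes by antisymmetry, and the
  -- length of `b` enters as a quadratic factor.
  have h1 : ∀ a b, riemannCurvature g y a b b = 0 := fun a b => by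
    rcases eq_or_ne b 0 with rfl | hb
    · simp [hg.riemannCurvature_eq hy]
    by_cases hab : ∃ s : ℝ, a = s • b
    · obtain ⟨s, rfl⟩ := hab
      simp [hg.riemannCurvature_eq hy]
    have hpos := hg.pos y hy b hb
    set r := √(g y b b) with hr
    have hr0 : 0 < r := Real.sqrt_pos.2 hpos
    have hunit : g y (r⁻¹ • b) (r⁻¹ • b) = 1 := by
      have hrr : r * r = g y b b := Real.mul_self_sqrt hpos.le
      simp only [map_smul, smul_apply, smul_eq_mul, ← hrr]
      field_simp
    have h2 := h a (r⁻¹ • b) hunit (by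
      rintro ⟨s, t⟩ ⟨s', t'⟩ hst
      simp only [smul_smul] at hst
      have hs : s = s' := by
        by_contra hne
        have hne' : s - s' ≠ 0 := sub_ne_zero.2 hne
        refine hab ⟨(s - s')⁻¹ * ((t' - t) * r⁻¹), ?_⟩
        have h3 : (s - s') • a = ((t' - t) * r⁻¹) • b := by
          rw [sub_smul, sub_mul, sub_smul, sub_eq_sub_iff_add_eq_add, hst, add_comm]
        rw [mul_smul, ← h3, smul_smul, inv_mul_cancel₀ hne', one_smul]
      subst hs
      have h4 := smul_left_injective ℝ hb (add_left_cancel hst)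
      rw [mul_right_cancel₀ (inv_ne_zero hr0.ne') h4])
    have h3 : riemannCurvature g y a (r⁻¹ • b) (r⁻¹ • b) =
        (r⁻¹ * r⁻¹) • riemannCurvature g y a b b := by
      simp only [hg.riemannCurvature_eq hy, map_smul, smul_apply, smul_smul, smul_sub, smul_add]
    rw [h3, smul_eq_zero, or_iff_right (mul_ne_zero (inv_ne_zero hr0.ne') (inv_ne_zero hr0.ne'))]
      at h2
    exact h2
  -- Polarization of `R(a, b)b = 0` in `b`.
  have h2 : ∀ a b c, riemannCurvature g y a b c = -riemannCurvature g y a c b := fun a b c => by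
    have e : riemannCurvature g y a (b + c) (b + c) = riemannCurvature g y a b b +
        riemannCurvature g y a c c + (riemannCurvature g y a b c + riemannCurvature g y a c b) := by
      simp only [hg.riemannCurvature_eq hy, map_add, add_apply]
      abel
    rw [h1, h1, h1, zero_add, zero_add] at e
    exact eq_neg_of_add_eq_zero_left e.symm
  have h3 : ∀ a b c, riemannCurvature g y a b c = -riemannCurvature g y b a c := fun a b c => by
    simp only [hg.riemannCurvature_eq hy]
    abel
  -- The first Bianchi identity. By the two antisymmetries its three terms are equal, so it reads `3
  -- R(a, b)c = 0`.
  have h4 : riemannCurvature g y a b c + riemannCurvature g y b c a + riemannCurvature g y c a b =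
      0 := by
    simp only [hg.riemannCurvature_eq hy]
    rw [hg.fderiv_christoffelB_symm hy a c b, hg.fderiv_christoffelB_symm hy b a c,
      hg.fderiv_christoffelB_symm hy c b a, hg.christoffelB_symm hy c b,
      hg.christoffelB_symm hy a c, hg.christoffelB_symm hy b a]
    abel
  rw [h2 b c a, h3 b a c, neg_neg, h3 c a b, ← h2 a b c] at h4
  have h5 : (3 : ℝ) • riemannCurvature g y a b c = 0 := by
    rw [← h4]
    module
  exact (smul_eq_zero.1 h5).resolve_left (by norm_num)

end IsMetricOn

end CurvatureAlgebra

/-! ### The derivative of `axisDeriv` along the rulings -/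

section FlatManifolds

open Filter Topology

set_option maxSynthPendingDepth 3

variable {M : Type*} [TopologicalSpace M] [ChartedSpace E3 M] [IsManifold (𝓡 3) ∞ M]
  [RiemannianBundle (fun x : M => TangentSpace (𝓡 3) x)]

lemma covDir_eq_zero {P : Type*} [NormedAddCommGroup P] [NormedSpace ℝ P] {f : P → M}
    {X : ∀ p, TangentSpace (𝓡 3) (f p)} {p : P} (h : ∀ᶠ q in 𝓝 p, X q = 0) (w : P) :
    covDir f X p w = 0 := by
  have h1 : (fun q => coordVec (f p) (f q) (X q)) =ᶠ[𝓝 p] fun _ => 0 := by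
    filter_upwards [h] with q hq
    rw [hq, map_zero]
  rw [covDir, covD_congr (EventuallyEq.refl _ _) h1]
  simp [covD]

variable [IsContMDiffRiemannianBundle (𝓡 3) ∞ E3 (fun x : M => TangentSpace (𝓡 3) x)]

variable [T2Space M]

namespace IntrinsicCylinder

variable {C : IntrinsicCylinder M}

/-- The commutator formula for `∂_v`, in which `∇_u ∇_v ∂_v` vanishes. This equation links cylinders
to the curvature of `M`. -/
lemma coordVec_covDir_axisDeriv {x₀ : M} {p : ℝ × ℝ} (hp : p ∈ C.W)
    (hx : C.param p ∈ coordSource x₀) :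
    coordVec x₀ (C.param p) (covDir C.param C.axisDeriv p (0, 1)) =
      riemannCurvature (chartMetric x₀) (coord x₀ (C.param p))
        (fderiv ℝ (coord x₀ ∘ C.param) p (0, 1)) (fderiv ℝ (coord x₀ ∘ C.param) p (1, 0))
        (coordVec x₀ (C.param p) (partialV C.param p)) := by
  have hW := C.isOpen_W.mem_nhds hp
  rw [← covDir_commutator (eventually_of_mem hW fun _ hq => isSmoothFieldAt_partialV hq) hx,
    covDir_eq_zero (X := fun q => covDir C.param (partialV C.param) q (0, 1))
      (eventually_of_mem hW fun _ hq => covDir_partialV_snd hq), sub_zero]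
  rfl

/-- Without curvature `axisDeriv` is parallel along each ruling, so its norm keeps the value zero
that it has on the basis. -/
lemma axisParallel_of_isFlat (h : IsFlat M) : C.AxisParallel := by
  refine axisParallel_iff.2 fun p hp => ?_
  have hu := C.fst_mem p hp
  have hpar : IsParallelOn (fun v => C.param (p.1, v)) (fun v => C.axisDeriv (p.1, v))
      (C.ruling p.1) := by
    refine (isParallelOn_iff (C.isOpen_ruling p.1)).2 fun v hv => ?_
    have hs := isSmoothFieldAt_axisDeriv (C := C) (p := (p.1, v)) hv
    refine ⟨IsSmoothFieldAt.comp (c := fun v => (p.1, v)) hs (by fun_prop),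
      (covDeriv_comp_ruling hs).trans ?_⟩
    have hx := mem_coordSource (C.param (p.1, v))
    refine coordVec_injective hx ?_
    rw [coordVec_covDir_axisDeriv hv hx, h _ _ (coord_mem hx), map_zero]
  have h1 := hpar.norm_eq (C.isOpen_ruling p.1) (C.ordConnected_ruling p.1 hu) hp
    (C.basis_mem p.1 hu)
  rw [axisDeriv_basis hu, norm_zero, norm_eq_zero] at h1
  exact h1

end IntrinsicCylinder

end FlatManifolds

/-! ### Construction of cylinders -/

section CylinderConstruction

open Filter Topology

set_option maxSynthPendingDepth 3

/-- Parallel transport of `b` along the segment `u ↦ y₀ + u a`, followed by the geodesic flow. -/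
lemma IsMetricOn.exists_ruled_surface {E : Type} [NormedAddCommGroup E] [NormedSpace ℝ E]
    [FiniteDimensional ℝ E] {g : E → E →L[ℝ] E →L[ℝ] ℝ} {U : Set E} (hg : IsMetricOn g U)
    {y₀ a b : E} (hy₀ : y₀ ∈ U)
    (hab : Function.Injective fun p : ℝ × ℝ => p.1 • a + p.2 • b) :
    ∃ ε > 0, ∃ Y Z : ℝ × ℝ → E,
      ContDiffOn ℝ ∞ Y (Ioo (-ε) ε ×ˢ Ioo (-ε) ε) ∧ ContDiffOn ℝ ∞ Z (Ioo (-ε) ε ×ˢ Ioo (-ε) ε) ∧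
      Y 0 = y₀ ∧ Z 0 = b ∧
      (∀ u ∈ Ioo (-ε) ε, HasDerivAt (fun u => Y (u, 0)) a u ∧
        covD g (fun u => Y (u, 0)) (fun u => Z (u, 0)) u 1 = 0) ∧
      ∀ u ∈ Ioo (-ε) ε, ∀ v ∈ Ioo (-ε) ε, Y (u, v) ∈ U ∧
        HasDerivAt (fun v => (Y (u, v), Z (u, v))) (spray g (Y (u, v), Z (u, v))) v ∧
        Function.Injective (fderiv ℝ Y (u, v)) := by
  -- An integral curve of this field is the segment with velocity `a` together with a vector
  -- parallel along it.
  have hF : ContDiffOn ℝ ∞ (fun q : E × E => (a, -christoffelB g q.1 a q.2)) (U ×ˢ univ) := by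
    have h1 : ContDiffOn ℝ ∞ (fun q : E × E => christoffelB g q.1) (U ×ˢ univ) :=
      hg.contDiffOn_christoffelB.comp contDiff_fst.contDiffOn fun q hq => hq.1
    exact contDiffOn_const.prodMk
      ((h1.clm_apply contDiffOn_const).clm_apply contDiff_snd.contDiffOn).neg
  obtain ⟨δ, hδ, φ, hφ, h⟩ := exists_smooth_flow (hg.isOpen.prod isOpen_univ) hF
    (x₀ := (y₀, b)) ⟨hy₀, mem_univ _⟩
  obtain ⟨δ', hδ', φ', hφ', h'⟩ := exists_smooth_flow (hg.isOpen.prod isOpen_univ)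
    (contDiffOn_spray hg) (x₀ := (y₀, b)) ⟨hy₀, mem_univ _⟩
  obtain ⟨h0, h⟩ := h (y₀, b) (Metric.mem_ball_self hδ)
  set c : ℝ → E × E := fun t => φ ((y₀, b), t) with hc
  have hcs : ContDiffOn ℝ ∞ c (Ioo (-δ) δ) :=
    hφ.comp (contDiff_prodMk_right (y₀, b)).contDiffOn fun t ht => ⟨Metric.mem_ball_self hδ, ht⟩
  have hδ0 : (0 : ℝ) ∈ Ioo (-δ) δ := ⟨by linarith, hδ⟩
  have hδ0' : (0 : ℝ) ∈ Ioo (-δ') δ' := ⟨by linarith, hδ'⟩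
  have hc0 : c 0 = (y₀, b) := h0
  -- Restricts the basis to parameters whose transported vectors lie in the domain of the geodesic
  -- flow `φ'`.
  have hA : IsOpen (Ioo (-δ) δ ∩ c ⁻¹' Metric.ball (y₀, b) δ') :=
    hcs.continuousOn.isOpen_inter_preimage isOpen_Ioo Metric.isOpen_ball
  set A := Ioo (-δ) δ ∩ c ⁻¹' Metric.ball (y₀, b) δ' with hAdef
  have hA0 : (0 : ℝ) ∈ A := ⟨hδ0, by rw [mem_preimage, hc0]; exact Metric.mem_ball_self hδ'⟩
  have hB : IsOpen (A ×ˢ Ioo (-δ') δ') := hA.prod isOpen_Ioo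
  set Ψ : ℝ × ℝ → E × E := fun p => φ' (c p.1, p.2) with hΨ
  have hΨs : ContDiffOn ℝ ∞ Ψ (A ×ˢ Ioo (-δ') δ') := by
    refine hφ'.comp (ContDiffOn.prodMk (hcs.comp contDiffOn_fst fun p hp => hp.1.1)
      contDiffOn_snd) fun p hp => ⟨hp.1.2, hp.2⟩
  have hY : ContDiffOn ℝ ∞ (fun p => (Ψ p).1) (A ×ˢ Ioo (-δ') δ') :=
    contDiff_fst.comp_contDiffOn hΨs
  have hZ : ContDiffOn ℝ ∞ (fun p => (Ψ p).2) (A ×ˢ Ioo (-δ') δ') :=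
    contDiff_snd.comp_contDiffOn hΨs
  have hΨ0 : ∀ u ∈ A, Ψ (u, 0) = c u := fun u hu => (h' _ hu.2).1
  have hspray : ∀ u ∈ A, ∀ v ∈ Ioo (-δ') δ', (Ψ (u, v)).1 ∈ U ∧
      HasDerivAt (fun v => Ψ (u, v)) (spray g (Ψ (u, v))) v := fun u hu v hv =>
    ⟨((h' _ hu.2).2 v hv).1.1, ((h' _ hu.2).2 v hv).2⟩
  have hcd : ∀ u ∈ A, HasDerivAt c (a, -christoffelB g (c u).1 a (c u).2) u := fun u hu =>
    (h u hu.1).2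
  have hbasis : ∀ u ∈ A, (fun u => Ψ (u, 0)) =ᶠ[𝓝 u] c := fun u hu =>
    eventually_of_mem (hA.mem_nhds hu) hΨ0
  have hbd : ∀ u ∈ A, HasDerivAt (fun u => (Ψ (u, 0)).1) a u := fun u hu =>
    ((hcd u hu).congr_of_eventuallyEq (hbasis u hu)).fst
  have hZd : ∀ u ∈ A, HasDerivAt (fun u => (Ψ (u, 0)).2)
      (-christoffelB g (c u).1 a (c u).2) u := fun u hu =>
    ((hcd u hu).congr_of_eventuallyEq (hbasis u hu)).snd
  have h00 : ((0 : ℝ), (0 : ℝ)) ∈ A ×ˢ Ioo (-δ') δ' := ⟨hA0, hδ0'⟩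
  have hYd : HasFDerivAt (fun p => (Ψ p).1) (fderiv ℝ (fun p => (Ψ p).1) (0, 0)) (0, 0) :=
    ((hY.contDiffAt (hB.mem_nhds h00)).differentiableAt (by simp)).hasFDerivAt
  have e1 : fderiv ℝ (fun p => (Ψ p).1) (0, 0) (1, 0) = a :=
    HasDerivAt.unique (HasFDerivAt.comp_hasDerivAt (f := fun u : ℝ => (u, (0 : ℝ))) (0 : ℝ) hYd
      ((hasDerivAt_id (0 : ℝ)).prodMk (hasDerivAt_const (0 : ℝ) (0 : ℝ)))) (hbd 0 hA0)
  have e2 : fderiv ℝ (fun p => (Ψ p).1) (0, 0) (0, 1) = b := by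
    refine HasDerivAt.unique (hYd.comp_hasDerivAt (0 : ℝ)
      ((hasDerivAt_const (0 : ℝ) (0 : ℝ)).prodMk (hasDerivAt_id (0 : ℝ)))) ?_
    have := (hspray 0 hA0 0 hδ0').2.fst
    rw [hΨ0 0 hA0, hc0] at this
    exact this
  have hinj : Function.Injective (fderiv ℝ (fun p => (Ψ p).1) (0, 0)) := by
    have e3 : ∀ p : ℝ × ℝ, fderiv ℝ (fun p => (Ψ p).1) (0, 0) p = p.1 • a + p.2 • b := fun p => by
      rw [← e1, ← e2, ← map_smul, ← map_smul, ← map_add]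
      simp
    intro p q hpq
    rw [e3, e3] at hpq
    exact hab hpq
  -- At the origin the partial derivatives are `a` and `b`, which are independent; injectivity is an
  -- open condition on the derivative, so it persists nearby.
  have hev : ∀ᶠ p in 𝓝 ((0 : ℝ), (0 : ℝ)),
      Function.Injective (fderiv ℝ (fun p => (Ψ p).1) p) ∧ p ∈ A ×ˢ Ioo (-δ') δ' := by
    refine Filter.Eventually.and ?_ (hB.mem_nhds h00)
    have hct : ContinuousAt (fderiv ℝ (fun p => (Ψ p).1)) (0, 0) :=
      ((hY.contDiffAt (hB.mem_nhds h00)).fderiv_right (m := ∞) (by simp)).continuousAt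
    exact hct.eventually (ContinuousLinearMap.isOpen_injective.mem_nhds hinj)
  obtain ⟨ε, hε, hεs⟩ := Metric.eventually_nhds_iff_ball.1 hev
  rw [← ball_prod_same, Real.ball_eq_Ioo, zero_sub, zero_add] at hεs
  have hε0 : (0 : ℝ) ∈ Ioo (-ε) ε := ⟨by linarith, hε⟩
  have hsub : Ioo (-ε) ε ×ˢ Ioo (-ε) ε ⊆ A ×ˢ Ioo (-δ') δ' := fun p hp => (hεs p hp).2
  have hsubA : Ioo (-ε) ε ⊆ A := fun u hu => (hsub (a := (u, 0)) ⟨hu, hε0⟩).1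
  refine ⟨ε, hε, fun p => (Ψ p).1, fun p => (Ψ p).2, hY.mono hsub, hZ.mono hsub, ?_, ?_,
    fun u hu => ⟨hbd u (hsubA hu), ?_⟩, fun u hu v hv => ?_⟩
  · exact congrArg Prod.fst ((hΨ0 0 hA0).trans hc0)
  · exact congrArg Prod.snd ((hΨ0 0 hA0).trans hc0)
  · change deriv _ u + christoffelB g (Ψ (u, 0)).1 (deriv _ u) (Ψ (u, 0)).2 = 0
    rw [(hbd u (hsubA hu)).deriv, (hZd u (hsubA hu)).deriv, hΨ0 u (hsubA hu), neg_add_cancel]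
  · have hp := hsub (a := (u, v)) ⟨hu, hv⟩
    exact ⟨(hspray u hp.1 v hp.2).1, (hspray u hp.1 v hp.2).2, (hεs (u, v) ⟨hu, hv⟩).1⟩

variable {M : Type*} [TopologicalSpace M] [ChartedSpace E3 M] [IsManifold (𝓡 3) ∞ M]

lemma ofCoordVec_injective {x₀ x : M} (hx : x ∈ coordSource x₀) :
    Function.Injective (ofCoordVec x₀ x) := fun a b h => by
  rw [← coordVec_ofCoordVec hx a, h, coordVec_ofCoordVec hx]

variable [T2Space M]
  [RiemannianBundle (fun x : M => TangentSpace (𝓡 3) x)]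
  [IsContMDiffRiemannianBundle (𝓡 3) ∞ E3 (fun x : M => TangentSpace (𝓡 3) x)]

namespace IntrinsicCylinder

/-- There is a cylinder through every point, with prescribed basis direction and director. -/
lemma exists_of_chart (x₀ : M) {y₀ a b : E3} (hy₀ : y₀ ∈ coordTarget x₀)
    (hb : chartMetric x₀ y₀ b b = 1)
    (hab : Function.Injective fun p : ℝ × ℝ => p.1 • a + p.2 • b) :
    ∃ (C : IntrinsicCylinder M), 0 ∈ C.W ∧ C.param 0 = ofCoord x₀ y₀ ∧
      fderiv ℝ (coord x₀ ∘ C.param) 0 (1, 0) = a ∧ fderiv ℝ (coord x₀ ∘ C.param) 0 (0, 1) = b := by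
  obtain ⟨ε, hε, Y, Z, hY, hZ, hY0, hZ0, hbasis, hruling⟩ :=
    (isMetricOn_chartMetric x₀).exists_ruled_surface hy₀ hab
  have hε0 : (0 : ℝ) ∈ Ioo (-ε) ε := ⟨by linarith, hε⟩
  have hW : IsOpen (Ioo (-ε) ε ×ˢ Ioo (-ε) ε) := isOpen_Ioo.prod isOpen_Ioo
  have hbm : MapsTo (fun u : ℝ => (u, (0 : ℝ))) (Ioo (-ε) ε) (Ioo (-ε) ε ×ˢ Ioo (-ε) ε) :=
    fun u hu => ⟨hu, hε0⟩
  have hrm (u) (hu : u ∈ Ioo (-ε) ε) : MapsTo (fun v : ℝ => (u, v)) (Ioo (-ε) ε)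
    (Ioo (-ε) ε ×ˢ Ioo (-ε) ε) := fun v hv => ⟨hu, hv⟩
  have hYb : ContDiffOn ℝ ∞ (fun u : ℝ => Y (u, 0)) (Ioo (-ε) ε) :=
    hY.comp (by fun_prop) hbm
  have hZb : ContDiffOn ℝ ∞ (fun u : ℝ => Z (u, 0)) (Ioo (-ε) ε) :=
    hZ.comp (by fun_prop) hbm
  have hpar := isParallelOn_ofCoord (x₀ := x₀) isOpen_Ioo hYb hZb
    (fun u hu => (hruling u hu 0 hε0).1) fun u hu => (hbasis u hu).2
  have hgeo : ∀ u ∈ Ioo (-ε) ε, IsGeodesicOn (fun v => ofCoord x₀ (Y (u, v))) (Ioo (-ε) ε) ∧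
      ∀ v ∈ Ioo (-ε) ε, velocity (fun v => ofCoord x₀ (Y (u, v))) v =
        ofCoordVec x₀ (ofCoord x₀ (Y (u, v))) (Z (u, v)) := fun u hu =>
    isGeodesicOn_ofCoord isOpen_Ioo (hY.comp (by fun_prop) (hrm u hu))
      (fun v hv => (hruling u hu v hv).1) fun v hv => (hruling u hu v hv).2.1
  have hw : ∀ u ∈ Ioo (-ε) ε, (⟨ofCoord x₀ (Y (u, 0)), velocity (fun v => ofCoord x₀ (Y (u, v))) 0⟩ :
      TangentBundle (𝓡 3) M) = ⟨ofCoord x₀ (Y (u, 0)),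
        ofCoordVec x₀ (ofCoord x₀ (Y (u, 0))) (Z (u, 0))⟩ := fun u hu => by
    rw [(hgeo u hu).2 0 hε0]
  -- The curves `v ↦ Y(u, v)` are geodesics with initial velocity `Z(u, 0)`, so the surface built in
  -- the chart is the exponential parametrization that a cylinder requires.
  have hexp : ∀ p ∈ Ioo (-ε) ε ×ˢ Ioo (-ε) ε,
      expMap (⟨ofCoord x₀ (Y (p.1, 0)), p.2 • ofCoordVec x₀ (ofCoord x₀ (Y (p.1, 0)))
        (Z (p.1, 0))⟩ : TangentBundle (𝓡 3) M) = ofCoord x₀ (Y p) := fun p hp =>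
    expMap_smul isOpen_Ioo ordConnected_Ioo (hgeo p.1 hp.1).1 hε0 (hw p.1 hp.1) hp.2
  have hexp' : ∀ p ∈ Ioo (-ε) ε ×ˢ Ioo (-ε) ε, (fun p : ℝ × ℝ =>
      expMap (⟨ofCoord x₀ (Y (p.1, 0)), p.2 • ofCoordVec x₀ (ofCoord x₀ (Y (p.1, 0)))
        (Z (p.1, 0))⟩ : TangentBundle (𝓡 3) M)) =ᶠ[𝓝 p] fun p => ofCoord x₀ (Y p) := fun p hp =>
    eventually_of_mem (hW.mem_nhds hp) hexp
  have hYat : ∀ p ∈ Ioo (-ε) ε ×ˢ Ioo (-ε) ε, ContDiffAt ℝ ∞ Y p := fun p hp =>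
    hY.contDiffAt (hW.mem_nhds hp)
  have hmem : ∀ p ∈ Ioo (-ε) ε ×ˢ Ioo (-ε) ε, Y p ∈ coordTarget x₀ := fun p hp =>
    (hruling p.1 hp.1 p.2 hp.2).1
  let C : IntrinsicCylinder M :=
    { I := Ioo (-ε) ε
      isOpen_I := isOpen_Ioo
      ordConnected_I := ordConnected_Ioo
      nonempty_I := ⟨0, hε0⟩
      β := fun u => ofCoord x₀ (Y (u, 0))
      V := fun u => ofCoordVec x₀ (ofCoord x₀ (Y (u, 0))) (Z (u, 0))
      smooth_β := fun u hu => (contMDiffAt_ofCoord_comp (hYb.contDiffAt (isOpen_Ioo.mem_nhds hu))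
        (hmem _ (hbm hu))).contMDiffWithinAt
      regular_β := fun u hu h0 => by
        have h1 : velocity (fun u => ofCoord x₀ (Y (u, 0))) u =
            ofCoordVec x₀ (ofCoord x₀ (Y (u, 0))) a := by
          rw [← (hbasis u hu).1.deriv]
          exact mfderiv_ofCoord_comp (hYb.contDiffAt (isOpen_Ioo.mem_nhds hu)) (hmem _ (hbm hu)) 1
        rw [h1] at h0
        have ha : a = 0 := ofCoordVec_injective (ofCoord_mem (hmem _ (hbm hu)))
          (h0.trans (map_zero _).symm)
        have := @hab (1, 0) (0, 0) (by simp [ha])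
        simp at this
      parallel_V := hpar
      norm_V := fun u hu => by
        -- A parallel director has constant length, so `hb` at the origin suffices.
        rw [hpar.norm_eq isOpen_Ioo ordConnected_Ioo hu hε0, norm_eq_sqrt_real_inner,
          ← chartMetric_apply]
        change √(chartMetric x₀ (Y 0) (Z 0) (Z 0)) = 1
        rw [hY0, hZ0, hb, Real.sqrt_one]
      W := Ioo (-ε) ε ×ˢ Ioo (-ε) ε
      isOpen_W := hW
      fst_mem := fun p hp => hp.1
      basis_mem := fun u hu => hbm hu
      ordConnected_ruling := fun u hu => by
        have : {v : ℝ | (u, v) ∈ Ioo (-ε) ε ×ˢ Ioo (-ε) ε} = Ioo (-ε) ε := by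
          ext v
          exact and_iff_right hu
        rw [this]
        exact ordConnected_Ioo
      mem_expDomain := fun p hp => ⟨_, isExpCurve_scale isOpen_Ioo ordConnected_Ioo
        (hgeo p.1 hp.1).1 hε0 (hw p.1 hp.1) hp.2⟩
      smooth := fun p hp => ((contMDiffAt_ofCoord_comp (hYat p hp)
        (hmem p hp)).congr_of_eventuallyEq (hexp' p hp)).contMDiffWithinAt
      immersion := fun p hp => by
        rw [(hexp' p hp).mfderiv_eq]
        intro w w' hww
        refine (hruling p.1 hp.1 p.2 hp.2).2.2
          (ofCoordVec_injective (ofCoord_mem (hmem p hp)) ?_)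
        exact (mfderiv_ofCoord_comp (hYat p hp) (hmem p hp) w).symm.trans
          (hww.trans (mfderiv_ofCoord_comp (hYat p hp) (hmem p hp) w')) }
  have h0W : (0 : ℝ × ℝ) ∈ Ioo (-ε) ε ×ˢ Ioo (-ε) ε := ⟨hε0, hε0⟩
  have hcoord : coord x₀ ∘ C.param =ᶠ[𝓝 0] Y := by
    filter_upwards [hW.mem_nhds h0W] with p hp
    exact (congrArg (coord x₀) (hexp p hp)).trans (coord_ofCoord (hmem p hp))
  have hYd := ((hYat 0 h0W).differentiableAt (by simp)).hasFDerivAt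
  refine ⟨C, h0W, (hexp 0 h0W).trans (by rw [hY0]), ?_, ?_⟩ <;> rw [hcoord.fderiv_eq]
  · exact HasDerivAt.unique (HasFDerivAt.comp_hasDerivAt (f := fun u : ℝ => (u, (0 : ℝ))) (0 : ℝ) hYd
      ((hasDerivAt_id (0 : ℝ)).prodMk (hasDerivAt_const (0 : ℝ) (0 : ℝ)))) (hbasis 0 hε0).1
  · rw [← hZ0]
    exact HasDerivAt.unique (HasFDerivAt.comp_hasDerivAt (f := fun v : ℝ => ((0 : ℝ), v)) (0 : ℝ) hYd
      ((hasDerivAt_const (0 : ℝ) (0 : ℝ)).prodMk (hasDerivAt_id (0 : ℝ))))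
      (hruling 0 hε0 0 hε0).2.1.fst

end IntrinsicCylinder

/-- On a cylinder with basis direction `a` and director `b` at the given point, `axisDeriv` vanishes
identically, hence so does its derivative `R(b, a)b` along the ruling. Unit `b` independent of `a`
is all that the algebra of the curvature tensor needs. -/
lemma isFlat_of_axisParallel (h : ∀ C : IntrinsicCylinder M, C.AxisParallel) : IsFlat M := by
  intro x₀ y hy
  have hg := isMetricOn_chartMetric x₀
  refine hg.riemannCurvature_eq_zero hy fun a b hb hab => ?_
  obtain ⟨C, h0, hx, h1, h2⟩ := IntrinsicCylinder.exists_of_chart x₀ hy hb hab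
  have hsrc : C.param 0 ∈ coordSource x₀ := by
    rw [hx]
    exact ofCoord_mem hy
  have h3 := IntrinsicCylinder.coordVec_covDir_axisDeriv h0 hsrc
  have h4 : coordVec x₀ (C.param 0) (partialV C.param 0) = b :=
    (coordVec_mfderiv ((C.contMDiffAt_param h0).mdifferentiableAt (by simp)) hsrc (0, 1)).trans h2
  rw [covDir_eq_zero (eventually_of_mem (C.isOpen_W.mem_nhds h0)
    (IntrinsicCylinder.axisParallel_iff.1 (h C))), map_zero, h1, h2, h4, hx, coord_ofCoord hy] at h3
  have h5 : riemannCurvature (chartMetric x₀) y a b b =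
      -riemannCurvature (chartMetric x₀) y b a b := by
    simp only [hg.riemannCurvature_eq hy]
    abel
  rw [h5, ← h3, neg_zero]

end CylinderConstruction

end

theorem theorem3p1 {M : Type*} [TopologicalSpace M] [T2Space M] [ChartedSpace E3 M]
    [IsManifold (𝓡 3) ∞ M]
    [RiemannianBundle (fun x : M => TangentSpace (𝓡 3) x)]
    [IsContMDiffRiemannianBundle (𝓡 3) ∞ E3 (fun x : M => TangentSpace (𝓡 3) x)] :
    (∀ C : IntrinsicCylinder M,
      (C.AxisParallel ↔ C.IntrinsicallyFlat ∧ C.ExtrinsicallyFlat) ∧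
      (C.GeodesicsAreHelices ↔ C.IntrinsicallyFlat ∧ C.ExtrinsicallyFlat)) ∧
    (IsFlat M ↔ ∀ C : IntrinsicCylinder M, C.AxisParallel) ∧
    (IsFlat M ↔ ∀ C : IntrinsicCylinder M, C.GeodesicsAreHelices) := by
  refine ⟨fun C => ⟨C.axisParallel_iff_flat, C.geodesicsAreHelices_iff.trans C.axisParallel_iff_flat⟩,
    ⟨fun h C => C.axisParallel_of_isFlat h, isFlat_of_axisParallel⟩,
    ⟨fun h C => C.geodesicsAreHelices_iff.2 (C.axisParallel_of_isFlat h), fun h =>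
      isFlat_of_axisParallel fun C => C.geodesicsAreHelices_iff.1 (h C)⟩⟩
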